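/- Let $\Gamma$ be a finite metric graph: finitely many vertices $v\in V$ and finitely many edges $e\in E$, each edge being identified with an interval $I_e=[0,\ell_e]$, $0<\ell_e<\infty$ (internal edge), or $I_e=[0,\infty)$ (external edge). Put $L^2(\Gamma)=\bigoplus_e L^2(I_e)$ and $W^{k,2}(\Gamma)=\bigoplus_e W^{k,2}(I_e)$ (complex valued functions). For each vertex $v$ of degree $n_v$ (the number of edge ends at $v$) let $A_v,B_v\in\mathbb C^{n_v\times n_v}$, and let $\Delta_\Gamma f=(f_e'')_{e}$ with domain $$D(\Delta_\Gamma)=\{f\in W^{2,2}(\Gamma): A_v f(v)+B_v f'(v)=0 \text{ for all } v\in V\},$$ where $f(v),f'(v)\in\mathbb C^{n_v}$ are the vectors of the values of $f$, and of the derivatives of $f$ in the directions from $v$ into the edges, at the edge ends at $v$. Assume that $(\Delta_\Gamma,D(\Delta_\Gamma))$ is self-adjoint on $L^2(\Gamma)$, and let $(e^{it\Delta_\Gamma})_{t\in\mathbb R}$ be the strongly continuous group of isometries of $L^2(\Gamma)$ generated by $i\Delta_\Gamma$, which exists and is unique. At every vertex the condition $A_vf(v)+B_vf'(v)=0$ is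 equivalent to $P_{D,v}f(v)=0$, $P_{N,v}f'(v)=0$, $P_{R,v}f'(v)=\Lambda_vP_{R,v}f(v)$, where $P_{D,v},P_{N,v}$ are the orthogonal projections onto $\ker B_v$ and $\ker A_v$, $P_{D,v}P_{N,v}=0$, $P_{R,v}=I-P_{D,v}-P_{N,v}$, and $\Lambda_v$ is an invertible self-adjoint operator on the range of $P_{R,v}$. Let $$D(\mathcal E)=\{f\in W^{1,2}(\Gamma): P_{D,v}f(v)=0 \text{ for all } v\in V\},\qquad \mathcal E(f,f)=\sum_{e}\int_{I_e}|f_e'|^2\,dx+\sum_{v}\langle\Lambda_vP_{R,v}f(v),P_{R,v}f(v)\rangle .$$ There is $M>0$ such that $\|f\|_{D(\mathcal E)}=\sqrt{M\|f\|_{L^2(\Gamma)}^2+\mathcal E(f,f)}$ is well defined on $D(\mathcal E)$ and equivalent there to the norm of $W^{1,2}(\Gamma)$; $D(\mathcal E)$ carries such a norm. Let $\theta\in C_0^\infty(\mathbb R)$ be real valued with $\theta=1$ on $[0,1]$ and $\theta=0$ on $[2,\infty)$, let $\sigma\ge\frac12$, $R>0$, and $F:\mathbb C\to\mathbb C$,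 $F(z)=|z|^{2\sigma}z\,\theta(|z|^2/R)$. Let $T>0$ and $n\in C([0,T],\mathbb R)$. Then for every $u_0\in L^2(\Gamma)$ the equation $$u(t)=e^{i(n(t)-n(0))\Delta_\Gamma}u_0+i\int_0^t e^{i(n(t)-n(s))\Delta_\Gamma}F(u(s))\,ds,\qquad t\in[0,T],$$ has a unique solution $u\in C([0,T],L^2(\Gamma))$. If moreover $u_0\in D(\mathcal E)$ and $F(w)\in D(\mathcal E)$ for every $w\in D(\mathcal E)$, then $u\in C([0,T],D(\mathcal E))$. -/

import Mathlib

open MeasureTheory Filter Topology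
open scoped ContDiff

noncomputable section

/-- `g` is a weak derivative of `f` on the open set `J ⊆ ℝ`. -/
def HasWeakDeriv (J : Set ℝ) (f g : ℝ → ℂ) : Prop :=
  ∀ φ : ℝ → ℝ, ContDiff ℝ ∞ φ → HasCompactSupport φ → tsupport φ ⊆ J →
    ∫ x in J, deriv φ x • f x = -∫ x in J, φ x • g x

/-- The continuous version of `f` on the closed interval `K` takes the value `c` at `p`. -/
def HasBoundaryValue (K : Set ℝ) (f : ℝ → ℂ) (p : ℝ) (c : ℂ) : Prop :=
  ∃ g : ℝ → ℂ, ContinuousOn g K ∧ g =ᵐ[volume.restrict K] f ∧ g p = c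

/-- A finite metric graph with vertices `V`, internal edges `I` (segments of positive finite
length, with an initial and a terminal vertex) and external edges `X` (half-lines). Loops and
multiple edges are allowed. -/
structure MetricGraph (V I X : Type*) where
  /-- the initial vertex of an internal edge -/
  init : I → V
  /-- the terminal vertex of an internal edge -/
  term : I → V
  /-- the vertex of an external edge -/
  base : X → V
  /-- the length of an internal edge -/
  len : I → ℝ
  len_pos : ∀ e, 0 < len e

namespace MetricGraph

variable {V I X : Type*}

/-- The open interval underlying an edge. -/
def edge (Γ : MetricGraph V I X) : I ⊕ X → Set ℝ
  | .inl e => Set.Ioo 0 (Γ.len e)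
  | .inr _ => Set.Ioi 0

/-- The closed interval underlying an edge. -/
def closedEdge (Γ : MetricGraph V I X) : I ⊕ X → Set ℝ
  | .inl e => Set.Icc 0 (Γ.len e)
  | .inr _ => Set.Ici 0

/-- The Lebesgue measure on an edge. -/
abbrev edgeMeasure (Γ : MetricGraph V I X) (e : I ⊕ X) : Measure ℝ :=
  volume.restrict (Γ.edge e)

end MetricGraph

/-- The ends of edges: the initial and the terminal end of each internal edge, and the only end
of each external edge. -/
inductive EdgeEnd (I X : Type*)
  | start (e : I)
  | finish (e : I)
  | ext (e : X)
  deriving Fintype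

namespace MetricGraph

variable {V I X : Type*}

/-- The edge to which an end belongs. -/
def edgeOf : EdgeEnd I X → I ⊕ X
  | .start e => .inl e
  | .finish e => .inl e
  | .ext e => .inr e

/-- The vertex at which an end sits. -/
def vertexOf (Γ : MetricGraph V I X) : EdgeEnd I X → V
  | .start e => Γ.init e
  | .finish e => Γ.term e
  | .ext e => Γ.base e

/-- The coordinate of an end in the interval of its edge. -/
def coord (Γ : MetricGraph V I X) : EdgeEnd I X → ℝ
  | .start _ => 0
  | .finish e => Γ.len e
  | .ext _ => 0

/-- The sign that turns `d/dx` into the derivative in the direction from the vertex into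
the edge. -/
def outwardSign : EdgeEnd I X → ℂ
  | .start _ => 1
  | .finish _ => -1
  | .ext _ => 1

/-- The ends of edges at the vertex `v`; their number is the degree of `v`. -/
abbrev EndsAt (Γ : MetricGraph V I X) (v : V) : Type _ := {p : EdgeEnd I X // Γ.vertexOf p = v}

/-- The vector of the values at `v` of a quantity defined at all ends. -/
def atVertex (Γ : MetricGraph V I X) (x : EdgeEnd I X → ℂ) (v : V) :
    EuclideanSpace ℂ (Γ.EndsAt v) :=
  WithLp.toLp 2 fun p => x p

/-- `L²(Γ)`, the Hilbert space direct sum of the spaces `L²(I_e)`. -/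
abbrev L2 (Γ : MetricGraph V I X) : Type _ :=
  PiLp 2 fun e : I ⊕ X => Lp ℂ 2 (Γ.edgeMeasure e)

/-- `w` is the weak derivative of `u`, edge by edge. -/
def HasDeriv (Γ : MetricGraph V I X) (u w : Γ.L2) : Prop :=
  ∀ e, HasWeakDeriv (Γ.edge e) (u e) (w e)

/-- `x` is the family of the boundary values of `u` at all ends. -/
def HasValues (Γ : MetricGraph V I X) (u : Γ.L2) (x : EdgeEnd I X → ℂ) : Prop :=
  ∀ p, HasBoundaryValue (Γ.closedEdge (edgeOf p)) (u (edgeOf p)) (Γ.coord p) (x p)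

end MetricGraph

/-! ### The vertex conditions -/

section Vertex

variable {ι : Type*} [Fintype ι]

/-- The linear map of `ℂⁿ` given by a matrix. -/
def matrixMap (A : Matrix ι ι ℂ) : EuclideanSpace ℂ ι →ₗ[ℂ] EuclideanSpace ℂ ι where
  toFun x := WithLp.toLp 2 (A.mulVec x)
  map_add' x y := by ext i; simp [Matrix.mulVec_add]
  map_smul' c x := by ext i; simp [Matrix.mulVec_smul]

/-- The orthogonal projection `P_D` of the Dirichlet part of the condition `A x + B y = 0`. -/
def dirichletProj (B : Matrix ι ι ℂ) : EuclideanSpace ℂ ι →L[ℂ] EuclideanSpace ℂ ι :=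
  (LinearMap.ker (matrixMap B)).starProjection

/-- The orthogonal projection `P_N` of the Neumann part of the condition `A x + B y = 0`. -/
def neumannProj (A : Matrix ι ι ℂ) : EuclideanSpace ℂ ι →L[ℂ] EuclideanSpace ℂ ι :=
  (LinearMap.ker (matrixMap A)).starProjection

/-- The projection `P_R = 1 - P_D - P_N` of the Robin part. -/
def robinProj (A B : Matrix ι ι ℂ) : EuclideanSpace ℂ ι →L[ℂ] EuclideanSpace ℂ ι :=
  1 - dirichletProj B - neumannProj A

open Classical in
/-- The operator `Λ` of the Robin part `P_R y = Λ P_R x`: for `x` in the range of `P_R`,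
`Λ x = P_R y` for any `y` with `A x + B y = 0`. -/
def robinMap (A B : Matrix ι ι ℂ) (x : EuclideanSpace ℂ ι) : EuclideanSpace ℂ ι :=
  if h : ∃ y, matrixMap A x + matrixMap B y = 0 then robinProj A B h.choose else 0

/-- Whenever the condition `A x + B y = 0` is equivalent to a Dirichlet, a Neumann and a Robin
condition given by mutually orthogonal projections and an invertible `Λ` on the range of the
third one, these data are the ones defined above. -/
theorem vertex_decomposition (A B : Matrix ι ι ℂ)
    (PD PN PR L : EuclideanSpace ℂ ι →L[ℂ] EuclideanSpace ℂ ι)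
    (hD : IsStarProjection PD) (hN : IsStarProjection PN)
    (hDN : PD * PN = 0) (hND : PN * PD = 0) (hR : PR = 1 - PD - PN)
    (hL : ∀ x, PR (L (PR x)) = L (PR x)) (hinj : ∀ x, L (PR x) = 0 → PR x = 0)
    (h : ∀ x y, matrixMap A x + matrixMap B y = 0 ↔
      PD x = 0 ∧ PN y = 0 ∧ PR y = L (PR x)) :
    dirichletProj B = PD ∧ neumannProj A = PN ∧ robinProj A B = PR ∧
      ∀ x, robinMap A B (PR x) = L (PR x) := by
  have hDD : ∀ x, PD (PD x) = PD x := fun x => congrArg (· x) hD.isIdempotentElem.eq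
  have hNN : ∀ x, PN (PN x) = PN x := fun x => congrArg (· x) hN.isIdempotentElem.eq
  have hDN' : ∀ x, PD (PN x) = 0 := fun x => congrArg (· x) hDN
  have hND' : ∀ x, PN (PD x) = 0 := fun x => congrArg (· x) hND
  have hRx : ∀ x, PR x = x - PD x - PN x := fun x => by rw [hR]; rfl
  have hRR : ∀ x, PR (PR x) = PR x := fun x => by
    simp [hRx, hDD, hNN, hDN', hND']
  have hNR : ∀ x, PN (PR x) = 0 := fun x => by simp [hRx, hNN, hND']
  have hDR : ∀ x, PD (PR x) = 0 := fun x => by simp [hRx, hDD, hDN']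
  have eD : LinearMap.ker (matrixMap B) = PD.range := by
    ext y
    have h0 := h 0 y
    simp only [map_zero, zero_add, true_and] at h0
    rw [LinearMap.mem_ker, h0]
    constructor
    · rintro ⟨h1, h2⟩
      refine ⟨y, ?_⟩
      have := hRx y
      rw [h1, h2, sub_zero] at this
      exact (sub_eq_zero.mp this.symm).symm
    · rintro ⟨z, rfl⟩
      refine ⟨hND' z, ?_⟩
      change PR (PD z) = 0
      simp [hRx, hDD, hND']
  have eN : LinearMap.ker (matrixMap A) = PN.range := by
    ext x
    have h0 := h x 0
    simp only [map_zero, add_zero, true_and] at h0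
    rw [LinearMap.mem_ker, h0]
    constructor
    · rintro ⟨h1, h2⟩
      refine ⟨x, ?_⟩
      have := hRx x
      rw [h1, hinj x h2.symm, sub_zero] at this
      exact (sub_eq_zero.mp this.symm).symm
    · rintro ⟨z, rfl⟩
      refine ⟨hDN' z, ?_⟩
      have : PR (PN z) = 0 := by simp [hRx, hNN, hDN']
      change 0 = L (PR (PN z))
      rw [this, map_zero]
  have e1 : dirichletProj B = PD := by
    obtain ⟨i, hi⟩ := isStarProjection_iff_eq_starProjection_range.mp hD
    rw [hi, dirichletProj]
    congr 1
  have e2 : neumannProj A = PN := by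
    obtain ⟨i, hi⟩ := isStarProjection_iff_eq_starProjection_range.mp hN
    rw [hi, neumannProj]
    congr 1
  have e3 : robinProj A B = PR := by rw [robinProj, e1, e2, hR]
  refine ⟨e1, e2, e3, fun x => ?_⟩
  have hex : ∃ y, matrixMap A (PR x) + matrixMap B y = 0 := by
    refine ⟨L (PR x), (h _ _).mpr ⟨hDR x, ?_, ?_⟩⟩
    · rw [← hL x, hNR]
    · rw [hL, hRR]
  rw [robinMap, dif_pos hex, e3, ((h _ _).mp hex.choose_spec).2.2, hRR]

end Vertex

/-! ### Linearity of weak derivatives and boundary values -/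

section Linearity

theorem integrable_smul_of_test {J : Set ℝ} {φ : ℝ → ℝ} (hφ : Continuous φ)
    (hc : HasCompactSupport φ) {f : ℝ → ℂ} (hf : MemLp f 2 (volume.restrict J)) :
    Integrable (fun x => φ x • f x) (volume.restrict J) := by
  have h1 : MemLp φ 2 (volume.restrict J) :=
    (hφ.memLp_of_hasCompactSupport hc).restrict J
  exact memLp_one_iff_integrable.mp (MemLp.smul (r := 1) hf h1)

theorem HasWeakDeriv.congr {J : Set ℝ} {f g f₁ g₁ : ℝ → ℂ} (h : HasWeakDeriv J f g)
    (hf : f₁ =ᵐ[volume.restrict J] f) (hg : g₁ =ᵐ[volume.restrict J] g) :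
    HasWeakDeriv J f₁ g₁ := by
  intro φ h1 h2 h3
  have e1 : ∫ x in J, deriv φ x • f₁ x = ∫ x in J, deriv φ x • f x :=
    integral_congr_ae (hf.mono fun x hx => by simp only [hx])
  have e2 : ∫ x in J, φ x • g₁ x = ∫ x in J, φ x • g x :=
    integral_congr_ae (hg.mono fun x hx => by simp only [hx])
  rw [e1, e2]
  exact h φ h1 h2 h3

theorem HasWeakDeriv.add {J : Set ℝ} {f g f₁ g₁ : ℝ → ℂ}
    (hf : MemLp f 2 (volume.restrict J)) (hg : MemLp g 2 (volume.restrict J))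
    (hf₁ : MemLp f₁ 2 (volume.restrict J)) (hg₁ : MemLp g₁ 2 (volume.restrict J))
    (h : HasWeakDeriv J f g) (h₁ : HasWeakDeriv J f₁ g₁) :
    HasWeakDeriv J (f + f₁) (g + g₁) := by
  intro φ k1 k2 k3
  have d : Continuous (deriv φ) := k1.continuous_deriv (by simp)
  simp only [Pi.add_apply, smul_add]
  rw [integral_add (integrable_smul_of_test d k2.deriv hf)
      (integrable_smul_of_test d k2.deriv hf₁),
    integral_add (integrable_smul_of_test k1.continuous k2 hg)
      (integrable_smul_of_test k1.continuous k2 hg₁), h φ k1 k2 k3, h₁ φ k1 k2 k3]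
  ring

theorem HasWeakDeriv.const_smul {J : Set ℝ} {f g : ℝ → ℂ} (c : ℂ) (h : HasWeakDeriv J f g) :
    HasWeakDeriv J (c • f) (c • g) := by
  intro φ k1 k2 k3
  simp only [Pi.smul_apply, smul_comm _ c]
  rw [integral_smul, integral_smul, h φ k1 k2 k3, smul_neg]

theorem HasWeakDeriv.eq_zero {J : Set ℝ} (hJ : IsOpen J) {f g : ℝ → ℂ}
    (hg : MemLp g 2 (volume.restrict J)) (h : HasWeakDeriv J f g)
    (hf : f =ᵐ[volume.restrict J] 0) : g =ᵐ[volume.restrict J] 0 := by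
  have hloc : LocallyIntegrableOn g J volume := by
    intro x hx
    obtain ⟨ε, hε, hb⟩ := Metric.isOpen_iff.mp hJ x hx
    refine ⟨Metric.ball x ε, mem_nhdsWithin_of_mem_nhds (Metric.ball_mem_nhds x hε), ?_⟩
    have h2 : MemLp g 2 (volume.restrict (Metric.ball x ε)) :=
      hg.mono_measure (Measure.restrict_mono hb le_rfl)
    have : IsFiniteMeasure (volume.restrict (Metric.ball x ε)) :=
      ⟨by rw [Measure.restrict_apply_univ]; exact measure_ball_lt_top⟩
    exact h2.integrable (by norm_num)
  have key := hJ.ae_eq_zero_of_integral_contDiff_smul_eq_zero hloc (fun φ k1 k2 k3 => by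
    have e := h φ k1 k2 k3
    have e1 : ∫ x in J, deriv φ x • f x = 0 := by
      rw [integral_congr_ae (g := fun _ => (0 : ℂ)) (hf.mono fun x hx => by simp [hx])]
      simp
    rw [e1, eq_comm, neg_eq_zero] at e
    rw [← e]
    refine (setIntegral_eq_integral_of_forall_compl_eq_zero fun x hx => ?_).symm
    rw [image_eq_zero_of_notMem_tsupport fun hx' => hx (k3 hx'), zero_smul])
  exact (ae_restrict_iff' hJ.measurableSet).mpr key

theorem HasBoundaryValue.congr {K : Set ℝ} {f f₁ : ℝ → ℂ} {p : ℝ} {c : ℂ}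
    (h : HasBoundaryValue K f p c) (hf : f₁ =ᵐ[volume.restrict K] f) :
    HasBoundaryValue K f₁ p c := by
  obtain ⟨g, h1, h2, h3⟩ := h
  exact ⟨g, h1, h2.trans hf.symm, h3⟩

theorem HasBoundaryValue.add {K : Set ℝ} {f f₁ : ℝ → ℂ} {p : ℝ} {c c₁ : ℂ}
    (h : HasBoundaryValue K f p c) (h' : HasBoundaryValue K f₁ p c₁) :
    HasBoundaryValue K (f + f₁) p (c + c₁) := by
  obtain ⟨g, h1, h2, rfl⟩ := h
  obtain ⟨g', h1', h2', rfl⟩ := h'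
  exact ⟨g + g', h1.add h1', h2.add h2', rfl⟩

theorem HasBoundaryValue.const_smul {K : Set ℝ} {f : ℝ → ℂ} {p : ℝ} {c : ℂ} (a : ℂ)
    (h : HasBoundaryValue K f p c) : HasBoundaryValue K (a • f) p (a * c) := by
  obtain ⟨g, h1, h2, rfl⟩ := h
  exact ⟨a • g, h1.const_smul a, h2.const_smul a, rfl⟩

theorem HasBoundaryValue.zero (K : Set ℝ) (p : ℝ) : HasBoundaryValue K 0 p 0 :=
  ⟨0, continuousOn_const, EventuallyEq.rfl, rfl⟩

end Linearity

namespace MetricGraph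

variable {V I X : Type*}

theorem isOpen_edge (Γ : MetricGraph V I X) (e : I ⊕ X) : IsOpen (Γ.edge e) := by
  cases e
  · exact isOpen_Ioo
  · exact isOpen_Ioi

theorem restrict_closedEdge (Γ : MetricGraph V I X) (e : I ⊕ X) :
    volume.restrict (Γ.closedEdge e) = Γ.edgeMeasure e := by
  cases e
  · exact (restrict_Ioo_eq_restrict_Icc).symm
  · exact (restrict_Ioi_eq_restrict_Ici).symm

theorem HasDeriv.add {Γ : MetricGraph V I X} {u w u₁ w₁ : Γ.L2} (h : Γ.HasDeriv u w)
    (h₁ : Γ.HasDeriv u₁ w₁) : Γ.HasDeriv (u + u₁) (w + w₁) := fun e =>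
  (HasWeakDeriv.add (Lp.memLp _) (Lp.memLp _) (Lp.memLp _) (Lp.memLp _) (h e) (h₁ e)).congr
    (Lp.coeFn_add _ _) (Lp.coeFn_add _ _)

theorem HasDeriv.smul {Γ : MetricGraph V I X} {u w : Γ.L2} (c : ℂ) (h : Γ.HasDeriv u w) :
    Γ.HasDeriv (c • u) (c • w) := fun e =>
  ((h e).const_smul c).congr (Lp.coeFn_smul _ _) (Lp.coeFn_smul _ _)

theorem HasDeriv.zero (Γ : MetricGraph V I X) : Γ.HasDeriv 0 0 := fun e =>
  HasWeakDeriv.congr (f := 0) (g := 0) (fun φ _ _ _ => by simp)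
    (Lp.coeFn_zero _ _ _) (Lp.coeFn_zero _ _ _)

theorem HasDeriv.eq_zero {Γ : MetricGraph V I X} {w : Γ.L2} (h : Γ.HasDeriv 0 w) : w = 0 := by
  ext1 e
  refine Lp.ext ?_
  exact ((h e).eq_zero (Γ.isOpen_edge e) (Lp.memLp _) (Lp.coeFn_zero _ _ _)).trans
    (Lp.coeFn_zero _ _ _).symm

theorem HasValues.add {Γ : MetricGraph V I X} {u u₁ : Γ.L2} {x x₁ : EdgeEnd I X → ℂ}
    (h : Γ.HasValues u x) (h₁ : Γ.HasValues u₁ x₁) : Γ.HasValues (u + u₁) (x + x₁) := fun p =>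
  ((h p).add (h₁ p)).congr (by rw [restrict_closedEdge]; exact Lp.coeFn_add _ _)

theorem HasValues.smul {Γ : MetricGraph V I X} {u : Γ.L2} {x : EdgeEnd I X → ℂ} (c : ℂ)
    (h : Γ.HasValues u x) : Γ.HasValues (c • u) (c • x) := fun p =>
  ((h p).const_smul c).congr (by rw [restrict_closedEdge]; exact Lp.coeFn_smul _ _)

theorem HasValues.zero (Γ : MetricGraph V I X) : Γ.HasValues 0 0 := fun p =>
  (HasBoundaryValue.zero _ _).congr (by rw [restrict_closedEdge]; exact Lp.coeFn_zero _ _ _)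

/-! ### The Laplacian and its quadratic form -/

variable [DecidableEq V] [Fintype I] [Fintype X]

/-- Matrices `A_v`, `B_v` at every vertex, of size the degree of the vertex. -/
abbrev VertexMatrices (Γ : MetricGraph V I X) : Type _ :=
  ∀ v : V, Matrix (Γ.EndsAt v) (Γ.EndsAt v) ℂ

/-- The graph of `Δ_Γ`: the pairs `(u, u'')` with `u ∈ H²(Γ)` such that
`A_v u(v) + B_v u'(v) = 0` at every vertex, `u'(v)` being the vector of the derivatives in the
directions from `v` into the edges. -/
def laplacianGraph (Γ : MetricGraph V I X) (A B : Γ.VertexMatrices) :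
    Submodule ℂ (Γ.L2 × Γ.L2) where
  carrier := {q | ∃ (u' : Γ.L2) (x y : EdgeEnd I X → ℂ),
    Γ.HasDeriv q.1 u' ∧ Γ.HasDeriv u' q.2 ∧ Γ.HasValues q.1 x ∧ Γ.HasValues u' y ∧
    ∀ v, matrixMap (A v) (Γ.atVertex x v) +
      matrixMap (B v) (Γ.atVertex (fun p => outwardSign p * y p) v) = 0}
  add_mem' := by
    rintro q q₁ ⟨u', x, y, h1, h2, h3, h4, h5⟩ ⟨u₁', x₁, y₁, k1, k2, k3, k4, k5⟩
    refine ⟨u' + u₁', x + x₁, y + y₁, h1.add k1, h2.add k2, h3.add k3, h4.add k4, fun v => ?_⟩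
    have e1 : Γ.atVertex (x + x₁) v = Γ.atVertex x v + Γ.atVertex x₁ v := rfl
    have e2 : Γ.atVertex (fun p => outwardSign p * (y + y₁) p) v =
        Γ.atVertex (fun p => outwardSign p * y p) v +
          Γ.atVertex (fun p => outwardSign p * y₁ p) v := by
      ext p; exact mul_add _ _ _
    rw [e1, e2, map_add, map_add, add_add_add_comm, h5, k5, add_zero]
  zero_mem' := by
    refine ⟨0, 0, 0, HasDeriv.zero Γ, HasDeriv.zero Γ, HasValues.zero Γ, HasValues.zero Γ,
      fun v => ?_⟩
    have e1 : Γ.atVertex 0 v = 0 := rfl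
    have e2 : Γ.atVertex (fun p => outwardSign p * (0 : EdgeEnd I X → ℂ) p) v = 0 := by
      ext p; exact mul_zero _
    rw [e1, e2, map_zero, map_zero, add_zero]
  smul_mem' := by
    rintro c q ⟨u', x, y, h1, h2, h3, h4, h5⟩
    refine ⟨c • u', c • x, c • y, h1.smul c, h2.smul c, h3.smul c, h4.smul c, fun v => ?_⟩
    have e1 : Γ.atVertex (c • x) v = c • Γ.atVertex x v := rfl
    have e2 : Γ.atVertex (fun p => outwardSign p * (c • y) p) v =
        c • Γ.atVertex (fun p => outwardSign p * y p) v := by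
      ext p; exact mul_left_comm _ _ _
    rw [e1, e2, map_smul, map_smul, ← smul_add, h5, smul_zero]

/-- The operator `Δ_Γ` on `L²(Γ)` with the coupling conditions `A`, `B`. -/
def laplacian (Γ : MetricGraph V I X) (A B : Γ.VertexMatrices) : Γ.L2 →ₗ.[ℂ] Γ.L2 :=
  (Γ.laplacianGraph A B).toLinearPMap

theorem graph_laplacian (Γ : MetricGraph V I X) (A B : Γ.VertexMatrices) :
    (Γ.laplacian A B).graph = Γ.laplacianGraph A B := by
  refine Submodule.toLinearPMap_graph_eq _ ?_
  rintro ⟨u, w⟩ ⟨u', x, y, h1, h2, -⟩ h0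
  simp only at h0 h1 h2 ⊢
  subst h0
  obtain rfl := h1.eq_zero
  exact h2.eq_zero

open Classical in
/-- The weak derivative of `u ∈ W^{1,2}(Γ)`. -/
def grad (Γ : MetricGraph V I X) (u : Γ.L2) : Γ.L2 :=
  if h : ∃ w, Γ.HasDeriv u w then h.choose else 0

open Classical in
/-- The boundary values of `u ∈ W^{1,2}(Γ)`. -/
def values (Γ : MetricGraph V I X) (u : Γ.L2) : EdgeEnd I X → ℂ :=
  if h : ∃ x, Γ.HasValues u x then h.choose else 0

/-- The form domain `D(𝓔) = {u ∈ W^{1,2}(Γ) : P_{D,v} u(v) = 0 for all v}`. -/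
def energyDomain (Γ : MetricGraph V I X) (B : Γ.VertexMatrices) : Submodule ℂ Γ.L2 where
  carrier := {u | ∃ (w : Γ.L2) (x : EdgeEnd I X → ℂ), Γ.HasDeriv u w ∧ Γ.HasValues u x ∧
    ∀ v, dirichletProj (B v) (Γ.atVertex x v) = 0}
  add_mem' := by
    rintro u u₁ ⟨w, x, h1, h2, h3⟩ ⟨w₁, x₁, k1, k2, k3⟩
    refine ⟨w + w₁, x + x₁, h1.add k1, h2.add k2, fun v => ?_⟩
    have e1 : Γ.atVertex (x + x₁) v = Γ.atVertex x v + Γ.atVertex x₁ v := rfl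
    rw [e1, map_add, h3, k3, add_zero]
  zero_mem' := ⟨0, 0, HasDeriv.zero Γ, HasValues.zero Γ, fun v => by
    have e1 : Γ.atVertex 0 v = 0 := rfl
    rw [e1, map_zero]⟩
  smul_mem' := by
    rintro c u ⟨w, x, h1, h2, h3⟩
    refine ⟨c • w, c • x, h1.smul c, h2.smul c, fun v => ?_⟩
    have e1 : Γ.atVertex (c • x) v = c • Γ.atVertex x v := rfl
    rw [e1, map_smul, h3, smul_zero]

variable [Fintype V]

/-- The quadratic form
`𝓔(u,u) = ∑_e ∫ |u_e'|² + ∑_v ⟨Λ_v P_{R,v} u(v), P_{R,v} u(v)⟩`. -/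
def energy (Γ : MetricGraph V I X) (A B : Γ.VertexMatrices) (u : Γ.L2) : ℝ :=
  (∑ e, ∫ x in Γ.edge e, ‖Γ.grad u e x‖ ^ 2) +
    ∑ v, (inner ℂ (robinMap (A v) (B v) (robinProj (A v) (B v) (Γ.atVertex (Γ.values u) v)))
      (robinProj (A v) (B v) (Γ.atVertex (Γ.values u) v))).re

/-- `M > 0` is such that `√(M‖u‖² + 𝓔(u,u))` is well defined on `D(𝓔)` and equivalent there to
the norm of `W^{1,2}(Γ)`. -/
def IsFormConstant (Γ : MetricGraph V I X) (A B : Γ.VertexMatrices) (M : ℝ) : Prop :=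
  0 < M ∧ ∃ c C : ℝ, 0 < c ∧ ∀ u ∈ Γ.energyDomain B,
    c * (‖u‖ ^ 2 + ‖Γ.grad u‖ ^ 2) ≤ M * ‖u‖ ^ 2 + Γ.energy A B u ∧
    M * ‖u‖ ^ 2 + Γ.energy A B u ≤ C * (‖u‖ ^ 2 + ‖Γ.grad u‖ ^ 2)

/-- The norm of `D(𝓔)`. -/
def energyNorm (Γ : MetricGraph V I X) (A B : Γ.VertexMatrices) (M : ℝ) (u : Γ.L2) : ℝ :=
  √(M * ‖u‖ ^ 2 + Γ.energy A B u)

/-- `u ∈ C([0,T], D(𝓔))`. -/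
def ContinuousInEnergyDomain (Γ : MetricGraph V I X) (A B : Γ.VertexMatrices) (M T : ℝ)
    (u : ℝ → Γ.L2) : Prop :=
  (∀ t ∈ Set.Icc 0 T, u t ∈ Γ.energyDomain B) ∧
  ∀ t ∈ Set.Icc 0 T,
    Tendsto (fun s => Γ.energyNorm A B M (u s - u t)) (𝓝[Set.Icc 0 T] t) (𝓝 0)

end MetricGraph

/-- `S` is the strongly continuous group of isometries generated by `iΔ`, i.e. it is such a group
and its generator (with its domain) is exactly `iΔ`. -/
structure IsGroupGeneratedBy {H : Type*} [NormedAddCommGroup H] [NormedSpace ℂ H]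
    (Δ : H →ₗ.[ℂ] H) (S : ℝ → H →L[ℂ] H) : Prop where
  zero : S 0 = 1
  add : ∀ s t, S (s + t) = S s * S t
  continuous : ∀ f, Continuous fun t => S t f
  isometry : ∀ t f, ‖S t f‖ = ‖f‖
  generator : ∀ f g, (f, g) ∈ Δ.graph ↔ HasDerivAt (fun t => S t f) (Complex.I • g) 0

/-! ### The truncated nonlinearity and the mild equation -/

/-- `θ ∈ C_0^∞(ℝ)` with `θ = 1` on `[0,1]` and `θ = 0` on `[2,∞)`. -/
structure IsCutoff (θ : ℝ → ℝ) : Prop where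
  contDiff : ContDiff ℝ ∞ θ
  compact : HasCompactSupport θ
  eq_one : ∀ x ∈ Set.Icc (0 : ℝ) 1, θ x = 1
  eq_zero : ∀ x ∈ Set.Ici (2 : ℝ), θ x = 0

/-- `F(z) = |z|^{2σ} z θ(|z|²/R)`. -/
def truncF (θ : ℝ → ℝ) (σ R : ℝ) (z : ℂ) : ℂ :=
  ((‖z‖ ^ (2 * σ) * θ (‖z‖ ^ 2 / R) : ℝ) : ℂ) * z

namespace MetricGraph

variable {V I X : Type*}

/-- `F(u) = (F ∘ u_e)_e` for `u ∈ L²(Γ)`. -/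
def truncNonlin (Γ : MetricGraph V I X) (θ : ℝ → ℝ) (σ R : ℝ) (u : Γ.L2) : Γ.L2 :=
  open Classical in
  WithLp.toLp 2 fun e =>
    if h : MemLp (fun x => truncF θ σ R (u e x)) 2 (Γ.edgeMeasure e) then h.toLp else 0

/-- The case distinction in the definition of `F(u)` never falls into its second case. -/
theorem memLp_truncF (Γ : MetricGraph V I X) {θ : ℝ → ℝ} (hθ : IsCutoff θ) {σ R : ℝ}
    (hσ : 1 / 2 ≤ σ) (hR : 0 < R) (u : Γ.L2) (e : I ⊕ X) :
    MemLp (fun x => truncF θ σ R (u e x)) 2 (Γ.edgeMeasure e) := by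
  obtain ⟨K, hK⟩ := hθ.compact.exists_bound_of_continuous hθ.contDiff.continuous
  have hc : Continuous (truncF θ σ R) := by
    unfold truncF
    have h1 : Continuous fun z : ℂ => ‖z‖ ^ (2 * σ) :=
      continuous_norm.rpow_const fun _ => Or.inr (by linarith)
    have h2 : Continuous fun z : ℂ => θ (‖z‖ ^ 2 / R) :=
      hθ.contDiff.continuous.comp (by fun_prop)
    exact (Complex.continuous_ofReal.comp (h1.mul h2)).mul continuous_id
  have hb : ∀ z, ‖truncF θ σ R z‖ ≤ ((√(2 * R)) ^ (2 * σ) * K) * ‖z‖ := by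
    intro z
    have hK0 : 0 ≤ K := (norm_nonneg _).trans (hK 0)
    rw [truncF, norm_mul, Complex.norm_real]
    refine mul_le_mul_of_nonneg_right ?_ (norm_nonneg _)
    by_cases hz : 2 ≤ ‖z‖ ^ 2 / R
    · rw [hθ.eq_zero _ hz, mul_zero, norm_zero]
      positivity
    · rw [norm_mul, Real.norm_of_nonneg (Real.rpow_nonneg (norm_nonneg _) _)]
      refine mul_le_mul (Real.rpow_le_rpow (norm_nonneg _) ?_ (by linarith)) (hK _)
        (norm_nonneg _) (by positivity)
      refine Real.le_sqrt_of_sq_le ?_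
      rw [not_le, div_lt_iff₀ hR] at hz
      exact hz.le
  exact (Lp.memLp (u e)).of_le_mul (hc.comp_aestronglyMeasurable (Lp.memLp (u e)).1)
    (Eventually.of_forall fun x => hb _)

variable [Fintype I] [Fintype X]

/-- `u ∈ C([0,T], L²(Γ))` solves
`u(t) = S(n(t)-n(0)) u₀ + i ∫₀ᵗ S(n(t)-n(s)) F(u(s)) ds` for all `t ∈ [0,T]`. -/
structure IsMildSolution (Γ : MetricGraph V I X) (S : ℝ → Γ.L2 →L[ℂ] Γ.L2) (θ : ℝ → ℝ)
    (σ R T : ℝ) (n : ℝ → ℝ) (u₀ : Γ.L2) (u : ℝ → Γ.L2) : Prop where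
  continuousOn : ContinuousOn u (Set.Icc 0 T)
  eq : ∀ t ∈ Set.Icc 0 T, u t = S (n t - n 0) u₀ +
    Complex.I • ∫ s in (0 : ℝ)..t, S (n t - n s) (Γ.truncNonlin θ σ R (u s))

end MetricGraph

end

/-! ### Primitives of locally integrable functions -/

section Primitive

/-! The dispersion `n` is only continuous, but the interaction picture `v(t) = S(-n(t)) u(t)`
removes it: the mild equation becomes `v(t) = v₀ + ∫₀ᵗ G(s, v(s)) ds` with `G(s, f) = i S(-n(s))
F(S(n(s)) f)`. Since `F` is Lipschitz on `ℂ` and `S` consists of isometries, `G` is jointly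
continuous and Lipschitz in `f`, uniformly in `s`. The `k`-th Picard iterate has Lipschitz constant
at most `(KT)^k / k!`, so a high iterate contracts on all of `[0, T]`; this gives existence and
uniqueness in `L²`.

For the energy space a Lipschitz bound of `F` on `W^{1,2}` is not used. A growth bound suffices:
`‖F(w)‖ ≤ K ‖w‖` in `W^{1,2}`, because a Lipschitz function multiplies derivatives by at most `K`.
Let `L` be the square root of the resolvent `(M - Δ)⁻¹`. Then `D(𝓔)` is the range of `L`, its norm
is equivalent to `‖L⁻¹ f‖`, and `L` commutes with `S` (`exists_formSqrt`). The image under `L` of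
the ball of radius `r` is `{f : |⟨f, k⟩| ≤ r ‖L k‖ for all k}`, which is closed in `L²` and stable
under integration. So the Picard iteration stays in the images of the balls of radius `ρ(t) = ‖g₀‖
e^{Kt}`, where `K` is now the growth constant for preimages. Applied to `v(t) - v(s)`, the same
bound shows that `L⁻¹ v` is Lipschitz in time (`exists_volterra_solution_lift`). Applying the
strongly continuous `S(n(t))`, which commutes with `L`, gives continuity of `u` in `D(𝓔)`.

The link between operator and form comes from self-adjointness. Green's formula, tested with
functions of arbitrary boundary data, shows that the condition at each vertex is a Lagrangian
subspace (`isLagrangianCondition`). Hence the Robin term is a bounded form in the boundary values,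
and a trace inequality with a small constant in front of the gradient makes the shifted energy
coercive (`exists_isFormConstant`). Then `M - Δ` has a bounded nonnegative inverse `R`, and the
group is built as `exp(it(M - R⁻¹))`: the continuous functional calculus defines `R exp(it(M -
R⁻¹))`, and the factor `R` is removed by isometric extension from the dense range of `R`.

All facts about weak derivatives reduce to one: on an interval, a function with a weak derivative is
a primitive of it. -/

theorem AbsolutelyContinuousOnInterval.complex_ofReal {f : ℝ → ℝ} {a b : ℝ}
    (hf : AbsolutelyContinuousOnInterval f a b) :
    AbsolutelyContinuousOnInterval (fun x => (f x : ℂ)) a b := by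
  unfold AbsolutelyContinuousOnInterval at hf ⊢
  simpa [Complex.dist_eq, ← Complex.ofReal_sub, Real.dist_eq] using hf

theorem AbsolutelyContinuousOnInterval.const {X : Type*} [PseudoMetricSpace X] (c : X) (a b : ℝ) :
    AbsolutelyContinuousOnInterval (fun _ => c) a b := by
  unfold AbsolutelyContinuousOnInterval
  simpa using tendsto_const_nhds

theorem MeasureTheory.LocallyIntegrable.intervalIntegrable' {g : ℝ → ℂ}
    (h : LocallyIntegrable g volume) (a b : ℝ) : IntervalIntegrable g volume a b :=
  (h.integrableOn_isCompact isCompact_uIcc).intervalIntegrable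

theorem MeasureTheory.LocallyIntegrable.absolutelyContinuousOnInterval_primitive {g : ℝ → ℂ}
    (h : LocallyIntegrable g volume) (a b c : ℝ) :
    AbsolutelyContinuousOnInterval (fun x => ∫ t in c..x, g t) a b := by
  have key : ∀ a b : ℝ, c ∈ Set.uIcc a b →
      AbsolutelyContinuousOnInterval (fun x => ∫ t in c..x, g t) a b := by
    intro a b hc
    have hi := h.intervalIntegrable' a b
    have hre : IntervalIntegrable (fun t => (g t).re) volume a b := ⟨hi.1.re, hi.2.re⟩
    have him : IntervalIntegrable (fun t => (g t).im) volume a b := ⟨hi.1.im, hi.2.im⟩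
    have h1 := (hre.absolutelyContinuousOnInterval_intervalIntegral hc).complex_ofReal
    have h2 := (him.absolutelyContinuousOnInterval_intervalIntegral hc).complex_ofReal
    have h3 := h1.add (h2.const_smul Complex.I)
    convert! h3 using 1
    funext x
    simp only [Pi.add_apply, smul_eq_mul]
    have hi := h.intervalIntegrable' c x
    have hre : IntervalIntegrable (fun t => ((g t).re : ℂ)) volume c x :=
      ⟨hi.1.re.ofReal, hi.2.re.ofReal⟩
    have him : IntervalIntegrable (fun t => ((g t).im : ℂ)) volume c x :=
      ⟨hi.1.im.ofReal, hi.2.im.ofReal⟩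
    rw [← intervalIntegral.integral_ofReal, ← intervalIntegral.integral_ofReal,
      ← intervalIntegral.integral_const_mul, ← intervalIntegral.integral_add hre
        (him.const_mul _)]
    refine intervalIntegral.integral_congr fun t _ => ?_
    simp only [mul_comm Complex.I, Complex.re_add_im]
  -- The interval is enlarged until it contains the base point `c`.
  refine (key (min (min a b) c) (max (max a b) c) ?_).mono ?_
  · rw [Set.mem_uIcc]
    exact Or.inl ⟨min_le_right _ _, le_max_right _ _⟩
  · refine Set.uIcc_subset_uIcc ?_ ?_ <;> rw [Set.mem_uIcc] <;> left <;> simp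

/-- Integration of the derivative of a product of two primitives. -/
theorem MeasureTheory.LocallyIntegrable.integral_mul_primitive {g h : ℝ → ℂ}
    (hg : LocallyIntegrable g volume) (hh : LocallyIntegrable h volume) (c d : ℂ) (a b : ℝ) :
    ∫ x in a..b, (g x * (d + ∫ t in (0 : ℝ)..x, h t) + (c + ∫ t in (0 : ℝ)..x, g t) * h x) =
      (c + ∫ t in (0 : ℝ)..b, g t) * (d + ∫ t in (0 : ℝ)..b, h t) -
        (c + ∫ t in (0 : ℝ)..a, g t) * (d + ∫ t in (0 : ℝ)..a, h t) := by
  set U : ℝ → ℂ := fun x => c + ∫ t in (0 : ℝ)..x, g t with hU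
  set W : ℝ → ℂ := fun x => d + ∫ t in (0 : ℝ)..x, h t with hW
  have acU : ∀ a b, AbsolutelyContinuousOnInterval U a b := fun a b =>
    (AbsolutelyContinuousOnInterval.const c a b).add
      (hg.absolutelyContinuousOnInterval_primitive a b 0)
  have acW : ∀ a b, AbsolutelyContinuousOnInterval W a b := fun a b =>
    (AbsolutelyContinuousOnInterval.const d a b).add
      (hh.absolutelyContinuousOnInterval_primitive a b 0)
  have cU : Continuous U := continuous_const.add
    (intervalIntegral.continuous_primitive hg.intervalIntegrable' 0)
  have cW : Continuous W := continuous_const.add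
    (intervalIntegral.continuous_primitive hh.intervalIntegrable' 0)
  have hloc : LocallyIntegrable (fun x => g x * W x + U x * h x) volume := by
    refine LocallyIntegrable.add ?_ ?_
    · have := hg.smul_continuous cW
      simpa [mul_comm] using this
    · have := hh.continuous_smul cU
      simpa using this
  have acI := hloc.absolutelyContinuousOnInterval_primitive a b a
  -- The product minus the primitive of its almost everywhere derivative is absolutely continuous
  -- with derivative zero almost everywhere, hence constant.
  have acD := ((acU a b).smul (acW a b)).sub acI
  obtain ⟨C, hC⟩ := acD.const_of_ae_hasDerivAt_zero (by
    filter_upwards [LocallyIntegrable.ae_hasDerivAt_integral hg,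
      LocallyIntegrable.ae_hasDerivAt_integral hh,
      LocallyIntegrable.ae_hasDerivAt_integral hloc] with x h1 h2 h3 _
    have e1 : HasDerivAt U (g x) x := (h1 0).const_add c
    have e2 : HasDerivAt W (h x) x := (h2 0).const_add d
    have := (e1.mul e2).sub (h3 a)
    simpa using! this)
  have ha := hC a Set.left_mem_uIcc
  have hb := hC b Set.right_mem_uIcc
  simp only [Pi.sub_apply, smul_eq_mul, intervalIntegral.integral_same, sub_zero,
    Pi.mul_apply] at ha hb
  rw [← ha] at hb
  simp only [hU, hW] at hb ⊢
  linear_combination -hb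

/-- A primitive of `g`, extended by zero from the set `J`. -/
noncomputable def primitiveOn (J : Set ℝ) (g : ℝ → ℂ) (c : ℂ) (x : ℝ) : ℂ :=
  c + ∫ t in (0 : ℝ)..x, J.indicator g t

theorem locallyIntegrable_indicator_of_memLp {J : Set ℝ} (hJ : MeasurableSet J) {g : ℝ → ℂ}
    (hg : MemLp g 2 (volume.restrict J)) : LocallyIntegrable (J.indicator g) volume :=
  ((memLp_indicator_iff_restrict hJ).mpr hg).locallyIntegrable (by norm_num)

theorem continuous_primitiveOn {J : Set ℝ} (hJ : MeasurableSet J) {g : ℝ → ℂ}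
    (hg : MemLp g 2 (volume.restrict J)) (c : ℂ) : Continuous (primitiveOn J g c) :=
  continuous_const.add (intervalIntegral.continuous_primitive
    (locallyIntegrable_indicator_of_memLp hJ hg).intervalIntegrable' 0)

/-- The test function is the primitive of its own derivative, so this is the product formula on an
interval `(-N, N)` containing its support, where the boundary terms vanish. -/
theorem integral_deriv_smul_primitive {g : ℝ → ℂ} (hg : LocallyIntegrable g volume) (c : ℂ)
    {φ : ℝ → ℝ} (hφ : ContDiff ℝ ∞ φ) (hs : HasCompactSupport φ) :
    ∫ x, deriv φ x • (c + ∫ t in (0 : ℝ)..x, g t) = -∫ x, φ x • g x := by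
  obtain ⟨N, hN⟩ := hs.isCompact.isBounded.subset_ball (0 : ℝ)
  have hsub : tsupport φ ⊆ Set.Ioo (-N) N := by
    rwa [Real.ball_eq_Ioo, zero_sub, zero_add] at hN
  have hd : Continuous (deriv φ) := hφ.continuous_deriv (by simp)
  have hdiff : Differentiable ℝ φ := hφ.differentiable (by simp)
  have hgc : LocallyIntegrable (fun x => ((deriv φ x : ℝ) : ℂ)) volume :=
    (Complex.continuous_ofReal.comp hd).locallyIntegrable
  have hprim : ∀ x, ((φ 0 : ℝ) : ℂ) + ∫ t in (0 : ℝ)..x, ((deriv φ t : ℝ) : ℂ) = φ x := by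
    intro x
    rw [intervalIntegral.integral_ofReal, intervalIntegral.integral_deriv_eq_sub
      (fun x _ => hdiff x) (hd.intervalIntegrable _ _)]
    push_cast
    ring
  have key := hgc.integral_mul_primitive hg (φ 0 : ℝ) c (-N) N
  simp only [hprim] at key
  have z1 : φ N = 0 := image_eq_zero_of_notMem_tsupport fun h => lt_irrefl _ (hsub h).2
  have z2 : φ (-N) = 0 := image_eq_zero_of_notMem_tsupport fun h => lt_irrefl _ (hsub h).1
  rw [z1, z2] at key
  have cU : Continuous fun x => c + ∫ t in (0 : ℝ)..x, g t := continuous_const.add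
    (intervalIntegral.continuous_primitive hg.intervalIntegrable' 0)
  have i1 : Integrable (fun x => deriv φ x • (c + ∫ t in (0 : ℝ)..x, g t)) volume :=
    (hd.smul cU).integrable_of_hasCompactSupport (hs.deriv.smul_right)
  have i2 : Integrable (fun x => φ x • g x) volume :=
    hg.integrable_smul_left_of_hasCompactSupport hφ.continuous hs
  rw [eq_neg_iff_add_eq_zero, ← integral_add i1 i2]
  rw [← intervalIntegral.integral_eq_integral_of_support_subset (a := -N) (b := N)]
  · simpa only [Complex.real_smul, Complex.ofReal_zero, zero_mul, sub_self] using key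
  · intro x hx
    by_contra hx'
    have hx2 : x ∉ tsupport φ := fun h => hx' ⟨(hsub h).1, (hsub h).2.le⟩
    have hx3 : x ∉ tsupport (deriv φ) := fun h => hx2 (tsupport_deriv_subset h)
    exact hx (by simp [image_eq_zero_of_notMem_tsupport hx2,
      image_eq_zero_of_notMem_tsupport hx3])

theorem setIntegral_eq_integral_of_tsupport_subset {J : Set ℝ} {φ : ℝ → ℝ}
    (hs : tsupport φ ⊆ J) (f : ℝ → ℂ) : ∫ x in J, φ x • f x = ∫ x, φ x • f x :=
  setIntegral_eq_integral_of_forall_compl_eq_zero fun x hx => by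
    rw [image_eq_zero_of_notMem_tsupport fun hx' => hx (hs hx'), zero_smul]

theorem hasWeakDeriv_primitiveOn {J : Set ℝ} (hJ : MeasurableSet J) {g : ℝ → ℂ}
    (hg : MemLp g 2 (volume.restrict J)) (c : ℂ) : HasWeakDeriv J (primitiveOn J g c) g := by
  intro φ h1 h2 h3
  have e : ∫ x in J, φ x • g x = ∫ x in J, φ x • J.indicator g x :=
    setIntegral_congr_fun hJ fun x hx => by simp [Set.indicator_of_mem hx]
  rw [e, setIntegral_eq_integral_of_tsupport_subset h3,
    setIntegral_eq_integral_of_tsupport_subset (tsupport_deriv_subset.trans h3)]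
  exact integral_deriv_smul_primitive (locallyIntegrable_indicator_of_memLp hJ hg) c h1 h2

/-- The du Bois-Reymond lemma on an open interval. -/
theorem ae_eq_const_of_integral_deriv_smul_eq_zero {J : Set ℝ} (hJ : IsOpen J)
    (hc : J.OrdConnected) {f : ℝ → ℂ} (hf : LocallyIntegrable f volume)
    (h : ∀ φ : ℝ → ℝ, ContDiff ℝ ∞ φ → HasCompactSupport φ → tsupport φ ⊆ J →
      ∫ x, deriv φ x • f x = 0) :
    ∃ c, ∀ᵐ x, x ∈ J → f x = c := by
  rcases J.eq_empty_or_nonempty with rfl | ⟨x₀, hx₀⟩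
  · exact ⟨0, by simp⟩
  obtain ⟨ε, hε, hball⟩ := Metric.isOpen_iff.mp hJ x₀ hx₀
  -- A reference test function `ψ` of integral one; the constant will be `c = ∫ ψ f`.
  let b : ContDiffBump x₀ := ⟨ε / 4, ε / 2, by positivity, by linarith⟩
  set ψ : ℝ → ℝ := b.normed volume with hψ
  have ψ1 : ContDiff ℝ ∞ ψ := b.contDiff_normed
  have ψ2 : HasCompactSupport ψ := b.hasCompactSupport_normed
  have ψ3 : tsupport ψ ⊆ J := by
    rw [hψ, b.tsupport_normed_eq]
    exact (Metric.closedBall_subset_ball (by simp only [b]; linarith)).trans hball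
  have ψ4 : ∫ x, ψ x = 1 := b.integral_normed
  have ψ5 : (tsupport ψ).Nonempty := by
    rw [hψ, b.tsupport_normed_eq]
    exact ⟨x₀, Metric.mem_closedBall_self b.rOut_pos.le⟩
  have iφ : ∀ φ : ℝ → ℝ, ContDiff ℝ ∞ φ → HasCompactSupport φ →
      Integrable (fun x => φ x • f x) volume := fun φ k1 k2 =>
    hf.integrable_smul_left_of_hasCompactSupport k1.continuous k2
  set c := ∫ x, ψ x • f x with hcdef
  refine ⟨c, ?_⟩
  have key : ∀ φ : ℝ → ℝ, ContDiff ℝ ∞ φ → HasCompactSupport φ → tsupport φ ⊆ J →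
      ∫ x, φ x • (f x - c) = 0 := by
    intro φ k1 k2 k3
    set m := ∫ x, φ x with hm
    -- Subtracting the multiple of `ψ` with the same integral leaves mean zero, so the primitive `H`
    -- of `η` is again a test function in `J`, and the hypothesis applies to it.
    set η : ℝ → ℝ := fun x => φ x - m * ψ x with hη
    have η1 : ContDiff ℝ ∞ η := k1.sub (contDiff_const.mul ψ1)
    have iφ0 : Integrable φ volume := k1.continuous.integrable_of_hasCompactSupport k2
    have iψ0 : Integrable ψ volume := ψ1.continuous.integrable_of_hasCompactSupport ψ2
    have η2 : ∫ x, η x = 0 := by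
      rw [hη, integral_sub iφ0 (iψ0.const_mul m), integral_const_mul, ψ4, mul_one, sub_self]
    set C := tsupport φ ∪ tsupport ψ with hC
    have hCc : IsCompact C := k2.isCompact.union ψ2.isCompact
    have hCn : C.Nonempty := ψ5.inr
    have hCJ : C ⊆ J := Set.union_subset k3 ψ3
    set α := sInf C
    set β := sSup C
    have hα : α ∈ C := hCc.sInf_mem hCn
    have hβ : β ∈ C := hCc.sSup_mem hCn
    have hCI : C ⊆ Set.Icc α β := fun x hx =>
      ⟨csInf_le hCc.bddBelow hx, le_csSup hCc.bddAbove hx⟩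
    have ηz : ∀ x, x ∉ Set.Icc α β → η x = 0 := by
      intro x hx
      have hx' : x ∉ C := fun h => hx (hCI h)
      have a1 : φ x = 0 := image_eq_zero_of_notMem_tsupport fun h => hx' (Or.inl h)
      have a2 : ψ x = 0 := image_eq_zero_of_notMem_tsupport fun h => hx' (Or.inr h)
      simp [hη, a1, a2]
    -- The lower limit is `α - 1` because the intervals of integration are open on the left and `α`
    -- must be interior.
    set H : ℝ → ℝ := fun x => ∫ t in (α - 1)..x, η t with hH
    have Hd : ∀ x, HasDerivAt H (η x) x := fun x =>
      intervalIntegral.integral_hasDerivAt_right (η1.continuous.intervalIntegrable _ _)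
        η1.continuous.stronglyMeasurable.stronglyMeasurableAtFilter η1.continuous.continuousAt
    have Hd' : deriv H = η := funext fun x => (Hd x).deriv
    have H1 : ContDiff ℝ ∞ H := by
      rw [contDiff_infty_iff_deriv, Hd']
      exact ⟨fun x => (Hd x).differentiableAt, η1⟩
    have Hz : Function.support H ⊆ Set.Icc α β := by
      intro x hx
      by_contra hx'
      apply hx
      rcases lt_or_ge x α with hlt | hge
      · rw [hH]
        have : ∫ t in (α - 1)..x, η t = ∫ t in (α - 1)..x, (0 : ℝ) := by
          refine intervalIntegral.integral_congr fun t ht => ηz t fun h => ?_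
          rw [Set.mem_uIcc] at ht
          rcases ht with ht | ht <;> linarith [h.1, ht.1, ht.2]
        simpa using this
      · have hgt : β < x := by
          by_contra hle
          exact hx' ⟨hge, not_lt.mp hle⟩
        rw [hH, ← η2]
        refine intervalIntegral.integral_eq_integral_of_support_subset fun t ht => ?_
        have : t ∈ Set.Icc α β := by
          by_contra hh
          exact ht (ηz t hh)
        exact ⟨by linarith [this.1], by linarith [this.2]⟩
    have Ht : tsupport H ⊆ Set.Icc α β := closure_minimal Hz isClosed_Icc
    have H2 : HasCompactSupport H := isCompact_Icc.of_isClosed_subset (isClosed_tsupport _) Ht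
    have H3 : tsupport H ⊆ J := Ht.trans (hc.out (hCJ hα) (hCJ hβ))
    have e := h H H1 H2 H3
    rw [Hd'] at e
    have e2 : ∫ x, η x • f x = (∫ x, φ x • f x) - m • c := by
      have i3 : Integrable (fun x => m • ψ x • f x) volume := (iφ ψ ψ1 ψ2).smul m
      rw [hcdef, ← integral_smul, ← integral_sub (iφ φ k1 k2) i3]
      refine integral_congr_ae (Eventually.of_forall fun x => ?_)
      simp only [hη, sub_smul, mul_smul]
    have e3 : ∫ x, φ x • (f x - c) = (∫ x, φ x • f x) - m • c := by
      rw [hm, ← integral_smul_const, ← integral_sub (iφ φ k1 k2) (iφ0.smul_const c)]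
      simp only [smul_sub]
    rw [e3, ← e2, e]
  have hloc : LocallyIntegrableOn (fun x => f x - c) J volume :=
    (hf.sub (locallyIntegrable_const c)).locallyIntegrableOn J
  filter_upwards [hJ.ae_eq_zero_of_integral_contDiff_smul_eq_zero hloc key] with x hx hxJ
  exact sub_eq_zero.mp (hx hxJ)

/-- A function with a weak derivative on an open interval is a primitive. -/
theorem HasWeakDeriv.exists_primitiveOn {J : Set ℝ} (hJ : IsOpen J) (hc : J.OrdConnected)
    {f g : ℝ → ℂ} (hf : MemLp f 2 (volume.restrict J)) (hg : MemLp g 2 (volume.restrict J))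
    (h : HasWeakDeriv J f g) : ∃ c, f =ᵐ[volume.restrict J] primitiveOn J g c := by
  have hP := continuous_primitiveOn hJ.measurableSet hg 0
  have lf := locallyIntegrable_indicator_of_memLp hJ.measurableSet hf
  -- The function and the primitive of its weak derivative have the same weak derivative, so their
  -- difference is constant.
  obtain ⟨c, hc⟩ := ae_eq_const_of_integral_deriv_smul_eq_zero hJ hc
    (f := fun x => J.indicator f x - primitiveOn J g 0 x)
    (lf.sub hP.locallyIntegrable) (fun φ k1 k2 k3 => by
      have dc : Continuous (deriv φ) := k1.continuous_deriv (by simp)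
      have hsub := tsupport_deriv_subset.trans k3
      simp only [smul_sub]
      rw [integral_sub (lf.integrable_smul_left_of_hasCompactSupport dc k2.deriv)
        (hP.locallyIntegrable.integrable_smul_left_of_hasCompactSupport dc k2.deriv),
        ← setIntegral_eq_integral_of_tsupport_subset hsub,
        ← setIntegral_eq_integral_of_tsupport_subset hsub,
        hasWeakDeriv_primitiveOn hJ.measurableSet hg 0 φ k1 k2 k3, ← h φ k1 k2 k3, sub_eq_zero]
      exact setIntegral_congr_fun hJ.measurableSet fun x hx => by simp [Set.indicator_of_mem hx])
  refine ⟨c, (ae_restrict_iff' hJ.measurableSet).mpr ?_⟩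
  filter_upwards [hc] with x hx hxJ
  have := hx hxJ
  rw [Set.indicator_of_mem hxJ, sub_eq_iff_eq_add] at this
  rw [this]
  simp [primitiveOn]

end Primitive

/-! ### Estimates and integration by parts on one edge -/

section Edge

/-- Functions continuous on `K` and equal almost everywhere there agree on all of `K`, since every
nonempty relatively open part of `K` has positive measure. So any continuous version computes the
boundary value. -/
theorem HasBoundaryValue.eq_of_ae_eq {K : Set ℝ} (hK : K ⊆ closure (interior K)) {f P : ℝ → ℂ}
    {p : ℝ} {z : ℂ} (hp : p ∈ K) (h : HasBoundaryValue K f p z) (hP : Continuous P)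
    (hf : f =ᵐ[volume.restrict K] P) : z = P p := by
  obtain ⟨g, h1, h2, rfl⟩ := h
  exact Measure.eqOn_of_ae_eq (h2.trans hf) h1 hP.continuousOn hK hp

/-- Cauchy–Schwarz against the constant one, in the form that the variance of `‖g‖` is nonnegative;
`a / (β - α)` is the mean. -/
theorem sq_setIntegral_norm_le {α β : ℝ} (hαβ : α < β) {g : ℝ → ℂ}
    (hg : MemLp g 2 (volume.restrict (Set.Ioo α β))) :
    (∫ x in Set.Ioo α β, ‖g x‖) ^ 2 ≤ (β - α) * ∫ x in Set.Ioo α β, ‖g x‖ ^ 2 := by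
  have : IsFiniteMeasure (volume.restrict (Set.Ioo α β)) :=
    ⟨by rw [Measure.restrict_apply_univ]; exact measure_Ioo_lt_top⟩
  have i1 : Integrable (fun x => ‖g x‖) (volume.restrict (Set.Ioo α β)) :=
    (hg.integrable (by norm_num)).norm
  have i2 : Integrable (fun x => ‖g x‖ ^ 2) (volume.restrict (Set.Ioo α β)) :=
    hg.integrable_norm_pow (by norm_num)
  set a := ∫ x in Set.Ioo α β, ‖g x‖ with ha
  have hd : 0 < β - α := by linarith
  have h0 : 0 ≤ ∫ x in Set.Ioo α β, (‖g x‖ - a / (β - α)) ^ 2 :=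
    integral_nonneg fun x => sq_nonneg _
  have e : ∫ x in Set.Ioo α β, (‖g x‖ - a / (β - α)) ^ 2 =
      (∫ x in Set.Ioo α β, ‖g x‖ ^ 2) - 2 * (a / (β - α)) * a +
        (β - α) * (a / (β - α)) ^ 2 := by
    have : ∀ x, (‖g x‖ - a / (β - α)) ^ 2 =
        ‖g x‖ ^ 2 - 2 * (a / (β - α)) * ‖g x‖ + (a / (β - α)) ^ 2 := fun x => by ring
    simp only [this]
    have i3 : Integrable (fun x => ‖g x‖ ^ 2 - 2 * (a / (β - α)) * ‖g x‖)
        (volume.restrict (Set.Ioo α β)) := i2.sub (i1.const_mul _)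
    rw [integral_add i3 (integrable_const _), integral_sub i2 (i1.const_mul _), integral_const_mul, ← ha, setIntegral_const]
    simp [hd.le]
  rw [e] at h0
  have : 2 * (a / (β - α)) * a - (β - α) * (a / (β - α)) ^ 2 = a ^ 2 / (β - α) := by
    field_simp
    ring
  have h1 : a ^ 2 / (β - α) ≤ ∫ x in Set.Ioo α β, ‖g x‖ ^ 2 := by linarith
  rw [div_le_iff₀ hd] at h1
  linarith

/-- The values at `p` and at `x` differ by at most `∫ ‖g‖`; square this and average over `x ∈ (α,
β)`. The length `β - α` is left free: a short interval puts a small factor in front of the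
derivative, which is what makes the vertex terms of the energy harmless. -/
theorem norm_sq_primitiveOn_le {J : Set ℝ} (hJ : MeasurableSet J) {f g : ℝ → ℂ} {c : ℂ}
    (hf : MemLp f 2 (volume.restrict J)) (hg : MemLp g 2 (volume.restrict J))
    (hfg : f =ᵐ[volume.restrict J] primitiveOn J g c) {α β p : ℝ} (hαβ : α < β)
    (hs : Set.Ioo α β ⊆ J) (hp : p ∈ Set.Icc α β) :
    ‖primitiveOn J g c p‖ ^ 2 ≤
      2 * (β - α) * (∫ x in J, ‖g x‖ ^ 2) + 2 / (β - α) * ∫ x in J, ‖f x‖ ^ 2 := by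
  have hd : 0 < β - α := by linarith
  have hloc := locallyIntegrable_indicator_of_memLp hJ hg
  set P := primitiveOn J g c with hP
  have hgI : MemLp g 2 (volume.restrict (Set.Ioo α β)) :=
    hg.mono_measure (Measure.restrict_mono hs le_rfl)
  have hfI : MemLp f 2 (volume.restrict (Set.Ioo α β)) :=
    hf.mono_measure (Measure.restrict_mono hs le_rfl)
  have : IsFiniteMeasure (volume.restrict (Set.Ioo α β)) :=
    ⟨by rw [Measure.restrict_apply_univ]; exact measure_Ioo_lt_top⟩
  set a := ∫ x in Set.Ioo α β, ‖g x‖ with ha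
  have ha0 : 0 ≤ a := integral_nonneg fun x => norm_nonneg _
  have hdiff : ∀ x ∈ Set.Ioo α β, ‖P p‖ ^ 2 ≤ 2 * ‖P x‖ ^ 2 + 2 * a ^ 2 := by
    intro x hx
    have e : P p - P x = ∫ t in x..p, J.indicator g t := by
      simp only [hP, primitiveOn, add_sub_add_left_eq_sub]
      exact intervalIntegral.integral_interval_sub_left (hloc.intervalIntegrable' _ _)
        (hloc.intervalIntegrable' _ _)
    have h1 : ‖P p - P x‖ ≤ a := by
      rw [e]
      refine (intervalIntegral.norm_integral_le_integral_norm_uIoc).trans ?_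
      have hsub : Set.uIoc x p ⊆ Set.Ioc α β := by
        intro t ht
        rw [Set.mem_uIoc] at ht
        rcases ht with ht | ht
        · exact ⟨hx.1.trans ht.1, ht.2.trans hp.2⟩
        · exact ⟨hp.1.trans_lt ht.1, ht.2.trans hx.2.le⟩
      have hab : a = ∫ t in Set.Ioc α β, ‖J.indicator g t‖ := by
        rw [ha, integral_Ioc_eq_integral_Ioo]
        exact setIntegral_congr_fun measurableSet_Ioo fun t ht => by
          simp [Set.indicator_of_mem (hs ht)]
      rw [hab]
      refine setIntegral_mono_set ?_ (Eventually.of_forall fun t => norm_nonneg _)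
        hsub.eventuallyLE
      exact ((hloc.integrableOn_isCompact (isCompact_Icc (a := α) (b := β))).mono_set
        Set.Ioc_subset_Icc_self).norm
    have h2 : ‖P p‖ ≤ ‖P x‖ + a := by
      have := norm_add_le (P x) (P p - P x)
      rw [add_sub_cancel] at this
      linarith
    have h3 : ‖P p‖ ^ 2 ≤ (‖P x‖ + a) ^ 2 := pow_le_pow_left₀ (norm_nonneg _) h2 2
    nlinarith [sq_nonneg (‖P x‖ - a)]
  have i2 : Integrable (fun x => ‖f x‖ ^ 2) (volume.restrict (Set.Ioo α β)) :=
    hfI.integrable_norm_pow (by norm_num)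
  have hae : ∀ᵐ x ∂volume.restrict (Set.Ioo α β), ‖P p‖ ^ 2 ≤ 2 * ‖f x‖ ^ 2 + 2 * a ^ 2 := by
    filter_upwards [ae_restrict_of_ae_restrict_of_subset hs hfg,
      ae_restrict_mem measurableSet_Ioo] with x hx hxI
    rw [hx]
    exact hdiff x hxI
  have hint := integral_mono_ae (integrable_const _) ((i2.const_mul 2).add (integrable_const _)) hae
  have e1 : ∫ x in Set.Ioo α β, ‖P p‖ ^ 2 = (β - α) * ‖P p‖ ^ 2 := by
    rw [setIntegral_const]; simp [hd.le]
  have e2 : ∫ x in Set.Ioo α β, (2 * ‖f x‖ ^ 2 + 2 * a ^ 2) =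
      2 * (∫ x in Set.Ioo α β, ‖f x‖ ^ 2) + (β - α) * (2 * a ^ 2) := by
    rw [integral_add (i2.const_mul 2) (integrable_const _), integral_const_mul, setIntegral_const]
    simp [hd.le]
  have hint' : (β - α) * ‖P p‖ ^ 2 ≤
      2 * (∫ x in Set.Ioo α β, ‖f x‖ ^ 2) + (β - α) * (2 * a ^ 2) := by
    rw [← e1, ← e2]; exact hint
  have m1 : ∫ x in Set.Ioo α β, ‖f x‖ ^ 2 ≤ ∫ x in J, ‖f x‖ ^ 2 :=
    setIntegral_mono_set (hf.integrable_norm_pow (by norm_num))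
      (Eventually.of_forall fun t => by positivity) hs.eventuallyLE
  have m2 : ∫ x in Set.Ioo α β, ‖g x‖ ^ 2 ≤ ∫ x in J, ‖g x‖ ^ 2 :=
    setIntegral_mono_set (hg.integrable_norm_pow (by norm_num))
      (Eventually.of_forall fun t => by positivity) hs.eventuallyLE
  have m3 : a ^ 2 ≤ (β - α) * ∫ x in J, ‖g x‖ ^ 2 :=
    (sq_setIntegral_norm_le hαβ hgI).trans (by gcongr)
  have : ‖P p‖ ^ 2 ≤ (2 * (∫ x in J, ‖f x‖ ^ 2) +
      (β - α) * (2 * ((β - α) * ∫ x in J, ‖g x‖ ^ 2))) / (β - α) := by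
    rw [le_div_iff₀ hd]
    nlinarith
  refine this.trans (le_of_eq ?_)
  field_simp
  ring

theorem integral_Ioo_mul_primitiveOn {l : ℝ} (hl : 0 < l) {g h : ℝ → ℂ} (c d : ℂ)
    (hg : MemLp g 2 (volume.restrict (Set.Ioo 0 l)))
    (hh : MemLp h 2 (volume.restrict (Set.Ioo 0 l))) :
    ∫ x in Set.Ioo 0 l, (g x * primitiveOn (Set.Ioo 0 l) h d x +
        primitiveOn (Set.Ioo 0 l) g c x * h x) =
      primitiveOn (Set.Ioo 0 l) g c l * primitiveOn (Set.Ioo 0 l) h d l -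
        primitiveOn (Set.Ioo 0 l) g c 0 * primitiveOn (Set.Ioo 0 l) h d 0 := by
  have lg := locallyIntegrable_indicator_of_memLp measurableSet_Ioo hg
  have lh := locallyIntegrable_indicator_of_memLp measurableSet_Ioo hh
  rw [primitiveOn, primitiveOn, primitiveOn, primitiveOn,
    ← lg.integral_mul_primitive lh c d 0 l, intervalIntegral.integral_of_le hl.le,
    integral_Ioc_eq_integral_Ioo]
  exact setIntegral_congr_fun measurableSet_Ioo fun t ht => by
    simp only [Set.indicator_of_mem ht, primitiveOn]

/-- Let `b → ∞` in the formula on `(0, b)`. The boundary term at `b` converges because the integral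
does, and its limit is zero because it is integrable over a half-line of infinite measure. -/
theorem integral_Ioi_mul_primitiveOn {g h : ℝ → ℂ} (c d : ℂ)
    (hg : MemLp g 2 (volume.restrict (Set.Ioi 0)))
    (hh : MemLp h 2 (volume.restrict (Set.Ioi 0)))
    (hG : MemLp (primitiveOn (Set.Ioi 0) g c) 2 (volume.restrict (Set.Ioi 0)))
    (hH : MemLp (primitiveOn (Set.Ioi 0) h d) 2 (volume.restrict (Set.Ioi 0))) :
    ∫ x in Set.Ioi 0, (g x * primitiveOn (Set.Ioi 0) h d x +
        primitiveOn (Set.Ioi 0) g c x * h x) =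
      -(primitiveOn (Set.Ioi 0) g c 0 * primitiveOn (Set.Ioi 0) h d 0) := by
  set J : Set ℝ := Set.Ioi 0
  have lg := locallyIntegrable_indicator_of_memLp (J := J) measurableSet_Ioi hg
  have lh := locallyIntegrable_indicator_of_memLp (J := J) measurableSet_Ioi hh
  have hi : IntegrableOn (fun x => g x * primitiveOn J h d x + primitiveOn J g c x * h x) J :=
    (hg.integrable_mul hH).add (hG.integrable_mul hh)
  have ht := intervalIntegral_tendsto_integral_Ioi 0 hi tendsto_id
  have hb : ∀ b : ℝ, 0 ≤ b →
      ∫ x in (0 : ℝ)..b, (g x * primitiveOn J h d x + primitiveOn J g c x * h x) =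
      primitiveOn J g c b * primitiveOn J h d b - primitiveOn J g c 0 * primitiveOn J h d 0 := by
    intro b hb
    rw [primitiveOn, primitiveOn, primitiveOn, primitiveOn,
      ← lg.integral_mul_primitive lh c d 0 b, intervalIntegral.integral_of_le hb,
      intervalIntegral.integral_of_le hb]
    exact setIntegral_congr_fun measurableSet_Ioc fun t ht => by
      have : t ∈ J := ht.1
      simp only [Set.indicator_of_mem this, primitiveOn]
  set L := ∫ x in J, (g x * primitiveOn J h d x + primitiveOn J g c x * h x)
  have ht2 : Tendsto (fun b => primitiveOn J g c b * primitiveOn J h d b) atTop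
      (𝓝 (L + primitiveOn J g c 0 * primitiveOn J h d 0)) := by
    have := ht.add_const (primitiveOn J g c 0 * primitiveOn J h d 0)
    refine this.congr' ?_
    filter_upwards [eventually_ge_atTop 0] with b hb0
    rw [id, hb b hb0, sub_add_cancel]
  have hz := IntegrableAtFilter.eq_zero_of_tendsto (μ := volume)
    ⟨J, Ioi_mem_atTop 0, hG.integrable_mul hH⟩ (fun s hs => by
      obtain ⟨a, ha⟩ := mem_atTop_sets.mp hs
      have : Set.Ici a ⊆ s := ha
      exact measure_mono_top this Real.volume_Ici) ht2
  exact eq_neg_of_add_eq_zero_left hz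

/-- No chain rule is needed: by Lebesgue differentiation both primitives have classical derivatives
almost everywhere, and each difference quotient of the composition is at most `K` times that of the
inner function. -/
theorem norm_weakDeriv_le_of_lipschitz {J : Set ℝ} (hJ : IsOpen J) {g g₁ : ℝ → ℂ} {c c₁ : ℂ}
    (hg : MemLp g 2 (volume.restrict J)) (hg₁ : MemLp g₁ 2 (volume.restrict J))
    {G : ℂ → ℂ} {K : NNReal} (hG : LipschitzWith K G)
    (h : primitiveOn J g₁ c₁ =ᵐ[volume.restrict J] fun x => G (primitiveOn J g c x)) :
    ∀ᵐ x ∂volume.restrict J, ‖g₁ x‖ ≤ K * ‖g x‖ := by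
  have lg := locallyIntegrable_indicator_of_memLp hJ.measurableSet hg
  have lg₁ := locallyIntegrable_indicator_of_memLp hJ.measurableSet hg₁
  have heq : Set.EqOn (primitiveOn J g₁ c₁) (fun x => G (primitiveOn J g c x)) J :=
    Measure.eqOn_open_of_ae_eq h hJ
      (continuous_primitiveOn hJ.measurableSet hg₁ _).continuousOn
      (hG.continuous.comp (continuous_primitiveOn hJ.measurableSet hg _)).continuousOn
  rw [ae_restrict_iff' hJ.measurableSet]
  filter_upwards [LocallyIntegrable.ae_hasDerivAt_integral lg,
    LocallyIntegrable.ae_hasDerivAt_integral lg₁] with x h1 h2 hx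
  have d1 : HasDerivAt (primitiveOn J g c) (g x) x := by
    have := (h1 0).const_add c
    rwa [Set.indicator_of_mem hx] at this
  have d2 : HasDerivAt (primitiveOn J g₁ c₁) (g₁ x) x := by
    have := (h2 0).const_add c₁
    rwa [Set.indicator_of_mem hx] at this
  refine le_of_tendsto_of_tendsto (hasDerivAt_iff_tendsto_slope.mp d2).norm
    ((hasDerivAt_iff_tendsto_slope.mp d1).norm.const_mul (K : ℝ)) ?_
  filter_upwards [nhdsWithin_le_nhds (hJ.mem_nhds hx)] with y hy
  rw [slope_def_module, slope_def_module, norm_smul, norm_smul, heq hx, heq hy, mul_left_comm]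
  refine mul_le_mul_of_nonneg_left ?_ (norm_nonneg _)
  simpa [dist_eq_norm] using hG.dist_le_mul (primitiveOn J g c y) (primitiveOn J g c x)

end Edge

/-! ### Sobolev functions on a metric graph -/

section LpTwo

variable {α : Type*} {m : MeasurableSpace α} {μ : Measure α}

theorem norm_sq_Lp_two (f : Lp ℂ 2 μ) : ‖f‖ ^ 2 = ∫ x, ‖f x‖ ^ 2 ∂μ := by
  have h : inner ℂ f f = ∫ x, inner ℂ (f x) (f x) ∂μ := L2.inner_def f f
  have h2 : ∀ z : ℂ, inner ℂ z z = ((‖z‖ ^ 2 : ℝ) : ℂ) := fun z => by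
    rw [inner_self_eq_norm_sq_to_K]; norm_cast
  simp only [h2] at h
  have h2' : inner ℂ f f = ((‖f‖ ^ 2 : ℝ) : ℂ) := by
    rw [inner_self_eq_norm_sq_to_K]; norm_cast
  have h3 : ∫ x, ((‖f x‖ ^ 2 : ℝ) : ℂ) ∂μ = ((∫ x, ‖f x‖ ^ 2 ∂μ : ℝ) : ℂ) := integral_ofReal
  rw [h3, h2'] at h
  exact Complex.ofReal_injective h

theorem inner_Lp_two (f g : Lp ℂ 2 μ) :
    inner ℂ f g = ∫ x, (starRingEnd ℂ) (f x) * g x ∂μ := by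
  rw [L2.inner_def]
  refine integral_congr_ae (Eventually.of_forall fun x => ?_)
  simp [mul_comm]

end LpTwo

namespace MetricGraph

variable {V I X : Type*}

theorem ordConnected_edge (Γ : MetricGraph V I X) (e : I ⊕ X) : (Γ.edge e).OrdConnected := by
  cases e
  · exact Set.ordConnected_Ioo
  · exact Set.ordConnected_Ioi

theorem measurableSet_edge (Γ : MetricGraph V I X) (e : I ⊕ X) : MeasurableSet (Γ.edge e) :=
  (Γ.isOpen_edge e).measurableSet

theorem coord_mem_closedEdge (Γ : MetricGraph V I X) (p : EdgeEnd I X) :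
    Γ.coord p ∈ Γ.closedEdge (edgeOf p) := by
  cases p with
  | start e => exact ⟨le_rfl, (Γ.len_pos e).le⟩
  | finish e => exact ⟨(Γ.len_pos e).le, le_rfl⟩
  | ext e => exact Set.self_mem_Ici

theorem closedEdge_subset_closure_interior (Γ : MetricGraph V I X) (e : I ⊕ X) :
    Γ.closedEdge e ⊆ closure (interior (Γ.closedEdge e)) := by
  cases e with
  | inl e => exact (closure_interior_Icc (Γ.len_pos e).ne).symm.subset
  | inr e =>
    simp only [closedEdge, interior_Ici, closure_Ioi]
    exact le_rfl

/-! ### Uniqueness of derivatives and boundary values, and the trace inequality -/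

section Values

variable {Γ : MetricGraph V I X} {u w : Γ.L2} {x : EdgeEnd I X → ℂ}

theorem HasDeriv.exists_primitiveOn (h : Γ.HasDeriv u w) (e : I ⊕ X) :
    ∃ c, u e =ᵐ[Γ.edgeMeasure e] primitiveOn (Γ.edge e) (w e) c :=
  (h e).exists_primitiveOn (Γ.isOpen_edge e) (Γ.ordConnected_edge e) (Lp.memLp _) (Lp.memLp _)

theorem HasValues.eq_primitiveOn (h : Γ.HasValues u x) (p : EdgeEnd I X) {c : ℂ}
    (hc : u (edgeOf p) =ᵐ[Γ.edgeMeasure (edgeOf p)] primitiveOn (Γ.edge (edgeOf p))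
      (w (edgeOf p)) c) :
    x p = primitiveOn (Γ.edge (edgeOf p)) (w (edgeOf p)) c (Γ.coord p) :=
  (h p).eq_of_ae_eq (Γ.closedEdge_subset_closure_interior _) (Γ.coord_mem_closedEdge p)
    (continuous_primitiveOn (Γ.measurableSet_edge _) (Lp.memLp _) c)
    (by rwa [restrict_closedEdge])

theorem HasDeriv.exists_values (h : Γ.HasDeriv u w) : ∃ x, Γ.HasValues u x := by
  choose c hc using h.exists_primitiveOn
  refine ⟨fun p => primitiveOn (Γ.edge (edgeOf p)) (w (edgeOf p)) (c (edgeOf p)) (Γ.coord p),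
    fun p => ⟨_, (continuous_primitiveOn (Γ.measurableSet_edge _) (Lp.memLp _) _).continuousOn,
      ?_, rfl⟩⟩
  rw [restrict_closedEdge]
  exact (hc _).symm

theorem HasDeriv.values_unique {x' : EdgeEnd I X → ℂ} (h : Γ.HasDeriv u w)
    (hx : Γ.HasValues u x) (hx' : Γ.HasValues u x') : x = x' := by
  funext p
  obtain ⟨c, hc⟩ := h.exists_primitiveOn (edgeOf p)
  rw [hx.eq_primitiveOn p hc, hx'.eq_primitiveOn p hc]

theorem HasDeriv.sub {u₁ w₁ : Γ.L2} (h : Γ.HasDeriv u w) (h₁ : Γ.HasDeriv u₁ w₁) :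
    Γ.HasDeriv (u - u₁) (w - w₁) := by
  simpa [sub_eq_add_neg] using h.add (h₁.smul (-1))

theorem HasValues.sub {u₁ : Γ.L2} {x₁ : EdgeEnd I X → ℂ} (h : Γ.HasValues u x)
    (h₁ : Γ.HasValues u₁ x₁) : Γ.HasValues (u - u₁) (x - x₁) := by
  simpa [sub_eq_add_neg] using h.add (h₁.smul (-1))

theorem HasDeriv.unique {w' : Γ.L2} (h : Γ.HasDeriv u w) (h' : Γ.HasDeriv u w') : w = w' := by
  have := h.sub h'
  rw [sub_self] at this
  exact sub_eq_zero.mp this.eq_zero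

theorem HasDeriv.grad_eq (h : Γ.HasDeriv u w) : Γ.grad u = w := by
  have hex : ∃ w, Γ.HasDeriv u w := ⟨w, h⟩
  rw [grad, dif_pos hex]
  exact hex.choose_spec.unique h

theorem HasDeriv.values_eq (h : Γ.HasDeriv u w) (hx : Γ.HasValues u x) : Γ.values u = x := by
  have hex : ∃ x, Γ.HasValues u x := ⟨x, hx⟩
  rw [values, dif_pos hex]
  exact h.values_unique hex.choose_spec hx

variable (Γ) in
theorem exists_le_len [Finite I] : ∃ δ : ℝ, 0 < δ ∧ ∀ e, δ ≤ Γ.len e := by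
  rcases isEmpty_or_nonempty I with h | h
  · exact ⟨1, one_pos, fun e => h.elim e⟩
  · obtain ⟨e₀, he₀⟩ := Finite.exists_min Γ.len
    exact ⟨Γ.len e₀, Γ.len_pos e₀, he₀⟩

variable (Γ) in
-- Supplies the interval for the trace estimate. A common length `d` serves at all ends because no
-- internal edge is shorter.
theorem exists_edge_nhd {d : ℝ} (hd : 0 < d) (hlen : ∀ e, d ≤ Γ.len e) (p : EdgeEnd I X) :
    ∃ α β, β - α = d ∧ Set.Ioo α β ⊆ Γ.edge (edgeOf p) ∧ Γ.coord p ∈ Set.Icc α β := by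
  cases p with
  | start e =>
    exact ⟨0, d, sub_zero d, Set.Ioo_subset_Ioo le_rfl (hlen e), ⟨le_rfl, hd.le⟩⟩
  | finish e =>
    refine ⟨Γ.len e - d, Γ.len e, sub_sub_cancel _ _, Set.Ioo_subset_Ioo ?_ le_rfl, ?_⟩
    · linarith [hlen e]
    · exact ⟨by simp only [coord]; linarith, le_rfl⟩
  | ext e => exact ⟨0, d, sub_zero d, fun x hx => hx.1, ⟨le_rfl, hd.le⟩⟩

variable [Fintype I] [Fintype X]

theorem norm_sq_eq_sum (u : Γ.L2) : ‖u‖ ^ 2 = ∑ e, ∫ x in Γ.edge e, ‖u e x‖ ^ 2 := by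
  rw [PiLp.norm_sq_eq_of_L2]
  exact Finset.sum_congr rfl fun e _ => norm_sq_Lp_two _

theorem integral_norm_sq_le (u : Γ.L2) (e : I ⊕ X) :
    ∫ x in Γ.edge e, ‖u e x‖ ^ 2 ≤ ‖u‖ ^ 2 := by
  rw [norm_sq_eq_sum]
  exact Finset.single_le_sum (f := fun e => ∫ x in Γ.edge e, ‖u e x‖ ^ 2)
    (fun e _ => integral_nonneg fun x => by positivity) (Finset.mem_univ e)

/-- The trace inequality. -/
theorem HasDeriv.norm_sq_value_le (h : Γ.HasDeriv u w) (hx : Γ.HasValues u x) {d : ℝ}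
    (hd : 0 < d) (hlen : ∀ e, d ≤ Γ.len e) (p : EdgeEnd I X) :
    ‖x p‖ ^ 2 ≤ 2 * d * ‖w‖ ^ 2 + 2 / d * ‖u‖ ^ 2 := by
  obtain ⟨c, hc⟩ := h.exists_primitiveOn (edgeOf p)
  obtain ⟨α, β, rfl, hs, hp⟩ := Γ.exists_edge_nhd hd hlen p
  rw [hx.eq_primitiveOn p hc]
  refine (norm_sq_primitiveOn_le (Γ.measurableSet_edge _) (Lp.memLp _) (Lp.memLp _) hc
    (sub_pos.mp hd) hs hp).trans ?_
  have h1 := integral_norm_sq_le w (edgeOf p)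
  have h2 := integral_norm_sq_le u (edgeOf p)
  gcongr

end Values

/-! ### Integration by parts -/

section Parts

variable {Γ : MetricGraph V I X}

/-- The inner product conjugates its first argument; conjugates of primitives are primitives, so the
product formula still applies. -/
theorem conj_primitiveOn (J : Set ℝ) (g : ℝ → ℂ) (c : ℂ) (x : ℝ) :
    (starRingEnd ℂ) (primitiveOn J g c x) =
      primitiveOn J (fun t => (starRingEnd ℂ) (g t)) ((starRingEnd ℂ) c) x := by
  rw [primitiveOn, primitiveOn, map_add, ← intervalIntegral.intervalIntegral_conj]
  congr 1
  refine intervalIntegral.integral_congr fun t _ => ?_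
  by_cases ht : t ∈ J <;> simp [ht]

theorem inner_add_inner_edge {u u' w w' : Γ.L2} {e : I ⊕ X} {c d : ℂ} (hc : u e =ᵐ[Γ.edgeMeasure e] primitiveOn (Γ.edge e) (u' e) c)
    (hd : w e =ᵐ[Γ.edgeMeasure e] primitiveOn (Γ.edge e) (w' e) d) :
    inner ℂ (u' e) (w e) + inner ℂ (u e) (w' e) = ∫ x in Γ.edge e,
      ((starRingEnd ℂ) (u' e x) * primitiveOn (Γ.edge e) (w' e) d x +
        primitiveOn (Γ.edge e) (fun t => (starRingEnd ℂ) (u' e t)) ((starRingEnd ℂ) c) x *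
          w' e x) := by
  rw [inner_Lp_two, inner_Lp_two, ← integral_add]
  · refine integral_congr_ae ?_
    filter_upwards [hc, hd] with x h1 h2
    rw [h1, h2, conj_primitiveOn]
  · exact (Lp.memLp (u' e)).star.integrable_mul (Lp.memLp (w e))
  · exact (Lp.memLp (u e)).star.integrable_mul (Lp.memLp (w' e))

variable (I X) in
/-- The ends of edges, sorted by kind. -/
def edgeEndEquiv : EdgeEnd I X ≃ (I ⊕ I) ⊕ X where
  toFun
    | .start e => .inl (.inl e)
    | .finish e => .inl (.inr e)
    | .ext e => .inr e
  invFun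
    | .inl (.inl e) => .start e
    | .inl (.inr e) => .finish e
    | .inr e => .ext e
  left_inv p := by cases p <;> rfl
  right_inv p := by rcases p with (p | p) | p <;> rfl

variable [Fintype I] [Fintype X]

theorem sum_edgeEnd {M : Type*} [AddCommMonoid M] (f : EdgeEnd I X → M) :
    ∑ p, f p = (∑ e, f (.start e) + ∑ e, f (.finish e)) + ∑ e, f (.ext e) := by
  rw [← (edgeEndEquiv I X).symm.sum_comp, Fintype.sum_sum_type, Fintype.sum_sum_type]
  rfl

/-- Integration by parts on a metric graph. -/
theorem HasDeriv.inner_add_inner {u u' w w' : Γ.L2} {x z : EdgeEnd I X → ℂ}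
    (hu : Γ.HasDeriv u u') (hw : Γ.HasDeriv w w') (hx : Γ.HasValues u x)
    (hz : Γ.HasValues w z) :
    inner ℂ u' w + inner ℂ u w' = -∑ p, outwardSign p * ((starRingEnd ℂ) (x p) * z p) := by
  choose c hc using hu.exists_primitiveOn
  choose d hd using hw.exists_primitiveOn
  have ex : ∀ p, x p = _ := fun p => hx.eq_primitiveOn p (hc _)
  have ez : ∀ p, z p = _ := fun p => hz.eq_primitiveOn p (hd _)
  rw [PiLp.inner_apply, PiLp.inner_apply, ← Finset.sum_add_distrib, Fintype.sum_sum_type,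
    sum_edgeEnd]
  -- The sign `-1` at the terminal end turns the difference of the two boundary terms into minus a
  -- signed sum.
  have h1 : ∀ e : I, inner ℂ (u' (.inl e)) (w (.inl e)) + inner ℂ (u (.inl e)) (w' (.inl e)) =
      -(outwardSign (I := I) (X := X) (.start e) *
          ((starRingEnd ℂ) (x (.start e)) * z (.start e)) +
        outwardSign (I := I) (X := X) (.finish e) *
          ((starRingEnd ℂ) (x (.finish e)) * z (.finish e))) := by
    intro e
    rw [inner_add_inner_edge (hc _) (hd _), ex, ex, ez, ez, conj_primitiveOn,
      conj_primitiveOn]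
    refine (integral_Ioo_mul_primitiveOn (Γ.len_pos e) _ _ (Lp.memLp (u' (.inl e))).star
      (Lp.memLp (w' (.inl e)))).trans ?_
    change primitiveOn (Γ.edge (.inl e)) (fun t => (starRingEnd ℂ) (u' (.inl e) t)) _ _ * _ -
      primitiveOn (Γ.edge (.inl e)) (fun t => (starRingEnd ℂ) (u' (.inl e) t)) _ _ * _ = _
    simp only [outwardSign, coord, edgeOf, edge]
    ring
  have h2 : ∀ e : X, inner ℂ (u' (.inr e)) (w (.inr e)) + inner ℂ (u (.inr e)) (w' (.inr e)) =
      -(outwardSign (I := I) (X := X) (.ext e) *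
          ((starRingEnd ℂ) (x (.ext e)) * z (.ext e))) := by
    intro e
    rw [inner_add_inner_edge (hc _) (hd _), ex, ez, conj_primitiveOn]
    refine (integral_Ioi_mul_primitiveOn _ _ (Lp.memLp (u' (.inr e))).star
      (Lp.memLp (w' (.inr e))) ?_ ?_).trans ?_
    · refine ((Lp.memLp (u (.inr e))).star).ae_eq ?_
      filter_upwards [hc (.inr e)] with t ht
      rw [Pi.star_apply, ht]
      exact conj_primitiveOn _ _ _ _
    · exact (Lp.memLp (w (.inr e))).ae_eq (hd _)
    · change -(primitiveOn (Γ.edge (.inr e)) (fun t => (starRingEnd ℂ) (u' (.inr e) t)) _ _ * _) = _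
      simp only [outwardSign, coord, edgeOf, edge]
      ring
  simp only [h1, h2, Finset.sum_neg_distrib, Finset.sum_add_distrib]
  ring

end Parts

/-! ### Closedness of the weak derivative -/

section Closed

variable {Γ : MetricGraph V I X}

theorem integral_smul_eq_inner {J : Set ℝ} {φ : ℝ → ℝ}
    (h : MemLp (fun x => (φ x : ℂ)) 2 (volume.restrict J)) (f : Lp ℂ 2 (volume.restrict J)) :
    ∫ x in J, φ x • f x = inner ℂ h.toLp f := by
  rw [inner_Lp_two]
  refine integral_congr_ae ?_
  filter_upwards [h.coeFn_toLp] with x hx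
  rw [hx, Complex.conj_ofReal, Complex.real_smul]

theorem continuous_setIntegral_test_smul {J : Set ℝ} {φ : ℝ → ℝ} (hφ : Continuous φ)
    (hc : HasCompactSupport φ) :
    Continuous fun f : Lp ℂ 2 (volume.restrict J) => ∫ x in J, φ x • f x := by
  have h : MemLp (fun x => (φ x : ℂ)) 2 (volume.restrict J) :=
    ((Complex.continuous_ofReal.comp hφ).memLp_of_hasCompactSupport
      (hc.comp_left Complex.ofReal_zero)).restrict J
  simp only [integral_smul_eq_inner h]
  fun_prop

variable (Γ) in
/-- The weak derivative is a closed operator. -/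
theorem isClosed_hasDeriv : IsClosed {q : Γ.L2 × Γ.L2 | Γ.HasDeriv q.1 q.2} := by
  -- For each test function the defining identity equates two continuous functionals, as integration
  -- against it is an `L²` inner product.
  have : {q : Γ.L2 × Γ.L2 | Γ.HasDeriv q.1 q.2} = ⋂ (e) (φ : ℝ → ℝ) (_ : ContDiff ℝ ∞ φ)
      (_ : HasCompactSupport φ) (_ : tsupport φ ⊆ Γ.edge e),
      {q : Γ.L2 × Γ.L2 | ∫ x in Γ.edge e, deriv φ x • q.1 e x =
        -∫ x in Γ.edge e, φ x • q.2 e x} := by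
    ext q
    simp [HasDeriv, HasWeakDeriv]
  rw [this]
  refine isClosed_iInter fun e => isClosed_iInter fun φ => isClosed_iInter fun h1 =>
    isClosed_iInter fun h2 => isClosed_iInter fun h3 => isClosed_eq ?_ ?_
  · exact (continuous_setIntegral_test_smul (h1.continuous_deriv (by simp)) h2.deriv).comp
      ((PiLp.continuous_apply 2 _ e).comp continuous_fst)
  · exact ((continuous_setIntegral_test_smul h1.continuous h2).comp
      ((PiLp.continuous_apply 2 _ e).comp continuous_snd)).neg

end Closed

end MetricGraph

/-! ### Smooth functions with prescribed boundary data -/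

namespace MetricGraph

variable {V I X : Type*}

section Smooth

theorem hasWeakDeriv_of_contDiff {J : Set ℝ} {f : ℝ → ℂ} (hf : ContDiff ℝ ∞ f) :
    HasWeakDeriv J f (deriv f) := by
  intro φ h1 h2 h3
  have hd : Continuous (deriv f) := hf.continuous_deriv (by simp)
  have hdiff : Differentiable ℝ f := hf.differentiable (by simp)
  have hprim : ∀ x, f 0 + ∫ t in (0 : ℝ)..x, deriv f t = f x := by
    intro x
    rw [intervalIntegral.integral_deriv_eq_sub (fun x _ => hdiff x) (hd.intervalIntegrable _ _)]
    ring
  have := integral_deriv_smul_primitive hd.locallyIntegrable (f 0) h1 h2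
  simp only [hprim] at this
  rw [setIntegral_eq_integral_of_tsupport_subset h3,
    setIntegral_eq_integral_of_tsupport_subset (tsupport_deriv_subset.trans h3), this]

/-- The element of `L²(Γ)` given by continuous compactly supported functions on the edges. -/
noncomputable def ofCompactSupport (Γ : MetricGraph V I X) (f : I ⊕ X → ℝ → ℂ)
    (hf : ∀ e, Continuous (f e))
    (hs : ∀ e, HasCompactSupport (f e)) : Γ.L2 :=
  WithLp.toLp 2 fun e =>
    (((hf e).memLp_of_hasCompactSupport (hs e)).restrict (Γ.edge e) :
      MemLp (f e) 2 (Γ.edgeMeasure e)).toLp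

variable (Γ : MetricGraph V I X) {f : I ⊕ X → ℝ → ℂ}

theorem coeFn_ofCompactSupport (hf : ∀ e, Continuous (f e)) (hs : ∀ e, HasCompactSupport (f e))
    (e : I ⊕ X) : Γ.ofCompactSupport f hf hs e =ᵐ[Γ.edgeMeasure e] f e :=
  (((hf e).memLp_of_hasCompactSupport (hs e)).restrict (Γ.edge e) :
    MemLp (f e) 2 (Γ.edgeMeasure e)).coeFn_toLp

theorem hasValues_ofCompactSupport (hf : ∀ e, Continuous (f e))
    (hs : ∀ e, HasCompactSupport (f e)) :
    Γ.HasValues (Γ.ofCompactSupport f hf hs) fun p => f (edgeOf p) (Γ.coord p) := fun p =>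
  ⟨f (edgeOf p), (hf _).continuousOn, by
    rw [restrict_closedEdge]
    exact (Γ.coeFn_ofCompactSupport hf hs _).symm, rfl⟩

theorem hasDeriv_ofCompactSupport (hf : ∀ e, ContDiff ℝ ∞ (f e))
    (hs : ∀ e, HasCompactSupport (f e)) :
    Γ.HasDeriv (Γ.ofCompactSupport f (fun e => (hf e).continuous) hs)
      (Γ.ofCompactSupport (fun e => deriv (f e)) (fun e => (hf e).continuous_deriv (by simp))
        fun e => (hs e).deriv) := fun e =>
  (hasWeakDeriv_of_contDiff (hf e)).congr (Γ.coeFn_ofCompactSupport _ _ e)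
    (Γ.coeFn_ofCompactSupport _ _ e)

/-- A smooth function with prescribed value and derivative at a point, supported nearby. -/
theorem exists_contDiff_jet {δ : ℝ} (hδ : 0 < δ) (q : ℝ) (x y : ℂ) :
    ∃ f : ℝ → ℂ, ContDiff ℝ ∞ f ∧ HasCompactSupport f ∧ f q = x ∧ deriv f q = y ∧
      ∀ r, δ ≤ |r - q| → f r = 0 ∧ deriv f r = 0 := by
  let b : ContDiffBump q := ⟨δ / 4, δ / 2, by positivity, by linarith⟩
  have hb : ContDiff ℝ ∞ fun t => b t := b.contDiff
  set f : ℝ → ℂ := fun t => b t • (x + ((t - q : ℝ) : ℂ) * y) with hf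
  have hsupp : HasCompactSupport f := b.hasCompactSupport.smul_right
  have ht : tsupport f ⊆ Metric.closedBall q (δ / 2) := by
    refine (tsupport_smul_subset_left _ _).trans ?_
    rw [b.tsupport_eq]
  have hout : ∀ r, δ ≤ |r - q| → r ∉ tsupport f := by
    intro r hr h
    have := ht h
    rw [Metric.mem_closedBall, Real.dist_eq] at this
    linarith
  have hcd : ContDiff ℝ ∞ f := by
    refine hb.smul (contDiff_const.add (ContDiff.mul ?_ contDiff_const))
    exact Complex.ofRealCLM.contDiff.comp (contDiff_id.sub contDiff_const)
  refine ⟨f, hcd, hsupp, ?_, ?_, fun r hr => ⟨image_eq_zero_of_notMem_tsupport (hout r hr),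
    image_eq_zero_of_notMem_tsupport fun h => hout r hr (tsupport_deriv_subset h)⟩⟩
  · have : b q = 1 := b.one_of_mem_closedBall (Metric.mem_closedBall_self b.rIn_pos.le)
    simp [hf, this]
  · have heq : f =ᶠ[𝓝 q] fun t => x + ((t - q : ℝ) : ℂ) * y := by
      filter_upwards [b.eventuallyEq_one] with t ht
      simp [hf, ht]
    rw [heq.deriv_eq]
    have : HasDerivAt (fun t : ℝ => x + ((t - q : ℝ) : ℂ) * y) (1 * y) q := by
      refine HasDerivAt.const_add x (HasDerivAt.mul_const ?_ y)
      exact ((hasDerivAt_id q).sub_const q).ofReal_comp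
    rw [this.deriv, one_mul]

/-- Boundary data at distinct ends can be prescribed independently: `δ` is at most the length of
every internal edge, so the jet built at one end vanishes, with its derivative, at the other. This
is what lets self-adjointness be tested one vertex at a time. -/
theorem exists_hasDeriv_hasValues [Finite I] (x y : EdgeEnd I X → ℂ) :
    ∃ u u' u'' : Γ.L2, Γ.HasDeriv u u' ∧ Γ.HasDeriv u' u'' ∧ Γ.HasValues u x ∧
      Γ.HasValues u' y := by
  obtain ⟨δ, hδ, hlen⟩ := Γ.exists_le_len
  choose h h1 h2 h3 h4 h5 using fun p : EdgeEnd I X =>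
    exists_contDiff_jet hδ (Γ.coord p) (x p) (y p)
  let f : I ⊕ X → ℝ → ℂ := fun e => match e with
    | .inl e => h (.start e) + h (.finish e)
    | .inr e => h (.ext e)
  have f1 : ∀ e, ContDiff ℝ ∞ (f e) := by
    rintro (e | e)
    · exact (h1 _).add (h1 _)
    · exact h1 _
  have f2 : ∀ e, HasCompactSupport (f e) := by
    rintro (e | e)
    · exact (h2 _).add (h2 _)
    · exact h2 _
  have df : ∀ p, DifferentiableAt ℝ (h p) = fun _ => True := fun p => by
    funext t
    exact eq_true ((h1 p).differentiable (by simp) t)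
  have far : ∀ e, δ ≤ |Γ.coord (.finish e : EdgeEnd I X) - Γ.coord (.start e : EdgeEnd I X)| := by
    intro e
    simp only [coord, sub_zero]
    exact (hlen e).trans (le_abs_self _)
  have far' : ∀ e, δ ≤ |Γ.coord (.start e : EdgeEnd I X) - Γ.coord (.finish e : EdgeEnd I X)| :=
    fun e => by rw [abs_sub_comm]; exact far e
  have d1 : ∀ e, ContDiff ℝ ∞ (deriv (f e)) := fun e => (contDiff_infty_iff_deriv.mp (f1 e)).2
  refine ⟨_, _, _, Γ.hasDeriv_ofCompactSupport f1 f2,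
    Γ.hasDeriv_ofCompactSupport d1 (fun e => (f2 e).deriv), ?_, ?_⟩
  · convert Γ.hasValues_ofCompactSupport (fun e => (f1 e).continuous) f2 using 1
    funext p
    cases p with
    | start e => simp [f, edgeOf, h3, (h5 (.finish e) _ (far' e)).1]
    | finish e => simp [f, edgeOf, h3, (h5 (.start e) _ (far e)).1]
    | ext e => simp [f, edgeOf, h3]
  · convert Γ.hasValues_ofCompactSupport (fun e => (d1 e).continuous)
      (fun e => (f2 e).deriv) using 1
    funext p
    cases p with
    | start e => simp [f, edgeOf, deriv_add, df, h4, (h5 (.finish e) _ (far' e)).2]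
    | finish e => simp [f, edgeOf, deriv_add, df, h4, (h5 (.start e) _ (far e)).2]
    | ext e => simp [f, edgeOf, h4]

end Smooth

end MetricGraph

/-! ### Self-adjoint vertex conditions -/

section Vertex

variable {ι : Type*} [Fintype ι]

/-- The pairs `(a, b)` with `A a + B b = 0` form a Lagrangian subspace. -/
def IsLagrangianCondition (A B : Matrix ι ι ℂ) : Prop :=
  ∀ a b, matrixMap A a + matrixMap B b = 0 ↔
    ∀ a₁ b₁, matrixMap A a₁ + matrixMap B b₁ = 0 → inner ℂ a b₁ = inner ℂ b a₁

namespace IsLagrangianCondition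

variable {A B : Matrix ι ι ℂ} (h : IsLagrangianCondition A B)

theorem dirichletProj_eq_zero_iff {a : EuclideanSpace ℂ ι} :
    dirichletProj B a = 0 ↔ a ∈ (LinearMap.ker (matrixMap B))ᗮ := by
  rw [dirichletProj, Submodule.starProjection_apply_eq_zero_iff]

theorem neumannProj_eq_zero_iff {a : EuclideanSpace ℂ ι} :
    neumannProj A a = 0 ↔ a ∈ (LinearMap.ker (matrixMap A))ᗮ := by
  rw [neumannProj, Submodule.starProjection_apply_eq_zero_iff]

theorem matrixMap_neumannProj (a : EuclideanSpace ℂ ι) : matrixMap A (neumannProj A a) = 0 :=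
  (LinearMap.ker (matrixMap A)).starProjection_apply_mem a

include h

/-- For `b₁ ∈ ker B` the pair `(0, b₁)` satisfies the condition; symmetry against it says `a ⊥ b₁`.
The Neumann statement below exchanges the roles of `A` and `B`. -/
theorem dirichletProj_eq_zero {a b : EuclideanSpace ℂ ι}
    (hab : matrixMap A a + matrixMap B b = 0) : dirichletProj B a = 0 := by
  rw [dirichletProj_eq_zero_iff, Submodule.mem_orthogonal']
  intro b₁ hb₁
  have := (h a b).mp hab 0 b₁ (by rw [map_zero, zero_add]; exact hb₁)
  rwa [inner_zero_right] at this

theorem neumannProj_eq_zero {a b : EuclideanSpace ℂ ι}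
    (hab : matrixMap A a + matrixMap B b = 0) : neumannProj A b = 0 := by
  rw [neumannProj_eq_zero_iff, Submodule.mem_orthogonal']
  intro a₁ ha₁
  have := (h a b).mp hab a₁ 0 (by rw [map_zero, add_zero]; exact ha₁)
  rwa [inner_zero_right, eq_comm] at this

/-- Let `N` be the space of first components of solutions. If `b ⊥ N`, then `(0, b)` is symmetric
against every solution, hence a solution by maximality, so `Nᗮ ≤ ker B`. Taking orthogonal
complements in finite dimension gives the claim. -/
theorem exists_of_dirichletProj_eq_zero {a : EuclideanSpace ℂ ι} (ha : dirichletProj B a = 0) :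
    ∃ b, matrixMap A a + matrixMap B b = 0 := by
  let L : Submodule ℂ (EuclideanSpace ℂ ι × EuclideanSpace ℂ ι) :=
    LinearMap.ker ((matrixMap A).coprod (matrixMap B))
  let N : Submodule ℂ (EuclideanSpace ℂ ι) := L.map (LinearMap.fst ℂ _ _)
  have hN : Nᗮ ≤ LinearMap.ker (matrixMap B) := by
    intro b hb
    rw [Submodule.mem_orthogonal'] at hb
    have : matrixMap A 0 + matrixMap B b = 0 := by
      refine (h 0 b).mpr fun a₁ b₁ hab => ?_
      rw [inner_zero_left, hb a₁ ⟨(a₁, b₁), by simpa [L] using hab, rfl⟩]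
    rwa [map_zero, zero_add] at this
  rw [dirichletProj_eq_zero_iff] at ha
  have ha' : a ∈ Nᗮᗮ := Submodule.orthogonal_le hN ha
  rw [Submodule.orthogonal_orthogonal] at ha'
  obtain ⟨⟨a', b⟩, hab, rfl⟩ := ha'
  exact ⟨b, by simpa [L] using hab⟩

theorem dirichletProj_neumannProj (a : EuclideanSpace ℂ ι) :
    dirichletProj B (neumannProj A a) = 0 :=
  h.dirichletProj_eq_zero (b := 0) (by rw [matrixMap_neumannProj, map_zero, add_zero])

theorem robinProj_eq_zero_of_mem_ker {b : EuclideanSpace ℂ ι} (hb : matrixMap B b = 0) :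
    robinProj A B b = 0 := by
  have h1 : dirichletProj B b = b := Submodule.starProjection_eq_self_iff.mpr hb
  have h2 : neumannProj A b = 0 := h.neumannProj_eq_zero (a := 0) (by rw [map_zero, hb, add_zero])
  change b - dirichletProj B b - neumannProj A b = 0
  rw [h1, h2, sub_self, sub_zero]

/-- `P_R a` differs from `a` by a vector of `ker A`, so `b` is still a partner of it. The partner
chosen in `robinMap` may be another one, but two partners differ by an element of `ker B`, which
`P_R` annihilates. -/
theorem robinMap_robinProj {a b : EuclideanSpace ℂ ι} (hab : matrixMap A a + matrixMap B b = 0) :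
    robinMap A B (robinProj A B a) = robinProj A B b := by
  have h1 : robinProj A B a = a - neumannProj A a := by
    change a - dirichletProj B a - neumannProj A a = _
    rw [h.dirichletProj_eq_zero hab, sub_zero]
  have h2 : matrixMap A (robinProj A B a) + matrixMap B b = 0 := by
    rw [h1, map_sub, matrixMap_neumannProj, sub_zero, hab]
  have hex : ∃ b, matrixMap A (robinProj A B a) + matrixMap B b = 0 := ⟨b, h2⟩
  rw [robinMap, dif_pos hex, ← sub_eq_zero, ← map_sub]
  refine h.robinProj_eq_zero_of_mem_ker ?_
  have h3 := hex.choose_spec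
  rw [map_sub, sub_eq_zero]
  exact add_left_cancel (h3.trans h2.symm)

/-- Passing to Robin parts removes `P_D b` and `P_N a₁`. The former is orthogonal to `a₁` and to
`P_N a₁`, whose Dirichlet parts vanish; the latter is orthogonal to `b`, whose Neumann part
vanishes. -/
theorem inner_robinProj {a b a₁ : EuclideanSpace ℂ ι} (hab : matrixMap A a + matrixMap B b = 0)
    (ha₁ : dirichletProj B a₁ = 0) :
    inner ℂ (robinProj A B b) (robinProj A B a₁) = inner ℂ b a₁ := by
  have h1 : robinProj A B b = b - dirichletProj B b := by
    change b - dirichletProj B b - neumannProj A b = _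
    rw [h.neumannProj_eq_zero hab, sub_zero]
  have h2 : robinProj A B a₁ = a₁ - neumannProj A a₁ := by
    change a₁ - dirichletProj B a₁ - neumannProj A a₁ = _
    rw [ha₁, sub_zero]
  have h3 : inner ℂ b (neumannProj A a₁) = 0 := by
    rw [neumannProj, ← Submodule.inner_starProjection_left_eq_right]
    have := h.neumannProj_eq_zero hab
    rw [neumannProj] at this
    rw [this, inner_zero_left]
  have h4 : ∀ z, dirichletProj B z = 0 → inner ℂ (dirichletProj B b) z = 0 := by
    intro z hz
    rw [dirichletProj] at hz ⊢
    rw [Submodule.inner_starProjection_left_eq_right, hz, inner_zero_right]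
  rw [h1, h2, inner_sub_left, inner_sub_right, inner_sub_right, h3, h4 _ ha₁,
    h4 _ (h.dirichletProj_neumannProj a₁)]
  simp

/-- Identifies the vertex term of the energy with the boundary term of integration by parts. -/
theorem inner_robinMap {a b : EuclideanSpace ℂ ι} (hab : matrixMap A a + matrixMap B b = 0) :
    inner ℂ (robinMap A B (robinProj A B a)) (robinProj A B a) = inner ℂ b a := by
  rw [h.robinMap_robinProj hab, h.inner_robinProj hab (h.dirichletProj_eq_zero hab)]

/-- `robinMap` is defined by a choice, but on `(ker B)ᗮ` every vector has a partner and
`robinMap_robinProj` removes the choice. The map is therefore linear there, and bounded because the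
dimension is finite. -/
theorem exists_bound_robinMap :
    ∃ C : ℝ, 0 ≤ C ∧ ∀ a, dirichletProj B a = 0 →
      ‖robinMap A B (robinProj A B a)‖ ≤ C * ‖a‖ := by
  have hmem : ∀ a : (LinearMap.ker (matrixMap B))ᗮ, dirichletProj B (a : EuclideanSpace ℂ ι) = 0 :=
    fun a => dirichletProj_eq_zero_iff.mpr a.2
  let L : (LinearMap.ker (matrixMap B))ᗮ →ₗ[ℂ] EuclideanSpace ℂ ι :=
    { toFun := fun a => robinMap A B (robinProj A B a)
      map_add' := by
        intro a a₁
        obtain ⟨b, hb⟩ := h.exists_of_dirichletProj_eq_zero (hmem a)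
        obtain ⟨b₁, hb₁⟩ := h.exists_of_dirichletProj_eq_zero (hmem a₁)
        rw [h.robinMap_robinProj hb, h.robinMap_robinProj hb₁, ← map_add]
        refine h.robinMap_robinProj ?_
        rw [Submodule.coe_add, map_add, map_add, add_add_add_comm, hb, hb₁, add_zero]
      map_smul' := by
        intro c a
        obtain ⟨b, hb⟩ := h.exists_of_dirichletProj_eq_zero (hmem a)
        rw [h.robinMap_robinProj hb, RingHom.id_apply, ← map_smul]
        refine h.robinMap_robinProj ?_
        rw [Submodule.coe_smul, map_smul, map_smul, ← smul_add, hb, smul_zero] }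
  refine ⟨‖LinearMap.toContinuousLinearMap L‖,
    (LinearMap.toContinuousLinearMap L).opNorm_nonneg, fun a ha => ?_⟩
  exact (LinearMap.toContinuousLinearMap L).le_opNorm ⟨a, dirichletProj_eq_zero_iff.mp ha⟩

/-- The boundary form is controlled by the values alone. -/
theorem norm_inner_le {C : ℝ}
    (hC : ∀ a, dirichletProj B a = 0 → ‖robinMap A B (robinProj A B a)‖ ≤ C * ‖a‖)
    {a a₁ b₁ : EuclideanSpace ℂ ι} (ha : dirichletProj B a = 0)
    (hab : matrixMap A a₁ + matrixMap B b₁ = 0) : ‖inner ℂ a b₁‖ ≤ C * ‖a‖ * ‖a₁‖ := by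
  -- Symmetry moves the pairing from the uncontrolled `b₁` to a partner `b` of `a`; the Dirichlet
  -- part of `b` is orthogonal to `a₁`, and what remains is `Λ P_R a`.
  obtain ⟨b, hb⟩ := h.exists_of_dirichletProj_eq_zero ha
  have ha₁ := h.dirichletProj_eq_zero hab
  have hsub : b = robinProj A B b + dirichletProj B b := by
    change b = b - dirichletProj B b - neumannProj A b + dirichletProj B b
    rw [h.neumannProj_eq_zero hb]
    abel
  have hz : inner ℂ (dirichletProj B b) a₁ = 0 := by
    rw [dirichletProj] at ha₁ ⊢
    rw [Submodule.inner_starProjection_left_eq_right, ha₁, inner_zero_right]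
  rw [(h a b).mp hb _ _ hab, hsub, inner_add_left, hz, add_zero, ← h.robinMap_robinProj hb]
  exact (norm_inner_le_norm _ _).trans (mul_le_mul_of_nonneg_right (hC a ha) (norm_nonneg _))

end IsLagrangianCondition

end Vertex

/-! ### The vertex conditions of a self-adjoint Laplacian -/

/-- This is `A = A*` read on graphs. The direction from right to left is maximality, the means by
which membership in the domain is proved. -/
theorem LinearPMap.mem_graph_iff_of_isSelfAdjoint {H : Type*} [NormedAddCommGroup H]
    [InnerProductSpace ℂ H] [CompleteSpace H] {A : H →ₗ.[ℂ] H} (hA : IsSelfAdjoint A) (f g : H) :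
    (f, g) ∈ A.graph ↔ ∀ a b, (a, b) ∈ A.graph → inner ℂ b f = inner ℂ a g := by
  have h := LinearPMap.adjoint_graph_eq_graph_adjoint hA.dense_domain
  rw [LinearPMap.isSelfAdjoint_def.mp hA] at h
  constructor
  · intro hf a b hab
    rw [h, Submodule.mem_adjoint_iff] at hf
    exact sub_eq_zero.mp (hf a b hab)
  · intro hf
    rw [h, Submodule.mem_adjoint_iff]
    exact fun a b hab => sub_eq_zero.mpr (hf a b hab)

namespace MetricGraph

variable {V I X : Type*} {Γ : MetricGraph V I X}

theorem outwardSign_mul_self (p : EdgeEnd I X) : outwardSign p * outwardSign p = 1 := by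
  cases p <;> simp [outwardSign]

theorem conj_outwardSign (p : EdgeEnd I X) :
    (starRingEnd ℂ) (outwardSign p) = outwardSign p := by
  cases p <;> simp [outwardSign]

/-- The vector of derivatives in the directions into the edges. -/
abbrev outward (y : EdgeEnd I X → ℂ) : EdgeEnd I X → ℂ := fun p => outwardSign p * y p

theorem outward_outward (y : EdgeEnd I X → ℂ) : outward (outward y) = y := by
  funext p
  rw [outward, outward, ← mul_assoc, outwardSign_mul_self, one_mul]

section Extend

variable [DecidableEq V]

/-- Extension by zero to all ends of a vector at the vertex `v`. -/
def extendVertex (Γ : MetricGraph V I X) (v : V) (a : EuclideanSpace ℂ (Γ.EndsAt v)) :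
    EdgeEnd I X → ℂ :=
  fun p => if h : Γ.vertexOf p = v then a ⟨p, h⟩ else 0

theorem atVertex_extendVertex (v : V) (a : EuclideanSpace ℂ (Γ.EndsAt v)) :
    Γ.atVertex (Γ.extendVertex v a) v = a := by
  ext p
  simp [atVertex, extendVertex, p.2]

theorem atVertex_extendVertex_of_ne {v v' : V} (hv : v' ≠ v) (a : EuclideanSpace ℂ (Γ.EndsAt v)) :
    Γ.atVertex (Γ.extendVertex v a) v' = 0 := by
  ext p
  simp [atVertex, extendVertex, p.2, hv]

end Extend

variable [Fintype V] [DecidableEq V] [Fintype I] [Fintype X] {A B : Γ.VertexMatrices}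

theorem sum_inner_atVertex (x y : EdgeEnd I X → ℂ) :
    ∑ v, inner ℂ (Γ.atVertex x v) (Γ.atVertex y v) = ∑ p, (starRingEnd ℂ) (x p) * y p := by
  rw [← Fintype.sum_fiberwise Γ.vertexOf]
  refine Finset.sum_congr rfl fun v _ => ?_
  rw [PiLp.inner_apply]
  refine Finset.sum_congr rfl fun p _ => ?_
  simp [atVertex, mul_comm]

/-- Green's formula. -/
theorem HasDeriv.inner_sub_inner {u u' u'' w w' w'' : Γ.L2} {x y x₁ y₁ : EdgeEnd I X → ℂ}
    (hu : Γ.HasDeriv u u') (hu' : Γ.HasDeriv u' u'') (hw : Γ.HasDeriv w w')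
    (hw' : Γ.HasDeriv w' w'') (hx : Γ.HasValues u x) (hy : Γ.HasValues u' y)
    (hx₁ : Γ.HasValues w x₁) (hy₁ : Γ.HasValues w' y₁) :
    inner ℂ u'' w - inner ℂ u w'' =
      ∑ v, (inner ℂ (Γ.atVertex x v) (Γ.atVertex (outward y₁) v) -
        inner ℂ (Γ.atVertex (outward y) v) (Γ.atVertex x₁ v)) := by
  -- Both integrations by parts contain `⟨u', w'⟩`, which cancels in the difference.
  have h1 := hu'.inner_add_inner hw hy hx₁
  have h2 := hu.inner_add_inner hw' hx hy₁
  rw [Finset.sum_sub_distrib, sum_inner_atVertex, sum_inner_atVertex]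
  have e1 : ∀ p, outwardSign p * ((starRingEnd ℂ) (y p) * x₁ p) =
      (starRingEnd ℂ) (outward y p) * x₁ p := fun p => by
    rw [outward, map_mul, conj_outwardSign, mul_assoc]
  have e2 : ∀ p, outwardSign p * ((starRingEnd ℂ) (x p) * y₁ p) =
      (starRingEnd ℂ) (x p) * outward y₁ p := fun p => by
    rw [outward, mul_left_comm]
  simp only [e1] at h1
  simp only [e2] at h2
  linear_combination h1 - h2

/-- Extend `a` and `b` by zero to the other vertices and realise them as boundary data of some `u`;
`outward` is an involution, so prescribing `outward` of `b` yields the outward derivative `b`.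
Green's formula then has a term at `v` only, and "`u` is in the domain iff it is symmetric against
the domain" becomes the same statement for `(a, b)` at `v`. -/
theorem isLagrangianCondition (hsa : IsSelfAdjoint (Γ.laplacian A B)) (v : V) :
    IsLagrangianCondition (A v) (B v) := by
  intro a b
  obtain ⟨u, u', u'', h1, h2, h3, h4⟩ := Γ.exists_hasDeriv_hasValues (Γ.extendVertex v a)
    (outward (Γ.extendVertex v b))
  have green : ∀ (w w' w'' : Γ.L2) (x₁ y₁ : EdgeEnd I X → ℂ), Γ.HasDeriv w w' →
      Γ.HasDeriv w' w'' → Γ.HasValues w x₁ → Γ.HasValues w' y₁ →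
      inner ℂ u'' w - inner ℂ u w'' =
        inner ℂ a (Γ.atVertex (outward y₁) v) - inner ℂ b (Γ.atVertex x₁ v) := by
    intro w w' w'' x₁ y₁ k1 k2 k3 k4
    rw [h1.inner_sub_inner h2 k1 k2 h3 h4 k3 k4, outward_outward,
      Finset.sum_eq_single v, atVertex_extendVertex, atVertex_extendVertex]
    · intro v' _ hv'
      rw [atVertex_extendVertex_of_ne hv', atVertex_extendVertex_of_ne hv', inner_zero_left,
        inner_zero_left, sub_zero]
    · simp
  have hmem : matrixMap (A v) a + matrixMap (B v) b = 0 ↔ (u, u'') ∈ (Γ.laplacian A B).graph := by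
    rw [graph_laplacian]
    constructor
    · intro hab
      refine ⟨u', _, _, h1, h2, h3, h4, fun v' => ?_⟩
      change matrixMap (A v') (Γ.atVertex (Γ.extendVertex v a) v') +
        matrixMap (B v') (Γ.atVertex (outward (outward (Γ.extendVertex v b))) v') = 0
      rw [outward_outward]
      by_cases hv : v' = v
      · subst hv
        rw [atVertex_extendVertex, atVertex_extendVertex, hab]
      · rw [atVertex_extendVertex_of_ne hv, atVertex_extendVertex_of_ne hv, map_zero, map_zero,
          add_zero]
    · rintro ⟨z', x, y, k1, k2, k3, k4, k5⟩
      obtain rfl := h1.unique k1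
      obtain rfl := h1.values_unique h3 k3
      obtain rfl := h2.values_unique h4 k4
      have := k5 v
      change matrixMap (A v) (Γ.atVertex (Γ.extendVertex v a) v) +
        matrixMap (B v) (Γ.atVertex (outward (outward (Γ.extendVertex v b))) v) = 0 at this
      rwa [outward_outward, atVertex_extendVertex, atVertex_extendVertex] at this
  rw [hmem, LinearPMap.mem_graph_iff_of_isSelfAdjoint hsa]
  constructor
  · intro h a₁ b₁ hab₁
    obtain ⟨w, w', w'', k1, k2, k3, k4⟩ := Γ.exists_hasDeriv_hasValues (Γ.extendVertex v a₁)
      (outward (Γ.extendVertex v b₁))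
    have hw : (w, w'') ∈ (Γ.laplacian A B).graph := by
      rw [graph_laplacian]
      refine ⟨w', _, _, k1, k2, k3, k4, fun v' => ?_⟩
      change matrixMap (A v') (Γ.atVertex (Γ.extendVertex v a₁) v') +
        matrixMap (B v') (Γ.atVertex (outward (outward (Γ.extendVertex v b₁))) v') = 0
      rw [outward_outward]
      by_cases hv : v' = v
      · subst hv
        rw [atVertex_extendVertex, atVertex_extendVertex, hab₁]
      · rw [atVertex_extendVertex_of_ne hv, atVertex_extendVertex_of_ne hv, map_zero, map_zero,
          add_zero]
    have e := green w w' w'' _ _ k1 k2 k3 k4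
    rw [outward_outward, atVertex_extendVertex, atVertex_extendVertex] at e
    have e2 : inner ℂ u'' w = inner ℂ u w'' := by
      rw [← inner_conj_symm, ← h w w'' hw, inner_conj_symm]
    rw [e2, sub_self] at e
    exact (sub_eq_zero.mp e.symm)
  · intro h w w'' hw
    rw [graph_laplacian] at hw
    obtain ⟨w', x₁, y₁, k1, k2, k3, k4, k5⟩ := hw
    have e := green w w' w'' x₁ y₁ k1 k2 k3 k4
    rw [h _ _ (k5 v), sub_self, sub_eq_zero] at e
    rw [← inner_conj_symm, ← e, inner_conj_symm]

end MetricGraph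

/-! ### The quadratic form -/

namespace MetricGraph

variable {V I X : Type*} [Fintype I] [Fintype X] {Γ : MetricGraph V I X}

/-- The norm of `W^{1,2}(Γ)`. -/
noncomputable def sobolevNorm (Γ : MetricGraph V I X) (u : Γ.L2) : ℝ :=
  √(‖u‖ ^ 2 + ‖Γ.grad u‖ ^ 2)

theorem sobolevNorm_nonneg (u : Γ.L2) : 0 ≤ Γ.sobolevNorm u := Real.sqrt_nonneg _

theorem sobolevNorm_sq (u : Γ.L2) : Γ.sobolevNorm u ^ 2 = ‖u‖ ^ 2 + ‖Γ.grad u‖ ^ 2 :=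
  Real.sq_sqrt (by positivity)

theorem norm_le_sobolevNorm (u : Γ.L2) : ‖u‖ ≤ Γ.sobolevNorm u :=
  Real.le_sqrt_of_sq_le (le_add_of_nonneg_right (sq_nonneg _))

theorem norm_grad_le_sobolevNorm (u : Γ.L2) : ‖Γ.grad u‖ ≤ Γ.sobolevNorm u :=
  Real.le_sqrt_of_sq_le (le_add_of_nonneg_left (sq_nonneg _))

variable [DecidableEq V]

theorem norm_sq_atVertex_le (x : EdgeEnd I X → ℂ) (v : V) :
    ‖Γ.atVertex x v‖ ^ 2 ≤ ∑ p, ‖x p‖ ^ 2 := by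
  rw [EuclideanSpace.norm_sq_eq]
  have : ∑ p : Γ.EndsAt v, ‖Γ.atVertex x v p‖ ^ 2 = ∑ p : Γ.EndsAt v, ‖x p‖ ^ 2 := rfl
  rw [this, ← Finset.sum_subtype (Finset.univ.filter fun p => Γ.vertexOf p = v) (by simp)
    fun p => ‖x p‖ ^ 2]
  exact Finset.sum_le_sum_of_subset_of_nonneg (Finset.filter_subset _ _)
    fun _ _ _ => by positivity

theorem HasDeriv.norm_sq_atVertex_le {u w : Γ.L2} {x : EdgeEnd I X → ℂ} (h : Γ.HasDeriv u w)
    (hx : Γ.HasValues u x) {d : ℝ} (hd : 0 < d) (hlen : ∀ e, d ≤ Γ.len e) (v : V) :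
    ‖Γ.atVertex x v‖ ^ 2 ≤
      Fintype.card (EdgeEnd I X) * (2 * d * ‖w‖ ^ 2 + 2 / d * ‖u‖ ^ 2) := by
  refine (Γ.norm_sq_atVertex_le x v).trans ?_
  refine (Finset.sum_le_sum fun p _ => h.norm_sq_value_le hx hd hlen p).trans ?_
  rw [Finset.sum_const, Finset.card_univ, nsmul_eq_mul]

variable (Γ) in
theorem exists_norm_atVertex_le : ∃ C : ℝ, 0 ≤ C ∧ ∀ (u w : Γ.L2) (x : EdgeEnd I X → ℂ),
    Γ.HasDeriv u w → Γ.HasValues u x → ∀ v, ‖Γ.atVertex x v‖ ≤ C * Γ.sobolevNorm u := by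
  obtain ⟨d, hd, hlen⟩ := Γ.exists_le_len
  set N : ℝ := (Fintype.card (EdgeEnd I X) : ℝ)
  set K : ℝ := N * (2 * d + 2 / d)
  have hK : 0 ≤ K := by positivity
  refine ⟨√K, Real.sqrt_nonneg _, fun u w x h hx v => ?_⟩
  rw [sobolevNorm, ← Real.sqrt_mul hK]
  refine Real.le_sqrt_of_sq_le ((h.norm_sq_atVertex_le hx hd hlen v).trans ?_)
  rw [h.grad_eq, mul_assoc N]
  refine mul_le_mul_of_nonneg_left ?_ (by positivity)
  have h1 : 0 ≤ 2 * d * ‖u‖ ^ 2 := by positivity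
  have h2 : 0 ≤ 2 / d * ‖w‖ ^ 2 := by positivity
  nlinarith

/-- `D(𝓔)` is closed in `W^{1,2}(Γ)`. -/
theorem mem_energyDomain_of_tendsto {B : Γ.VertexMatrices} {u : ℕ → Γ.L2} {f w : Γ.L2}
    (hu : ∀ k, u k ∈ Γ.energyDomain B) (hf : Tendsto u atTop (𝓝 f))
    (hw : Tendsto (fun k => Γ.grad (u k)) atTop (𝓝 w)) :
    f ∈ Γ.energyDomain B ∧ Γ.grad f = w := by
  choose w' x h1 h2 h3 using hu
  have hd : Γ.HasDeriv f w := by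
    refine Γ.isClosed_hasDeriv.mem_of_tendsto (hf.prodMk_nhds hw) (Eventually.of_forall fun k => ?_)
    change Γ.HasDeriv (u k) (Γ.grad (u k))
    rw [(h1 k).grad_eq]
    exact h1 k
  obtain ⟨z, hz⟩ := hd.exists_values
  refine ⟨⟨w, z, hd, hz, fun v => ?_⟩, hd.grad_eq⟩
  -- By the trace inequality the boundary values converge too, so the Dirichlet condition survives
  -- the limit.
  obtain ⟨C, hC, hb⟩ := Γ.exists_norm_atVertex_le
  have hs : Tendsto (fun k => C * Γ.sobolevNorm (u k - f)) atTop (𝓝 0) := by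
    have e : ∀ k, Γ.sobolevNorm (u k - f) = √(‖u k - f‖ ^ 2 + ‖Γ.grad (u k) - w‖ ^ 2) := by
      intro k
      rw [sobolevNorm, ((h1 k).sub hd).grad_eq, (h1 k).grad_eq]
    simp only [e]
    have t1 := (tendsto_sub_nhds_zero_iff.mpr hf).norm
    have t2 := (tendsto_sub_nhds_zero_iff.mpr hw).norm
    have := (((t1.pow 2).add (t2.pow 2)).sqrt).const_mul C
    simpa using this
  have ht : Tendsto (fun k => Γ.atVertex (x k) v) atTop (𝓝 (Γ.atVertex z v)) := by
    rw [tendsto_iff_norm_sub_tendsto_zero]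
    refine squeeze_zero (fun _ => norm_nonneg _) (fun k => ?_) hs
    exact hb _ _ _ ((h1 k).sub hd) ((h2 k).sub hz) v
  have := ((dirichletProj (B v)).continuous.tendsto _).comp ht
  refine tendsto_nhds_unique this ?_
  simp only [Function.comp_def, h3]
  exact tendsto_const_nhds

variable {A B : Γ.VertexMatrices}

theorem mem_energyDomain_of_mem_graph (hL : ∀ v, IsLagrangianCondition (A v) (B v)) {u g : Γ.L2}
    (h : (u, g) ∈ (Γ.laplacian A B).graph) : u ∈ Γ.energyDomain B := by
  rw [graph_laplacian] at h
  obtain ⟨u', x, y, h1, -, h3, -, h5⟩ := h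
  exact ⟨u', x, h1, h3, fun v => (hL v).dirichletProj_eq_zero (h5 v)⟩

variable [Fintype V]

theorem exists_bound_robinMap (hL : ∀ v, IsLagrangianCondition (A v) (B v)) :
    ∃ C : ℝ, 0 ≤ C ∧ ∀ v a, dirichletProj (B v) a = 0 →
      ‖robinMap (A v) (B v) (robinProj (A v) (B v) a)‖ ≤ C * ‖a‖ := by
  choose C hC h using fun v => (hL v).exists_bound_robinMap
  refine ⟨∑ v, C v, Finset.sum_nonneg fun v _ => hC v, fun v a ha => (h v a ha).trans ?_⟩
  exact mul_le_mul_of_nonneg_right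
    (Finset.single_le_sum (fun v _ => hC v) (Finset.mem_univ v)) (norm_nonneg _)

theorem HasDeriv.energy_eq {u w : Γ.L2} {x : EdgeEnd I X → ℂ} (h : Γ.HasDeriv u w)
    (hx : Γ.HasValues u x) :
    Γ.energy A B u = ‖w‖ ^ 2 +
      ∑ v, (inner ℂ (robinMap (A v) (B v) (robinProj (A v) (B v) (Γ.atVertex x v)))
        (robinProj (A v) (B v) (Γ.atVertex x v))).re := by
  rw [energy, h.grad_eq, h.values_eq hx, norm_sq_eq_sum]

/-- The vertex terms are bounded by the squared boundary values, and the trace inequality on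
intervals of length `d` bounds these by a small multiple of `‖u'‖²` plus a large multiple of `‖u‖²`.
The shift `M` absorbs the latter. -/
theorem exists_isFormConstant (hL : ∀ v, IsLagrangianCondition (A v) (B v)) :
    ∃ M : ℝ, Γ.IsFormConstant A B M := by
  obtain ⟨C, hC, hb⟩ := exists_bound_robinMap hL
  obtain ⟨δ, hδ, hlen⟩ := Γ.exists_le_len
  set N : ℝ := Fintype.card V * (C * Fintype.card (EdgeEnd I X)) with hN
  have hN0 : 0 ≤ N := by positivity
  -- Short enough to fit in every edge and to keep the coefficient `2 d N` of the gradient below `1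
  -- / 2`.
  set d := min δ (1 / (4 * (N + 1))) with hd
  have hd0 : 0 < d := lt_min hδ (by positivity)
  have hd1 : 2 * d * N ≤ 1 / 2 := by
    have : d ≤ 1 / (4 * (N + 1)) := min_le_right _ _
    rw [le_div_iff₀ (by positivity)] at this
    nlinarith
  set k := N * (2 / d) with hk
  have hk0 : 0 ≤ k := by positivity
  have key : ∀ u w x, Γ.HasDeriv u w → Γ.HasValues u x →
      (∀ v, dirichletProj (B v) (Γ.atVertex x v) = 0) →
      |∑ v, (inner ℂ (robinMap (A v) (B v) (robinProj (A v) (B v) (Γ.atVertex x v)))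
        (robinProj (A v) (B v) (Γ.atVertex x v))).re| ≤ 1 / 2 * ‖w‖ ^ 2 + k * ‖u‖ ^ 2 := by
    intro u w x h1 h2 h3
    have hv : ∀ v, |(inner ℂ (robinMap (A v) (B v) (robinProj (A v) (B v) (Γ.atVertex x v)))
        (robinProj (A v) (B v) (Γ.atVertex x v))).re| ≤
        C * (Fintype.card (EdgeEnd I X) * (2 * d * ‖w‖ ^ 2 + 2 / d * ‖u‖ ^ 2)) := by
      intro v
      obtain ⟨b, hab⟩ := (hL v).exists_of_dirichletProj_eq_zero (h3 v)
      rw [(hL v).inner_robinMap hab]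
      refine (Complex.abs_re_le_norm _).trans ?_
      rw [norm_inner_symm]
      refine ((hL v).norm_inner_le (hb v) (h3 v) hab).trans ?_
      rw [mul_assoc, ← sq]
      exact mul_le_mul_of_nonneg_left (h1.norm_sq_atVertex_le h2 hd0
        (fun e => (min_le_left _ _).trans (hlen e)) v) hC
    refine (Finset.abs_sum_le_sum_abs _ _).trans ((Finset.sum_le_sum fun v _ => hv v).trans ?_)
    rw [Finset.sum_const, Finset.card_univ, nsmul_eq_mul]
    have e : (Fintype.card V : ℝ) * (C * (Fintype.card (EdgeEnd I X) *
        (2 * d * ‖w‖ ^ 2 + 2 / d * ‖u‖ ^ 2))) = 2 * d * N * ‖w‖ ^ 2 + k * ‖u‖ ^ 2 := by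
      rw [hk, hN]; ring
    rw [e]
    gcongr
  -- The energy lies between `‖w‖² / 2 - k ‖u‖²` and `3 ‖w‖² / 2 + k ‖u‖²`, whence these constants.
  refine ⟨k + 1 / 2, by positivity, 1 / 2, 2 * k + 2, by norm_num, ?_⟩
  rintro u ⟨w, x, h1, h2, h3⟩
  have h4 := abs_le.mp (key u w x h1 h2 h3)
  rw [h1.energy_eq h2, h1.grad_eq]
  have h5 : 0 ≤ k * ‖w‖ ^ 2 := by positivity
  have h6 := sq_nonneg ‖u‖
  have h7 := sq_nonneg ‖w‖
  constructor <;> nlinarith [h4.1, h4.2]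

/-- Integration by parts, with the boundary terms converted into Robin terms by `inner_robinMap`.
This ties the form to the operator. -/
theorem energy_eq_of_mem_graph (hL : ∀ v, IsLagrangianCondition (A v) (B v)) {u g : Γ.L2}
    (h : (u, g) ∈ (Γ.laplacian A B).graph) : Γ.energy A B u = -(inner ℂ g u).re := by
  rw [graph_laplacian] at h
  obtain ⟨u', x, y, h1, h2, h3, h4, h5⟩ := h
  have e := h2.inner_add_inner h1 h4 h3
  have e1 : ∑ p, outwardSign p * ((starRingEnd ℂ) (y p) * x p) =
      ∑ v, inner ℂ (Γ.atVertex (outward y) v) (Γ.atVertex x v) := by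
    rw [sum_inner_atVertex]
    refine Finset.sum_congr rfl fun p _ => ?_
    rw [outward, map_mul, conj_outwardSign, mul_assoc]
  have e2 := congrArg Complex.re (e1 ▸ e)
  rw [Complex.add_re, Complex.neg_re, Complex.re_sum] at e2
  have e3 : (inner ℂ u' u').re = ‖u'‖ ^ 2 := inner_self_eq_norm_sq (𝕜 := ℂ) u'
  rw [h1.energy_eq h3, ← e3]
  have e4 : ∀ v, inner ℂ (robinMap (A v) (B v) (robinProj (A v) (B v) (Γ.atVertex x v)))
        (robinProj (A v) (B v) (Γ.atVertex x v)) =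
        inner ℂ (Γ.atVertex (outward y) v) (Γ.atVertex x v) := fun v =>
    (hL v).inner_robinMap (h5 v)
  simp only [e4]
  linarith

/-- The form is bounded in the norm of `W^{1,2}(Γ)`. -/
theorem exists_norm_inner_laplacian_le (hL : ∀ v, IsLagrangianCondition (A v) (B v)) :
    ∃ K : ℝ, 0 ≤ K ∧ ∀ f ∈ Γ.energyDomain B, ∀ u g, (u, g) ∈ (Γ.laplacian A B).graph →
      ‖inner ℂ f g‖ ≤ K * Γ.sobolevNorm f * Γ.sobolevNorm u := by
  obtain ⟨C, hC, hb⟩ := exists_bound_robinMap hL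
  obtain ⟨D, hD, hDb⟩ := Γ.exists_norm_atVertex_le
  refine ⟨Fintype.card V * (C * D * D) + 1, by positivity, ?_⟩
  rintro f ⟨f', z, k1, k2, k3⟩ u g h
  rw [graph_laplacian] at h
  obtain ⟨u', x, y, h1, h2, h3, h4, h5⟩ := h
  have e := k1.inner_add_inner h2 k2 h4
  have e1 : ∑ p, outwardSign p * ((starRingEnd ℂ) (z p) * y p) =
      ∑ v, inner ℂ (Γ.atVertex z v) (Γ.atVertex (outward y) v) := by
    rw [sum_inner_atVertex]
    refine Finset.sum_congr rfl fun p _ => ?_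
    rw [outward, mul_left_comm]
  have e2 : inner ℂ f g = -(∑ v, inner ℂ (Γ.atVertex z v) (Γ.atVertex (outward y) v)) -
      inner ℂ f' u' := by
    rw [← e1, ← e]; ring
  have b1 : ‖inner ℂ f' u'‖ ≤ Γ.sobolevNorm f * Γ.sobolevNorm u := by
    refine (norm_inner_le_norm _ _).trans ?_
    rw [← k1.grad_eq, ← h1.grad_eq]
    exact mul_le_mul (norm_grad_le_sobolevNorm _) (norm_grad_le_sobolevNorm _) (norm_nonneg _)
      (sobolevNorm_nonneg _)
  -- The end derivatives of `u` are not controlled by its Sobolev norm; the Lagrangian property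
  -- trades them for values.
  have b2 : ∀ v, ‖inner ℂ (Γ.atVertex z v) (Γ.atVertex (outward y) v)‖ ≤
      C * D * D * (Γ.sobolevNorm f * Γ.sobolevNorm u) := by
    intro v
    refine ((hL v).norm_inner_le (hb v) (k3 v) (h5 v)).trans ?_
    have i1 := hDb f f' z k1 k2 v
    have i2 := hDb u u' x h1 h3 v
    have i3 : ‖Γ.atVertex z v‖ * ‖Γ.atVertex x v‖ ≤
        (D * Γ.sobolevNorm f) * (D * Γ.sobolevNorm u) :=
      mul_le_mul i1 i2 (norm_nonneg _) (mul_nonneg hD (sobolevNorm_nonneg _))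
    calc C * ‖Γ.atVertex z v‖ * ‖Γ.atVertex x v‖
        = C * (‖Γ.atVertex z v‖ * ‖Γ.atVertex x v‖) := by ring
      _ ≤ C * ((D * Γ.sobolevNorm f) * (D * Γ.sobolevNorm u)) :=
        mul_le_mul_of_nonneg_left i3 hC
      _ = _ := by ring
  rw [e2]
  refine (norm_sub_le _ _).trans ?_
  rw [norm_neg]
  have b3 := (norm_sum_le Finset.univ fun v =>
    inner ℂ (Γ.atVertex z v) (Γ.atVertex (outward y) v)).trans
      (Finset.sum_le_sum fun v _ => b2 v)
  rw [Finset.sum_const, Finset.card_univ, nsmul_eq_mul] at b3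
  linarith

end MetricGraph

/-! ### Resolvents of semibounded self-adjoint operators -/

section Resolvent

variable {H : Type*} [NormedAddCommGroup H] [InnerProductSpace ℂ H]

/-- `R = (M - A)⁻¹`. -/
structure IsResolvent (A : H →ₗ.[ℂ] H) (M : ℝ) (R : H →L[ℂ] H) : Prop where
  mem : ∀ h, (R h, (M : ℂ) • R h - h) ∈ A.graph
  eq : ∀ f g, (f, g) ∈ A.graph → R ((M : ℂ) • f - g) = f

/-- `M - A` is bounded below by a positive constant. -/
def IsCoerciveAt (A : H →ₗ.[ℂ] H) (M : ℝ) : Prop :=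
  ∃ c : ℝ, 0 < c ∧ ∀ f g, (f, g) ∈ A.graph → c * ‖f‖ ^ 2 ≤ M * ‖f‖ ^ 2 - (inner ℂ g f).re

theorem re_inner_smul_sub (M : ℝ) (f g : H) :
    (inner ℂ ((M : ℂ) • f - g) f).re = M * ‖f‖ ^ 2 - (inner ℂ g f).re := by
  have h : inner ℂ f f = ((‖f‖ ^ 2 : ℝ) : ℂ) := by
    rw [inner_self_eq_norm_sq_to_K]; norm_cast
  rw [inner_sub_left, inner_smul_left, h, Complex.conj_ofReal, ← Complex.ofReal_mul,
    Complex.sub_re, Complex.ofReal_re]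

/-- For the resolvent, this says that the quadratic form of `R` at `h` is the shifted energy of `R
h`. -/
theorem re_inner_apply_self (M : ℝ) (R : H →L[ℂ] H) (h : H) :
    (inner ℂ h (R h)).re = M * ‖R h‖ ^ 2 - (inner ℂ ((M : ℂ) • R h - h) (R h)).re := by
  rw [← re_inner_smul_sub, sub_sub_cancel]

variable {A : H →ₗ.[ℂ] H} {M : ℝ} {R : H →L[ℂ] H}

theorem IsResolvent.injective (hR : IsResolvent A M R) : Function.Injective R := by
  rw [injective_iff_map_eq_zero]
  intro h h0
  have := hR.mem h
  rw [h0, smul_zero, zero_sub] at this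
  have := A.graph_fst_eq_zero_snd this rfl
  exact neg_eq_zero.mp this

variable [CompleteSpace H]

/-- Coercivity makes `M - A`, viewed as a map on the complete graph of `A`, bounded below, so it is
injective with closed range. A vector orthogonal to the range lies in the domain with `A h = M h`,
by self-adjointness, and is zero by coercivity. -/
theorem exists_isResolvent (hA : IsSelfAdjoint A) (hM : IsCoerciveAt A M) :
    ∃ R : H →L[ℂ] H, IsResolvent A M R := by
  obtain ⟨c, hc, hb⟩ := hM
  let Φ : A.graph →ₗ[ℂ] H :=
    ((M : ℂ) • LinearMap.fst ℂ H H - LinearMap.snd ℂ H H) ∘ₗ A.graph.subtype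
  have hΦ : ∀ q : A.graph, Φ q = (M : ℂ) • q.1.1 - q.1.2 := fun q => rfl
  have h1 : ∀ q : A.graph, c * ‖q.1.1‖ ≤ ‖Φ q‖ := by
    intro q
    have := hb q.1.1 q.1.2 q.2
    rw [← re_inner_smul_sub, ← hΦ] at this
    have h2 : c * ‖q.1.1‖ ^ 2 ≤ ‖Φ q‖ * ‖q.1.1‖ :=
      this.trans ((Complex.re_le_norm _).trans (norm_inner_le_norm _ _))
    rcases (norm_nonneg q.1.1).eq_or_lt with h0 | h0
    · rw [← h0, mul_zero]; exact norm_nonneg _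
    · rw [sq, ← mul_assoc] at h2
      exact le_of_mul_le_mul_right h2 h0
  have h1' : ∀ q : A.graph, ‖q.1.1‖ ≤ 1 / c * ‖Φ q‖ := fun q => by
    rw [div_mul_eq_mul_div, one_mul, le_div_iff₀ hc, mul_comm]
    exact h1 q
  have : CompleteSpace A.graph := by
    have hcl : IsClosed (A.graph : Set (H × H)) := hA.isClosed
    exact hcl.completeSpace_coe
  have hΦc : Continuous Φ := by
    have : (Φ : A.graph → H) = fun q => (M : ℂ) • q.1.1 - q.1.2 := rfl
    rw [this]
    fun_prop
  let Φ' : A.graph →L[ℂ] H := ⟨Φ, hΦc⟩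
  set K : ℝ := (|M| + 1) * (1 / c) + 1 with hK
  have hK0 : 0 ≤ K := by positivity
  have hanti : AntilipschitzWith ⟨K, hK0⟩ Φ' := by
    refine Φ'.antilipschitz_of_bound fun q => ?_
    change ‖q.1‖ ≤ K * ‖Φ q‖
    have i1 := h1' q
    have i2 : ‖q.1.2‖ ≤ |M| * ‖q.1.1‖ + ‖Φ q‖ := by
      have : q.1.2 = (M : ℂ) • q.1.1 - Φ q := by rw [hΦ]; abel
      rw [this]
      refine (norm_sub_le _ _).trans ?_
      rw [norm_smul, Complex.norm_real, Real.norm_eq_abs]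
    have i3 : |M| * ‖q.1.1‖ ≤ |M| * (1 / c * ‖Φ q‖) :=
      mul_le_mul_of_nonneg_left i1 (abs_nonneg _)
    have i4 : 0 ≤ 1 / c * ‖Φ q‖ := by positivity
    have i5 : 0 ≤ |M| * (1 / c * ‖Φ q‖) := by positivity
    rw [Prod.norm_def]
    refine max_le ?_ ?_ <;> rw [hK] <;> nlinarith [norm_nonneg (Φ q)]
  have hclosed : IsClosed (LinearMap.range Φ : Set H) := by
    have := hanti.isClosed_range Φ'.uniformContinuous
    exact this
  have hinj : Function.Injective Φ := hanti.injective
  have horth : (LinearMap.range Φ)ᗮ = ⊥ := by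
    rw [Submodule.eq_bot_iff]
    intro h hh
    rw [Submodule.mem_orthogonal] at hh
    have hmem : (h, (M : ℂ) • h) ∈ A.graph := by
      rw [LinearPMap.mem_graph_iff_of_isSelfAdjoint hA]
      intro a b hab
      have := hh _ ⟨⟨(a, b), hab⟩, rfl⟩
      rw [hΦ, inner_sub_left, inner_smul_left, Complex.conj_ofReal, sub_eq_zero] at this
      rw [inner_smul_right, this]
    have h0 := h1 ⟨_, hmem⟩
    rw [hΦ, sub_self, norm_zero] at h0
    exact norm_eq_zero.mp (le_antisymm (by nlinarith [norm_nonneg h]) (norm_nonneg h))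
  have hsurj : Function.Surjective Φ := by
    rw [← LinearMap.range_eq_top, ← hclosed.submodule_topologicalClosure_eq,
      Submodule.topologicalClosure_eq_top_iff]
    exact horth
  let E := LinearEquiv.ofBijective Φ ⟨hinj, hsurj⟩
  have hE : ∀ h, Φ (E.symm h) = h := fun h => E.apply_symm_apply h
  let R₀ : H →ₗ[ℂ] H := LinearMap.fst ℂ H H ∘ₗ A.graph.subtype ∘ₗ E.symm.toLinearMap
  have hR₀ : ∀ h, R₀ h = (E.symm h).1.1 := fun h => rfl
  refine ⟨R₀.mkContinuous (1 / c) fun h => ?_, fun h => ?_, fun f g hfg => ?_⟩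
  · rw [hR₀]
    have := h1' (E.symm h)
    rwa [hE] at this
  · change (R₀ h, (M : ℂ) • R₀ h - h) ∈ A.graph
    have : (R₀ h, (M : ℂ) • R₀ h - h) = (E.symm h).1 := by
      refine Prod.ext rfl ?_
      have e := hE h
      rw [hΦ] at e
      change (M : ℂ) • R₀ h - h = (E.symm h).1.2
      rw [hR₀, sub_eq_iff_eq_add, ← sub_eq_iff_eq_add']
      exact e
    rw [this]
    exact (E.symm h).2
  · change R₀ ((M : ℂ) • f - g) = f
    have : (M : ℂ) • f - g = E ⟨(f, g), hfg⟩ := rfl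
    rw [hR₀, this, E.symm_apply_apply]

namespace IsResolvent

theorem nonneg (hR : IsResolvent A M R) (hA : IsSelfAdjoint A) (hM : IsCoerciveAt A M) :
    0 ≤ R := by
  obtain ⟨c, hc, hb⟩ := hM
  rw [ContinuousLinearMap.nonneg_iff_isPositive, ContinuousLinearMap.isPositive_def]
  constructor
  · intro h k
    change inner ℂ (R h) k = inner ℂ h (R k)
    have := (LinearPMap.mem_graph_iff_of_isSelfAdjoint hA _ _).mp (hR.mem k) _ _ (hR.mem h)
    rw [inner_sub_left, inner_sub_right, inner_smul_left, inner_smul_right,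
      Complex.conj_ofReal] at this
    exact (sub_right_injective this).symm
  · intro h
    change 0 ≤ (inner ℂ (R h) h).re
    rw [← inner_conj_symm, Complex.conj_re, re_inner_apply_self M]
    exact le_trans (by positivity) (hb _ _ (hR.mem h))

theorem denseRange (hR : IsResolvent A M R) (hA : IsSelfAdjoint A) : DenseRange R := by
  refine hA.dense_domain.mono ?_
  intro f hf
  exact ⟨_, hR.eq f (A ⟨f, hf⟩) (A.mem_graph ⟨f, hf⟩)⟩

end IsResolvent

end Resolvent

/-! ### Stone's theorem for semibounded self-adjoint operators -/

section Stone

/-- The function `z ↦ z exp(it(M - 1/z))` on `[0, ∞)`. -/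
noncomputable def groupSymbol (M t : ℝ) (z : ℂ) : ℂ :=
  z * Complex.exp (Complex.I * ((t * (M - ‖z‖⁻¹) : ℝ) : ℂ))

theorem norm_exp_I_mul_ofReal' (x : ℝ) : ‖Complex.exp (Complex.I * (x : ℂ))‖ = 1 := by
  rw [mul_comm, Complex.norm_exp_ofReal_mul_I]

theorem norm_groupSymbol (M t : ℝ) (z : ℂ) : ‖groupSymbol M t z‖ = ‖z‖ := by
  rw [groupSymbol, norm_mul, norm_exp_I_mul_ofReal', mul_one]

theorem continuous_groupSymbol (M t : ℝ) : Continuous (groupSymbol M t) := by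
  rw [continuous_iff_continuousAt]
  intro z
  by_cases hz : z = 0
  · subst hz
    -- At `0` the phase oscillates without limit, but the modulus is `‖z‖`.
    have h0 : groupSymbol M t 0 = 0 := by simp [groupSymbol]
    rw [ContinuousAt, h0, tendsto_zero_iff_norm_tendsto_zero]
    simp only [norm_groupSymbol]
    simpa using (continuous_norm (E := ℂ)).tendsto 0
  · have hn : ‖z‖ ≠ 0 := norm_ne_zero_iff.mpr hz
    refine continuousAt_id.mul (Complex.continuous_exp.continuousAt.comp
      (continuousAt_const.mul (Complex.continuous_ofReal.continuousAt.comp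
        (continuousAt_const.mul (continuousAt_const.sub ?_)))))
    exact continuousAt_id.norm.inv₀ hn

theorem groupSymbol_zero (M : ℝ) : groupSymbol M 0 = id := by
  funext z
  simp [groupSymbol]

/-- Each symbol carries one regularising factor `z`, so the group law holds up to one surplus
factor. -/
theorem groupSymbol_mul (M s t : ℝ) (z : ℂ) :
    groupSymbol M s z * groupSymbol M t z = z * groupSymbol M (s + t) z := by
  have : Complex.exp (Complex.I * (((s + t) * (M - ‖z‖⁻¹) : ℝ) : ℂ)) =
      Complex.exp (Complex.I * ((s * (M - ‖z‖⁻¹) : ℝ) : ℂ)) *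
        Complex.exp (Complex.I * ((t * (M - ‖z‖⁻¹) : ℝ) : ℂ)) := by
    rw [← Complex.exp_add]
    congr 1
    push_cast
    ring
  rw [groupSymbol, groupSymbol, groupSymbol, this]
  ring

/-- The frequency `M - 1/‖z‖` is unbounded near `0`, but one factor `z` compensates for it. This
bounds the first time derivative of the symbol. -/
theorem norm_mul_abs_sub_inv_le (M : ℝ) (z : ℂ) : ‖z‖ * |M - ‖z‖⁻¹| ≤ |M| * ‖z‖ + 1 := by
  have h1 : |M - ‖z‖⁻¹| ≤ |M| + ‖z‖⁻¹ := by
    refine (abs_sub _ _).trans ?_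
    rw [abs_of_nonneg (inv_nonneg.mpr (norm_nonneg z))]
  have h2 : ‖z‖ * ‖z‖⁻¹ ≤ 1 := mul_inv_le_one
  nlinarith [norm_nonneg z]

theorem norm_groupSymbol_sub_le (M s t : ℝ) (z : ℂ) :
    ‖groupSymbol M t z - groupSymbol M s z‖ ≤ (|M| * ‖z‖ + 1) * |t - s| := by
  have : groupSymbol M t z - groupSymbol M s z = groupSymbol M s z *
      (Complex.exp (Complex.I * (((t - s) * (M - ‖z‖⁻¹) : ℝ) : ℂ)) - 1) := by
    rw [mul_sub, mul_one]
    congr 1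
    rw [groupSymbol, groupSymbol, mul_assoc, ← Complex.exp_add]
    congr 2
    push_cast
    ring
  rw [this, norm_mul, norm_groupSymbol]
  have h1 : ‖Complex.exp (Complex.I * (((t - s) * (M - ‖z‖⁻¹) : ℝ) : ℂ)) - 1‖ ≤
      |t - s| * |M - ‖z‖⁻¹| := by
    refine Real.norm_exp_I_mul_ofReal_sub_one_le.trans ?_
    rw [Real.norm_eq_abs, abs_mul]
  calc ‖z‖ * ‖Complex.exp (Complex.I * (((t - s) * (M - ‖z‖⁻¹) : ℝ) : ℂ)) - 1‖
      ≤ ‖z‖ * (|t - s| * |M - ‖z‖⁻¹|) := mul_le_mul_of_nonneg_left h1 (norm_nonneg _)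
    _ = ‖z‖ * |M - ‖z‖⁻¹| * |t - s| := by ring
    _ ≤ _ := mul_le_mul_of_nonneg_right (norm_mul_abs_sub_inv_le M z) (abs_nonneg _)

theorem norm_exp_I_mul_sub_le (x : ℝ) :
    ‖Complex.exp (Complex.I * (x : ℂ)) - 1 - Complex.I * x‖ ≤ 2 * x ^ 2 := by
  have hn : ‖Complex.I * (x : ℂ)‖ = |x| := by simp
  rcases le_total |x| 1 with h | h
  · refine (Complex.norm_exp_sub_one_sub_id_le (by rw [hn]; exact h)).trans ?_
    rw [hn, sq_abs]
    nlinarith [sq_nonneg x]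
  · refine (norm_sub_le _ _).trans ?_
    have h1 : ‖Complex.exp (Complex.I * (x : ℂ)) - 1‖ ≤ |x| :=
      Real.norm_exp_I_mul_ofReal_sub_one_le
    rw [hn]
    nlinarith [sq_abs x]

/-- A second factor `z` bounds the second order Taylor remainder in time by a multiple of `t²`. The
linear term `i(M z² - z)` is `i(M - 1/z) z²`, the symbol of `i A R²`; the hypothesis on `z`
identifies `1/z` with `1/‖z‖`. -/
theorem norm_mul_groupSymbol_sub_le (M t : ℝ) {z : ℂ} (hz : z = (‖z‖ : ℂ)) :
    ‖z * groupSymbol M t z - z * z - (t : ℂ) * (Complex.I * (M * (z * z) - z))‖ ≤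
      2 * (|M| * ‖z‖ + 1) ^ 2 * t ^ 2 := by
  have e1 : (M : ℂ) * (z * z) - z = z * z * ((M - ‖z‖⁻¹ : ℝ) : ℂ) := by
    by_cases h0 : z = 0
    · simp [h0]
    · have hn : (‖z‖ : ℂ) ≠ 0 := by exact_mod_cast norm_ne_zero_iff.mpr h0
      have : z * z * ((‖z‖ : ℂ))⁻¹ = z := by
        rw [← hz, mul_assoc, mul_inv_cancel₀ h0, mul_one]
      push_cast
      rw [mul_sub, this]
      ring
  have e : z * groupSymbol M t z - z * z - (t : ℂ) * (Complex.I * (M * (z * z) - z)) =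
      z * z * (Complex.exp (Complex.I * ((t * (M - ‖z‖⁻¹) : ℝ) : ℂ)) - 1 -
        Complex.I * ((t * (M - ‖z‖⁻¹) : ℝ) : ℂ)) := by
    rw [e1, groupSymbol]
    push_cast
    ring
  rw [e, norm_mul, norm_mul]
  have h1 := norm_exp_I_mul_sub_le (t * (M - ‖z‖⁻¹))
  have h2 := norm_mul_abs_sub_inv_le M z
  have h3 : (‖z‖ * |M - ‖z‖⁻¹|) ^ 2 ≤ (|M| * ‖z‖ + 1) ^ 2 := pow_le_pow_left₀ (by positivity) h2 2
  calc ‖z‖ * ‖z‖ * _ ≤ ‖z‖ * ‖z‖ * (2 * (t * (M - ‖z‖⁻¹)) ^ 2) :=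
        mul_le_mul_of_nonneg_left h1 (by positivity)
    _ = 2 * (‖z‖ * |M - ‖z‖⁻¹|) ^ 2 * t ^ 2 := by rw [mul_pow, mul_pow ‖z‖, sq_abs]; ring
    _ ≤ _ := by gcongr

variable {H : Type*} [NormedAddCommGroup H] [InnerProductSpace ℂ H] [CompleteSpace H]
  {R : H →L[ℂ] H}

/-- The operator `R exp(it(M - R⁻¹))`. -/
noncomputable def regularizedGroup (R : H →L[ℂ] H) (M t : ℝ) : H →L[ℂ] H :=
  cfc (groupSymbol M t) R

open scoped ComplexOrder in
theorem eq_norm_of_mem_spectrum (hR : 0 ≤ R) {z : ℂ} (hz : z ∈ spectrum ℂ R) :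
    z = (‖z‖ : ℂ) := by
  have : 0 ≤ z := spectrum_nonneg_of_nonneg hR hz
  exact (Complex.eq_coe_norm_of_nonneg this)

theorem norm_le_of_mem_spectrum {z : ℂ} (hz : z ∈ spectrum ℂ R) : ‖z‖ ≤ ‖R‖ := by
  refine (spectrum.norm_le_norm_mul_of_mem hz).trans ?_
  refine mul_le_of_le_one_right (norm_nonneg _) ContinuousLinearMap.norm_id_le

section

variable (hR : 0 ≤ R) (M : ℝ)
include hR

theorem regularizedGroup_zero : regularizedGroup R M 0 = R := by
  have : IsStarNormal R := (IsSelfAdjoint.of_nonneg hR).isStarNormal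
  rw [regularizedGroup, groupSymbol_zero, cfc_id ℂ R]

theorem regularizedGroup_mul (s t : ℝ) :
    regularizedGroup R M s * regularizedGroup R M t = R * regularizedGroup R M (s + t) := by
  have : IsStarNormal R := (IsSelfAdjoint.of_nonneg hR).isStarNormal
  have c := continuous_groupSymbol M
  rw [regularizedGroup, regularizedGroup, regularizedGroup,
    ← cfc_mul _ _ R (c s).continuousOn (c t).continuousOn]
  conv_rhs => enter [1]; rw [← cfc_id ℂ R]
  rw [← cfc_mul _ _ R continuousOn_id (c (s + t)).continuousOn]
  congr 1
  funext z
  exact groupSymbol_mul M s t z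

theorem commute_regularizedGroup (t : ℝ) :
    R * regularizedGroup R M t = regularizedGroup R M t * R := by
  have h1 := regularizedGroup_mul hR M t 0
  have h2 := regularizedGroup_mul hR M 0 t
  rw [regularizedGroup_zero hR] at h1 h2
  rw [h2, h1, zero_add, add_zero]

/-- The symbol has modulus `‖z‖`, so the functional calculus gives `U* U = R* R`. -/
theorem norm_regularizedGroup_apply (t : ℝ) (h : H) : ‖regularizedGroup R M t h‖ = ‖R h‖ := by
  have hs : IsStarNormal R := (IsSelfAdjoint.of_nonneg hR).isStarNormal
  have c := continuous_groupSymbol M t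
  have key : star (regularizedGroup R M t) * regularizedGroup R M t = star R * R := by
    rw [regularizedGroup, ← cfc_star, ← cfc_mul _ _ R c.star.continuousOn c.continuousOn]
    have e : (fun z => star (groupSymbol M t z) * groupSymbol M t z) =
        fun z : ℂ => star z * z := by
      funext z
      have : ∀ w : ℂ, star w * w = ((‖w‖ ^ 2 : ℝ) : ℂ) := fun w => by
        rw [mul_comm, Complex.star_def, Complex.mul_conj, Complex.normSq_eq_norm_sq]
      rw [this, this, norm_groupSymbol]
    rw [e, cfc_mul (fun z => star z) (fun z => z) R, cfc_star_id R, cfc_id' ℂ R]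
  have h2 : ∀ B : H →L[ℂ] H, inner ℂ (B h) (B h) = inner ℂ h ((star B * B) h) := by
    intro B
    rw [ContinuousLinearMap.star_eq_adjoint, mul_apply_eq_comp,
      ContinuousLinearMap.adjoint_inner_right]
  have h3 : inner ℂ (regularizedGroup R M t h) (regularizedGroup R M t h) =
      inner ℂ (R h) (R h) := by
    rw [h2, h2, key]
  rw [inner_self_eq_norm_sq_to_K, inner_self_eq_norm_sq_to_K] at h3
  have h4 : ‖regularizedGroup R M t h‖ ^ 2 = ‖R h‖ ^ 2 := by exact_mod_cast h3
  exact (pow_left_inj₀ (norm_nonneg _) (norm_nonneg _) two_ne_zero).mp h4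

theorem norm_regularizedGroup_sub_le (s t : ℝ) :
    ‖regularizedGroup R M t - regularizedGroup R M s‖ ≤ (|M| * ‖R‖ + 1) * |t - s| := by
  have hs : IsStarNormal R := (IsSelfAdjoint.of_nonneg hR).isStarNormal
  rw [regularizedGroup, regularizedGroup, ← cfc_sub _ _ R (continuous_groupSymbol M t).continuousOn
    (continuous_groupSymbol M s).continuousOn]
  refine norm_cfc_le (by positivity) fun z hz => ?_
  refine (norm_groupSymbol_sub_le M s t z).trans ?_
  have := norm_le_of_mem_spectrum hz
  gcongr

theorem norm_mul_regularizedGroup_sub_le (t : ℝ) :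
    ‖R * regularizedGroup R M t - R * R - (t : ℂ) • (Complex.I • ((M : ℂ) • (R * R) - R))‖ ≤
      2 * (|M| * ‖R‖ + 1) ^ 2 * t ^ 2 := by
  have hs : IsStarNormal R := (IsSelfAdjoint.of_nonneg hR).isStarNormal
  have c := continuous_groupSymbol M t
  have e : R * regularizedGroup R M t - R * R - (t : ℂ) • (Complex.I • ((M : ℂ) • (R * R) - R)) =
      cfc (fun z => z * groupSymbol M t z - z * z - (t : ℂ) * (Complex.I * (M * (z * z) - z))) R := by
    rw [cfc_sub _ _ R, cfc_sub _ _ R, cfc_const_mul _ _ R, cfc_const_mul _ _ R, cfc_sub _ _ R,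
      cfc_const_mul _ _ R, cfc_mul _ _ R, cfc_mul _ _ R, cfc_id' ℂ R, regularizedGroup]
  rw [e]
  refine norm_cfc_le (by positivity) fun z hz => ?_
  refine (norm_mul_groupSymbol_sub_le M t (eq_norm_of_mem_spectrum hR hz)).trans ?_
  have := norm_le_of_mem_spectrum hz
  gcongr

end

end Stone

section StoneGroup

variable {H : Type*} [NormedAddCommGroup H] [InnerProductSpace ℂ H]

/-! ### Properties of the group generated by `iA` -/

namespace IsGroupGeneratedBy

variable {A : H →ₗ.[ℂ] H} {S S' : ℝ → H →L[ℂ] H}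

theorem add_apply (hS : IsGroupGeneratedBy A S) (s t : ℝ) (f : H) : S (s + t) f = S s (S t f) := by
  rw [hS.add]; rfl

theorem neg_apply_apply (hS : IsGroupGeneratedBy A S) (t : ℝ) (f : H) : S (-t) (S t f) = f := by
  rw [← hS.add_apply, neg_add_cancel, hS.zero]; rfl

theorem apply_neg_apply (hS : IsGroupGeneratedBy A S) (t : ℝ) (f : H) : S t (S (-t) f) = f := by
  rw [← hS.add_apply, add_neg_cancel, hS.zero]; rfl

theorem hasDerivAt (hS : IsGroupGeneratedBy A S) {f g : H} (h : (f, g) ∈ A.graph) (t : ℝ) :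
    HasDerivAt (fun s => S s f) (Complex.I • S t g) t := by
  have h0 := (hS.generator f g).mp h
  have h1 : HasDerivAt (fun s => S t (S (s - t) f)) (S t (Complex.I • g)) t := by
    have h2 : HasDerivAt (fun s => S (s - t) f) (Complex.I • g) t := by
      rw [← sub_self t] at h0
      exact h0.comp_sub_const t t
    exact (S t).hasFDerivAt.restrictScalars ℝ |>.comp_hasDerivAt t h2
  rw [map_smul] at h1
  convert h1 using 2 with s
  rw [← hS.add_apply, add_sub_cancel]

theorem apply_mem_graph (hS : IsGroupGeneratedBy A S) {f g : H} (h : (f, g) ∈ A.graph) (t : ℝ) :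
    (S t f, S t g) ∈ A.graph := by
  rw [hS.generator]
  have h1 := hS.hasDerivAt h t
  rw [← zero_add t] at h1
  have h2 := h1.comp_add_const 0 t
  rw [zero_add] at h2
  convert h2 using 2 with s
  rw [hS.add_apply]

/-- From a point of the domain, the difference of the two orbits solves the same linear equation; by
symmetry of `A` its norm is constant, and it vanishes at time `0`. The domain is dense. -/
theorem eq_of_isSelfAdjoint [CompleteSpace H] (hA : IsSelfAdjoint A) (hS : IsGroupGeneratedBy A S)
    (hS' : IsGroupGeneratedBy A S') : S = S' := by
  have key : ∀ f g, (f, g) ∈ A.graph → ∀ t, S t f = S' t f := by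
    intro f g h t
    have hd : ∀ s, HasDerivAt (fun s => inner ℂ (S s f - S' s f) (S s f - S' s f)) 0 s := by
      intro s
      have h1 : HasDerivAt (fun s => S s f - S' s f) (Complex.I • (S s g - S' s g)) s := by
        rw [smul_sub]
        exact (hS.hasDerivAt h s).sub (hS'.hasDerivAt h s)
      have hmem : (S s f - S' s f, S s g - S' s g) ∈ A.graph :=
        A.graph.sub_mem (hS.apply_mem_graph h s) (hS'.apply_mem_graph h s)
      have e := (LinearPMap.mem_graph_iff_of_isSelfAdjoint hA _ _).mp hmem _ _ hmem
      have h2 := h1.inner ℂ h1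
      rwa [inner_smul_left, inner_smul_right, e, Complex.conj_I, neg_mul, add_neg_cancel] at h2
    have hc := is_const_of_deriv_eq_zero (fun s => (hd s).differentiableAt)
      (fun s => (hd s).deriv) t 0
    simp only [hS.zero, hS'.zero, sub_self, inner_zero_left] at hc
    exact sub_eq_zero.mp (inner_self_eq_zero.mp hc)
  funext t
  ext f
  refine hA.dense_domain.induction (P := fun f => S t f = S' t f) (fun f hf => ?_)
    (isClosed_eq (S t).continuous (S' t).continuous) f
  exact key f _ (A.mem_graph ⟨f, hf⟩) t

theorem commute_resolvent (hS : IsGroupGeneratedBy A S) {M : ℝ} {R : H →L[ℂ] H}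
    (hR : IsResolvent A M R) (t : ℝ) : Commute R (S t) := by
  ext h
  have := hR.eq _ _ (hS.apply_mem_graph (hR.mem h) t)
  have e : (M : ℂ) • S t (R h) - S t ((M : ℂ) • R h - h) = S t h := by
    rw [map_sub, map_smul, sub_sub_cancel]
  rwa [e] at this

end IsGroupGeneratedBy

/-! ### Existence of the group -/

variable [CompleteSpace H] {A : H →ₗ.[ℂ] H} {M : ℝ} {R : H →L[ℂ] H}

/-- The group `exp(it(M - R⁻¹))`. -/
noncomputable def resolventGroup (R : H →L[ℂ] H) (M t : ℝ) : H →L[ℂ] H :=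
  (regularizedGroup R M t).toLinearMap.extendOfNorm R.toLinearMap

section

variable (hR : 0 ≤ R) (hd : DenseRange R) (M : ℝ)
include hR hd

/-- The assignment `R h ↦ U(t) h` preserves norms, hence is well defined and bounded on the dense
range of `R`. -/
theorem resolventGroup_apply (t : ℝ) (h : H) :
    resolventGroup R M t (R h) = regularizedGroup R M t h :=
  LinearMap.extendOfNorm_eq (f := (regularizedGroup R M t).toLinearMap) (e := R.toLinearMap) hd
    ⟨1, fun x => by
      rw [one_mul]
      exact (norm_regularizedGroup_apply hR M t x).le⟩ h

theorem norm_resolventGroup_apply (t : ℝ) (f : H) : ‖resolventGroup R M t f‖ = ‖f‖ := by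
  refine hd.induction_on f (isClosed_eq (by fun_prop) continuous_norm) fun h => ?_
  rw [resolventGroup_apply hR hd, norm_regularizedGroup_apply hR]

theorem resolventGroup_zero : resolventGroup R M 0 = 1 := by
  ext f
  refine hd.induction_on f (isClosed_eq (by fun_prop) continuous_id) fun h => ?_
  rw [resolventGroup_apply hR hd, regularizedGroup_zero hR]
  rfl

theorem resolventGroup_add (s t : ℝ) :
    resolventGroup R M (s + t) = resolventGroup R M s * resolventGroup R M t := by
  ext f
  -- Each of the two group elements uses up one factor `R`.
  have hd2 : DenseRange (R ∘ R) := hd.comp hd R.continuous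
  refine hd2.induction_on f (isClosed_eq (by fun_prop) (by fun_prop)) fun h => ?_
  have e1 : ∀ t, regularizedGroup R M t (R h) = R (regularizedGroup R M t h) := fun t =>
    (congrArg (fun B : H →L[ℂ] H => B h) (commute_regularizedGroup hR M t)).symm
  have e2 : regularizedGroup R M s (regularizedGroup R M t h) =
      R (regularizedGroup R M (s + t) h) :=
    congrArg (fun B : H →L[ℂ] H => B h) (regularizedGroup_mul hR M s t)
  rw [mul_apply_eq_comp, Function.comp_apply]
  change _ = resolventGroup R M s (resolventGroup R M t (R (R h)))
  rw [resolventGroup_apply hR hd, resolventGroup_apply hR hd, e1, e1,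
    resolventGroup_apply hR hd, e2]

theorem continuous_resolventGroup_apply (f : H) :
    Continuous fun t => resolventGroup R M t f := by
  refine continuous_of_uniform_approx_of_continuous fun u hu => ?_
  obtain ⟨ε, hε, hu⟩ := Metric.mem_uniformity_dist.mp hu
  obtain ⟨h, hh⟩ := hd.exists_dist_lt f hε
  refine ⟨fun t => resolventGroup R M t (R h), ?_, fun t => hu ?_⟩
  · simp only [resolventGroup_apply hR hd]
    have hL : LipschitzWith ⟨(|M| * ‖R‖ + 1) * ‖h‖, by positivity⟩
        fun t => regularizedGroup R M t h := by
      refine LipschitzWith.of_dist_le_mul fun t s => ?_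
      rw [dist_eq_norm, Real.dist_eq, ← _root_.sub_apply]
      refine (ContinuousLinearMap.le_opNorm _ _).trans ?_
      have := norm_regularizedGroup_sub_le hR M s t
      calc _ ≤ (|M| * ‖R‖ + 1) * |t - s| * ‖h‖ := mul_le_mul_of_nonneg_right this (norm_nonneg _)
        _ = (|M| * ‖R‖ + 1) * ‖h‖ * |t - s| := by ring
    exact hL.continuous
  · rw [dist_eq_norm, ← map_sub, norm_resolventGroup_apply hR hd, ← dist_eq_norm]
    exact hh

/-- The difference quotients, as operators acting on `h`, are uniformly bounded, so the set of `h`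
for which they converge to the bounded limit is closed. On `h = R k` the second order estimate gives
convergence with error `O(t)`. -/
theorem hasDerivAt_resolventGroup (h : H) :
    HasDerivAt (fun t => resolventGroup R M t (R h)) (Complex.I • ((M : ℂ) • R h - h)) 0 := by
  rw [hasDerivAt_iff_tendsto_slope_zero]
  simp only [zero_add, resolventGroup_apply hR hd, regularizedGroup_zero hR]
  let F : ℝ → H →L[ℂ] H := fun t => (t⁻¹ : ℂ) • (regularizedGroup R M t - R)
  have hF : ∀ t h, t⁻¹ • (regularizedGroup R M t h - R h) = F t h := fun t h => by
    simp only [F, _root_.smul_apply, _root_.sub_apply]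
    rw [← Complex.ofReal_inv, Complex.coe_smul]
  simp only [hF]
  have hb : ∀ t, ‖F t‖ ≤ |M| * ‖R‖ + 1 := by
    intro t
    have := norm_regularizedGroup_sub_le hR M 0 t
    rw [regularizedGroup_zero hR, sub_zero] at this
    simp only [F]
    rw [norm_smul, norm_inv, Complex.norm_real, Real.norm_eq_abs]
    rcases (abs_nonneg t).eq_or_lt with h0 | h0
    · rw [← h0, inv_zero, zero_mul]; positivity
    · rw [inv_mul_le_iff₀ h0, mul_comm |t|]
      exact this
  have heq : Equicontinuous fun t => (F t : H → H) :=
    ((NormedSpace.equicontinuous_TFAE F).out 5 1 :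
      (∃ C, ∀ t, ‖F t‖ ≤ C) ↔ _).mp ⟨_, hb⟩
  have hcl := heq.isClosed_setOfPred_tendsto (l := 𝓝[≠] (0 : ℝ))
    (f := fun h => Complex.I • ((M : ℂ) • R h - h)) (by fun_prop)
  refine hd.induction_on h hcl fun k => ?_
  rw [tendsto_iff_norm_sub_tendsto_zero]
  have hlim : Tendsto (fun t : ℝ => 2 * (|M| * ‖R‖ + 1) ^ 2 * |t| * ‖k‖) (𝓝[≠] 0) (𝓝 0) := by
    have : Continuous fun t : ℝ => 2 * (|M| * ‖R‖ + 1) ^ 2 * |t| * ‖k‖ := by fun_prop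
    have h2 := (this.tendsto 0).mono_left (nhdsWithin_le_nhds (s := {0}ᶜ))
    simpa using h2
  refine squeeze_zero' (Eventually.of_forall fun _ => norm_nonneg _) ?_ hlim
  filter_upwards [self_mem_nhdsWithin] with t ht
  have ht0 : (t : ℂ) ≠ 0 := by exact_mod_cast ht
  have htp : 0 < |t| := abs_pos.mpr ht
  have e : F t (R k) - Complex.I • ((M : ℂ) • R (R k) - R k) = (t⁻¹ : ℂ) •
      ((R * regularizedGroup R M t - R * R -
        (t : ℂ) • (Complex.I • ((M : ℂ) • (R * R) - R))) k) := by
    rw [commute_regularizedGroup hR]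
    simp only [F, _root_.smul_apply, _root_.sub_apply,
      mul_apply_eq_comp]
    conv_rhs => rw [smul_sub, smul_smul, inv_mul_cancel₀ ht0, one_smul]
  rw [e, norm_smul, norm_inv, Complex.norm_real, Real.norm_eq_abs, inv_mul_le_iff₀ htp]
  refine (ContinuousLinearMap.le_opNorm _ _).trans ?_
  have := norm_mul_regularizedGroup_sub_le hR M t
  calc _ ≤ 2 * (|M| * ‖R‖ + 1) ^ 2 * t ^ 2 * ‖k‖ := mul_le_mul_of_nonneg_right this (norm_nonneg _)
    _ = _ := by rw [← sq_abs t]; ring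

end

/-- Stone's theorem for a self-adjoint operator that is bounded above. -/
theorem exists_isGroupGeneratedBy (hA : IsSelfAdjoint A) (hM : IsCoerciveAt A M) :
    ∃ S : ℝ → H →L[ℂ] H, IsGroupGeneratedBy A S := by
  obtain ⟨R, hR⟩ := exists_isResolvent hA hM
  have h0 := hR.nonneg hA hM
  have hd := hR.denseRange hA
  have hiso := norm_resolventGroup_apply h0 hd M
  have hadd := resolventGroup_add h0 hd M
  have hzero := resolventGroup_zero h0 hd M
  have hgen : ∀ f g, (f, g) ∈ A.graph →
      HasDerivAt (fun t => resolventGroup R M t f) (Complex.I • g) 0 := by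
    intro f g hfg
    have := hasDerivAt_resolventGroup h0 hd M ((M : ℂ) • f - g)
    rwa [hR.eq f g hfg, sub_sub_cancel] at this
  refine ⟨resolventGroup R M, hzero, hadd, continuous_resolventGroup_apply h0 hd M, hiso,
    fun f g => ⟨hgen f g, fun h => ?_⟩⟩
  -- The generator is not larger than `iA`: differentiating `⟨a, S(t) f⟩ = ⟨S(-t) a, f⟩` at `0`
  -- shows that `(f, g)` is symmetric against the graph, which is maximal.
  rw [LinearPMap.mem_graph_iff_of_isSelfAdjoint hA]
  intro a b hab
  have hinner : ∀ t, inner ℂ a (resolventGroup R M t f) = inner ℂ (resolventGroup R M (-t) a) f := by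
    intro t
    have e := LinearIsometry.inner_map_map
      (⟨(resolventGroup R M (-t)).toLinearMap, hiso (-t)⟩ : H →ₗᵢ[ℂ] H) a (resolventGroup R M t f)
    rw [← e]
    change inner ℂ (resolventGroup R M (-t) a)
      ((resolventGroup R M (-t) * resolventGroup R M t) f) = _
    rw [← hadd, neg_add_cancel, hzero]
    rfl
  have d1 : HasDerivAt (fun t => inner ℂ a (resolventGroup R M t f)) (inner ℂ a (Complex.I • g)) 0 := by
    have := (hasDerivAt_const (0 : ℝ) a).inner ℂ h
    simpa only [inner_zero_left, add_zero] using this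
  have d2 : HasDerivAt (fun t => inner ℂ (resolventGroup R M (-t) a) f)
      (inner ℂ (-(Complex.I • b)) f) 0 := by
    have h1 := hgen a b hab
    rw [← neg_zero] at h1
    have h2 := h1.scomp (0 : ℝ) (hasDerivAt_neg (0 : ℝ))
    have := h2.inner ℂ (hasDerivAt_const (0 : ℝ) f)
    simpa [Function.comp_def] using this
  simp only [hinner] at d1
  have e := d1.unique d2
  rw [inner_smul_right, inner_neg_left, inner_smul_left, Complex.conj_I, neg_mul, neg_neg] at e
  exact (mul_left_cancel₀ Complex.I_ne_zero e).symm

end StoneGroup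

/-! ### The square root of the resolvent -/

section Sqrt

variable {H : Type*} [NormedAddCommGroup H] [InnerProductSpace ℂ H] [CompleteSpace H]
  {R T : H →L[ℂ] H}

/-- A nonnegative injective operator has a square root that commutes with whatever the operator
commutes with. -/
theorem exists_sqrt (hR : 0 ≤ R) (hi : Function.Injective R) (hd : DenseRange R) :
    ∃ T : H →L[ℂ] H, (∀ h, T (T h) = R h) ∧ (∀ f g, inner ℂ (T f) g = inner ℂ f (T g)) ∧
      (∀ h, ‖T h‖ ^ 2 = (inner ℂ h (R h)).re) ∧ Function.Injective T ∧ DenseRange T ∧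
      ∀ S, Commute R S → Commute T S := by
  obtain ⟨T, hT⟩ : ∃ T : H →L[ℂ] H, T = CFC.sqrt R := ⟨_, rfl⟩
  have h1 : ∀ h, T (T h) = R h := fun h => by
    have := CFC.sqrt_mul_sqrt_self R hR
    rw [← hT] at this
    exact congrArg (fun B : H →L[ℂ] H => B h) this
  have h2 : ∀ f g, inner ℂ (T f) g = inner ℂ f (T g) := by
    have : IsSelfAdjoint T := by
      rw [hT]
      exact IsSelfAdjoint.of_nonneg (CFC.sqrt_nonneg R)
    exact ContinuousLinearMap.isSelfAdjoint_iff_isSymmetric.mp this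
  refine ⟨T, h1, h2, fun h => ?_, fun f g hfg => hi ?_, ?_, fun S hS => ?_⟩
  · rw [← h1, ← h2]
    exact (inner_self_eq_norm_sq (𝕜 := ℂ) _).symm
  · rw [← h1, ← h1, hfg]
  · refine Dense.mono ?_ hd
    rintro _ ⟨h, rfl⟩
    exact ⟨T h, h1 h⟩
  · rw [hT]
    exact hS.cfcₙ_nnreal NNReal.sqrt

/-- A variational description of the image of a ball under a symmetric operator. -/
theorem exists_preimage_of_norm_inner_le (hT : ∀ f g, inner ℂ (T f) g = inner ℂ f (T g))
    (hd : DenseRange T) {f : H} {r : ℝ} (hr : 0 ≤ r) (h : ∀ k, ‖inner ℂ f k‖ ≤ r * ‖T k‖) :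
    ∃ g, T g = f ∧ ‖g‖ ≤ r := by
  -- The bound makes `T k ↦ ⟨f, k⟩` a well defined functional of norm at most `r` on a dense
  -- subspace; its Riesz representative is the preimage.
  let φ : H →L[ℂ] ℂ := (innerSL ℂ f).toLinearMap.extendOfNorm T.toLinearMap
  have hφ : ∀ k, φ (T k) = inner ℂ f k := fun k =>
    LinearMap.extendOfNorm_eq (f := (innerSL ℂ f).toLinearMap) (e := T.toLinearMap) hd
      ⟨r, h⟩ k
  have hn : ‖φ‖ ≤ r := LinearMap.opNorm_extendOfNorm_le hd hr h
  refine ⟨(InnerProductSpace.toDual ℂ H).symm φ, ?_, ?_⟩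
  · refine ext_inner_right ℂ fun k => ?_
    rw [hT, InnerProductSpace.toDual_symm_apply, hφ]
  · rwa [LinearIsometryEquiv.norm_map]

end Sqrt

/-! ### The form domain as the range of a square root -/

namespace MetricGraph

variable {V I X : Type*} [Fintype I] [Fintype X] [DecidableEq V] [Fintype V]
  {Γ : MetricGraph V I X} {A B : Γ.VertexMatrices} {M : ℝ}

theorem IsFormConstant.isCoerciveAt (hM : Γ.IsFormConstant A B M)
    (hsa : IsSelfAdjoint (Γ.laplacian A B)) : IsCoerciveAt (Γ.laplacian A B) M := by
  obtain ⟨-, c, C, hc, h⟩ := hM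
  have hL := fun v => isLagrangianCondition hsa v
  refine ⟨c, hc, fun f g hfg => ?_⟩
  have h1 := (h f (mem_energyDomain_of_mem_graph hL hfg)).1
  rw [energy_eq_of_mem_graph hL hfg] at h1
  have : 0 ≤ c * ‖Γ.grad f‖ ^ 2 := by positivity
  linarith

/-- The shifted energy of `R h` equals `⟨h, R h⟩ = ‖T h‖²`, and it dominates the square of the
Sobolev norm. -/
theorem IsFormConstant.exists_sobolevNorm_le (hM : Γ.IsFormConstant A B M)
    (hsa : IsSelfAdjoint (Γ.laplacian A B)) {R T : Γ.L2 →L[ℂ] Γ.L2}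
    (hR : IsResolvent (Γ.laplacian A B) M R) (hT : ∀ h, ‖T h‖ ^ 2 = (inner ℂ h (R h)).re) :
    ∃ C : ℝ, 0 ≤ C ∧ ∀ h, Γ.sobolevNorm (R h) ≤ C * ‖T h‖ := by
  obtain ⟨-, c, C, hc, hb⟩ := hM
  have hL := fun v => isLagrangianCondition hsa v
  refine ⟨√(1 / c), Real.sqrt_nonneg _, fun h => ?_⟩
  have h1 := (hb (R h) (mem_energyDomain_of_mem_graph hL (hR.mem h))).1
  rw [energy_eq_of_mem_graph hL (hR.mem h), ← sub_eq_add_neg, ← re_inner_apply_self,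
    ← hT, ← sobolevNorm_sq] at h1
  refine (abs_le_of_sq_le_sq' ?_ (by positivity)).2
  rw [mul_pow, Real.sq_sqrt (by positivity), div_mul_eq_mul_div, one_mul, le_div_iff₀ hc]
  linarith

/-- A description of `D(𝓔)` and of its norm by means of a bounded symmetric operator that
commutes with the group. -/
theorem exists_formSqrt (hsa : IsSelfAdjoint (Γ.laplacian A B)) :
    ∃ T : Γ.L2 →L[ℂ] Γ.L2, Function.Injective T ∧
      (∀ f g, inner ℂ (T f) g = inner ℂ f (T g)) ∧ DenseRange T ∧
      (∀ S, IsGroupGeneratedBy (Γ.laplacian A B) S → ∀ t, Commute T (S t)) ∧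
      (∃ C : ℝ, 0 ≤ C ∧ ∀ g, T g ∈ Γ.energyDomain B ∧ Γ.sobolevNorm (T g) ≤ C * ‖g‖) ∧
      ∃ C : ℝ, 0 ≤ C ∧ ∀ f ∈ Γ.energyDomain B, ∃ g, T g = f ∧ ‖g‖ ≤ C * Γ.sobolevNorm f := by
  have hL := fun v => isLagrangianCondition hsa v
  obtain ⟨M, hM⟩ := exists_isFormConstant hL
  have hco := hM.isCoerciveAt hsa
  obtain ⟨R, hR⟩ := exists_isResolvent hsa hco
  have hR0 := hR.nonneg hsa hco
  obtain ⟨T, hTT, hTs, hTn, hTi, hdT, hTc⟩ := exists_sqrt hR0 hR.injective (hR.denseRange hsa)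
  obtain ⟨C, hC, hCb⟩ := hM.exists_sobolevNorm_le hsa hR hTn
  have hmem : ∀ h, R h ∈ Γ.energyDomain B := fun h =>
    mem_energyDomain_of_mem_graph hL (hR.mem h)
  refine ⟨T, hTi, hTs, hdT,
    fun S hS t => hTc _ (hS.commute_resolvent hR t), ⟨C, hC, fun g => ?_⟩, ?_⟩
  -- Approximate `g` by `T h_k`. Then `R h_k → T g` in `L²`, and the Sobolev bound makes the
  -- gradients Cauchy, so the closedness of `D(𝓔)` applies.
  · obtain ⟨y, hy, hyg⟩ := mem_closure_iff_seq_limit.mp (hdT g)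
    choose h hh using hy
    obtain rfl : (fun k => T (h k)) = y := funext hh
    have hlim : Tendsto (fun k => R (h k)) atTop (𝓝 (T g)) := by
      simp only [← hTT]
      exact (T.continuous.tendsto g).comp hyg
    have hgrad : ∀ j k, Γ.grad (R (h j)) - Γ.grad (R (h k)) = Γ.grad (R (h j - h k)) := by
      intro j k
      obtain ⟨w, x, h1, -⟩ := hmem (h j)
      obtain ⟨w', x', h1', -⟩ := hmem (h k)
      rw [map_sub, (h1.sub h1').grad_eq, h1.grad_eq, h1'.grad_eq]
    have hcau : CauchySeq fun k => Γ.grad (R (h k)) := by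
      have hc1 := hyg.cauchySeq
      rw [Metric.cauchySeq_iff] at hc1 ⊢
      intro ε hε
      obtain ⟨N, hN⟩ := hc1 (ε / (C + 1)) (by positivity)
      refine ⟨N, fun j hj k hk => ?_⟩
      have h1 := hN j hj k hk
      rw [dist_eq_norm, ← map_sub, lt_div_iff₀ (by positivity)] at h1
      rw [dist_eq_norm, hgrad]
      refine (norm_grad_le_sobolevNorm _).trans_lt ((hCb _).trans_lt ?_)
      nlinarith [norm_nonneg (T (h j - h k))]
    obtain ⟨w, hw⟩ := cauchySeq_tendsto_of_complete hcau
    obtain ⟨h1, h2⟩ := mem_energyDomain_of_tendsto (fun k => hmem (h k)) hlim hw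
    refine ⟨h1, ?_⟩
    have t1 : Tendsto (fun k => Γ.sobolevNorm (R (h k))) atTop
        (𝓝 (Γ.sobolevNorm (T g))) := by
      simp only [sobolevNorm, h2]
      exact ((hlim.norm.pow 2).add (hw.norm.pow 2)).sqrt
    exact le_of_tendsto_of_tendsto t1 (hyg.norm.const_mul C) (Eventually.of_forall fun k => hCb _)
  -- Write `k = M R k - Δ R k`. Boundedness of the form gives `|⟨f, k⟩| ≤ const · ‖f‖ ‖R k‖` in
  -- Sobolev norms, and `‖R k‖ ≤ C ‖T k‖`; this is the variational criterion for a preimage.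
  · obtain ⟨K, hK, hKb⟩ := exists_norm_inner_laplacian_le hL
    refine ⟨(|M| + K) * C, by positivity, fun f hf => ?_⟩
    refine exists_preimage_of_norm_inner_le hTs hdT
      (mul_nonneg (by positivity) (sobolevNorm_nonneg f)) fun k => ?_
    have e : inner ℂ f k = (M : ℂ) * inner ℂ f (R k) - inner ℂ f ((M : ℂ) • R k - k) := by
      rw [inner_sub_right, inner_smul_right]; ring
    have b1 : ‖(M : ℂ) * inner ℂ f (R k)‖ ≤ |M| * (Γ.sobolevNorm f * Γ.sobolevNorm (R k)) := by
      rw [norm_mul, Complex.norm_real, Real.norm_eq_abs]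
      refine mul_le_mul_of_nonneg_left ((norm_inner_le_norm _ _).trans ?_) (abs_nonneg _)
      exact mul_le_mul (norm_le_sobolevNorm _) (norm_le_sobolevNorm _) (norm_nonneg _)
        (sobolevNorm_nonneg _)
    have b2 := hKb f hf _ _ (hR.mem k)
    have b3 : Γ.sobolevNorm f * Γ.sobolevNorm (R k) ≤
        Γ.sobolevNorm f * (C * ‖T k‖) :=
      mul_le_mul_of_nonneg_left (hCb k) (sobolevNorm_nonneg _)
    rw [e]
    calc _ ≤ |M| * (Γ.sobolevNorm f * Γ.sobolevNorm (R k)) +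
          K * Γ.sobolevNorm f * Γ.sobolevNorm (R k) := (norm_sub_le _ _).trans (add_le_add b1 b2)
      _ = (|M| + K) * (Γ.sobolevNorm f * Γ.sobolevNorm (R k)) := by ring
      _ ≤ (|M| + K) * (Γ.sobolevNorm f * (C * ‖T k‖)) :=
        mul_le_mul_of_nonneg_left b3 (by positivity)
      _ = _ := by ring

end MetricGraph

/-! ### Lipschitz continuity of the truncated nonlinearity -/

theorem truncF_zero (θ : ℝ → ℝ) (σ R : ℝ) : truncF θ σ R 0 = 0 := by
  rw [truncF, mul_zero]

/-- With `2σ ≥ 1` the radial factor `φ` is `C¹` with compact support, hence bounded and Lipschitz,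
and `F(z) = φ(‖z‖) z`. -/
theorem exists_lipschitzWith_truncF {θ : ℝ → ℝ} (hθ : IsCutoff θ) {σ R : ℝ} (hσ : 1 / 2 ≤ σ)
    (hR : 0 < R) : ∃ K, LipschitzWith K (truncF θ σ R) := by
  let φ : ℝ → ℝ := fun r => r ^ (2 * σ) * θ (r ^ 2 / R)
  have hc : ContDiff ℝ 1 φ :=
    (Real.contDiff_rpow_const_of_le (by push_cast; linarith)).mul
      ((hθ.contDiff.of_le (by simp)).comp (by fun_prop))
  have hs : ∀ r, √(2 * R) ≤ |r| → φ r = 0 := by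
    intro r hr
    have h1 : 2 * R ≤ r ^ 2 := by
      rw [← sq_abs]
      exact Real.sqrt_le_iff.mp hr |>.2
    simp only [φ]
    rw [hθ.eq_zero _ ((le_div_iff₀ hR).mpr h1), mul_zero]
  have hcs : HasCompactSupport φ := by
    refine HasCompactSupport.intro (isCompact_closedBall (0 : ℝ) √(2 * R)) fun r hr => hs r ?_
    rw [Metric.mem_closedBall, dist_zero_right, Real.norm_eq_abs, not_le] at hr
    exact hr.le
  obtain ⟨C, hC⟩ := hcs.exists_bound_of_continuous hc.continuous
  have hC0 : 0 ≤ C := (norm_nonneg _).trans (hC 0)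
  obtain ⟨L, hL⟩ := hc.lipschitzWith_of_hasCompactSupport hcs (by simp)
  have hF : ∀ z, truncF θ σ R z = ((φ ‖z‖ : ℝ) : ℂ) * z := fun z => rfl
  -- The increment of `φ` is made to multiply the point `z` of smaller modulus: either both values
  -- vanish or `‖z‖ < √(2R)`.
  have key : ∀ z w : ℂ, ‖z‖ ≤ ‖w‖ →
      ‖truncF θ σ R z - truncF θ σ R w‖ ≤ (C + L * √(2 * R)) * ‖z - w‖ := by
    intro z w hzw
    by_cases hz : √(2 * R) ≤ ‖z‖
    · rw [hF, hF, hs _ (by rwa [abs_norm]), hs _ (by rw [abs_norm]; exact hz.trans hzw)]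
      simp only [Complex.ofReal_zero, zero_mul, sub_zero, norm_zero]
      positivity
    · have e : truncF θ σ R z - truncF θ σ R w =
          ((φ ‖w‖ : ℝ) : ℂ) * (z - w) + ((φ ‖z‖ - φ ‖w‖ : ℝ) : ℂ) * z := by
        rw [hF, hF]; push_cast; ring
      have h1 : ‖φ ‖z‖ - φ ‖w‖‖ ≤ L * ‖z - w‖ := by
        have := hL.dist_le_mul ‖z‖ ‖w‖
        rw [dist_eq_norm, Real.dist_eq] at this
        exact this.trans (mul_le_mul_of_nonneg_left (abs_norm_sub_norm_le z w) L.2)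
      rw [e, add_mul]
      refine (norm_add_le _ _).trans (add_le_add ?_ ?_)
      · rw [norm_mul, Complex.norm_real]
        exact mul_le_mul_of_nonneg_right (hC _) (norm_nonneg _)
      · rw [norm_mul, Complex.norm_real]
        calc _ ≤ (L * ‖z - w‖) * √(2 * R) :=
              mul_le_mul h1 (not_le.mp hz).le (norm_nonneg _) (by positivity)
          _ = _ := by ring
  refine ⟨⟨C + L * √(2 * R), by positivity⟩, LipschitzWith.of_dist_le_mul fun z w => ?_⟩
  rw [dist_eq_norm, dist_eq_norm]
  rcases le_total ‖z‖ ‖w‖ with h | h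
  · exact key z w h
  · rw [norm_sub_rev, norm_sub_rev z]
    exact key w z h

namespace MetricGraph

variable {V I X : Type*} {Γ : MetricGraph V I X} {θ : ℝ → ℝ} {σ R : ℝ}

theorem coeFn_truncNonlin (hθ : IsCutoff θ) (hσ : 1 / 2 ≤ σ) (hR : 0 < R) (u : Γ.L2)
    (e : I ⊕ X) :
    Γ.truncNonlin θ σ R u e =ᵐ[Γ.edgeMeasure e] fun x => truncF θ σ R (u e x) := by
  have h := Γ.memLp_truncF hθ hσ hR u e
  have : Γ.truncNonlin θ σ R u e = h.toLp := dif_pos h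
  rw [this]
  exact h.coeFn_toLp

variable [Fintype I] [Fintype X]

/-- An edgewise pointwise bound gives a bound of the norms. -/
theorem norm_le_mul_norm_of_ae_le {u w : Γ.L2} {K : NNReal}
    (h : ∀ e, ∀ᵐ x ∂Γ.edgeMeasure e, ‖w e x‖ ≤ K * ‖u e x‖) : ‖w‖ ≤ K * ‖u‖ := by
  refine (abs_le_of_sq_le_sq' ?_ (by positivity)).2
  rw [mul_pow, norm_sq_eq_sum, norm_sq_eq_sum, Finset.mul_sum]
  refine Finset.sum_le_sum fun e _ => ?_
  rw [← integral_const_mul]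
  have hi : ∀ f : Lp ℂ 2 (Γ.edgeMeasure e), Integrable (fun x => ‖f x‖ ^ 2) (Γ.edgeMeasure e) :=
    fun f => (memLp_two_iff_integrable_sq_norm (Lp.memLp f).1).mp (Lp.memLp f)
  refine integral_mono_ae (hi _) ((hi _).const_mul _) ((h e).mono fun x hx => ?_)
  dsimp only
  rw [← mul_pow]
  exact pow_le_pow_left₀ (norm_nonneg _) hx 2

theorem lipschitzWith_truncNonlin (hθ : IsCutoff θ) (hσ : 1 / 2 ≤ σ) (hR : 0 < R) {K : NNReal}
    (hK : LipschitzWith K (truncF θ σ R)) : LipschitzWith K (Γ.truncNonlin θ σ R) := by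
  refine LipschitzWith.of_dist_le_mul fun u w => ?_
  rw [dist_eq_norm, dist_eq_norm]
  refine norm_le_mul_norm_of_ae_le fun e => ?_
  filter_upwards [coeFn_truncNonlin hθ hσ hR u e, coeFn_truncNonlin hθ hσ hR w e,
    Lp.coeFn_sub (u e) (w e), Lp.coeFn_sub (Γ.truncNonlin θ σ R u e) (Γ.truncNonlin θ σ R w e)]
    with x h1 h2 h3 h4
  change ‖(Γ.truncNonlin θ σ R u e - Γ.truncNonlin θ σ R w e : Lp ℂ 2 (Γ.edgeMeasure e)) x‖ ≤
    K * ‖(u e - w e : Lp ℂ 2 (Γ.edgeMeasure e)) x‖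
  rw [h3, h4, Pi.sub_apply, Pi.sub_apply, h1, h2, ← dist_eq_norm, ← dist_eq_norm]
  exact hK.dist_le_mul _ _

theorem norm_truncNonlin_le (hθ : IsCutoff θ) (hσ : 1 / 2 ≤ σ) (hR : 0 < R) {K : NNReal}
    (hK : LipschitzWith K (truncF θ σ R)) (u : Γ.L2) : ‖Γ.truncNonlin θ σ R u‖ ≤ K * ‖u‖ := by
  refine norm_le_mul_norm_of_ae_le fun e => ?_
  filter_upwards [coeFn_truncNonlin hθ hσ hR u e] with x hx
  rw [hx]
  simpa [truncF_zero] using hK.dist_le_mul (u e x) 0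

/-- Only linear growth of the gradient is asserted, not Lipschitz dependence on `u`; growth is all
that the invariance argument in `D(𝓔)` uses. -/
theorem norm_grad_truncNonlin_le (hθ : IsCutoff θ) (hσ : 1 / 2 ≤ σ) (hR : 0 < R) {K : NNReal}
    (hK : LipschitzWith K (truncF θ σ R)) {u w w₁ : Γ.L2} (h : Γ.HasDeriv u w)
    (h₁ : Γ.HasDeriv (Γ.truncNonlin θ σ R u) w₁) : ‖w₁‖ ≤ K * ‖w‖ := by
  refine norm_le_mul_norm_of_ae_le fun e => ?_
  obtain ⟨c, hc⟩ := h.exists_primitiveOn e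
  obtain ⟨c₁, hc₁⟩ := h₁.exists_primitiveOn e
  refine norm_weakDeriv_le_of_lipschitz (Γ.isOpen_edge e) (Lp.memLp _) (Lp.memLp _) hK
    (c := c) (c₁ := c₁) ?_
  filter_upwards [hc, hc₁, coeFn_truncNonlin hθ hσ hR u e] with x h1 h2 h3
  rw [← h2, ← h1, h3]

theorem sobolevNorm_truncNonlin_le [DecidableEq V] (hθ : IsCutoff θ) (hσ : 1 / 2 ≤ σ) (hR : 0 < R) {K : NNReal}
    (hK : LipschitzWith K (truncF θ σ R)) {B : Γ.VertexMatrices} {u : Γ.L2}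
    (hu : u ∈ Γ.energyDomain B) (hFu : Γ.truncNonlin θ σ R u ∈ Γ.energyDomain B) :
    Γ.sobolevNorm (Γ.truncNonlin θ σ R u) ≤ K * Γ.sobolevNorm u := by
  obtain ⟨w, -, h, -⟩ := hu
  obtain ⟨w₁, -, h₁, -⟩ := hFu
  have h2 := norm_truncNonlin_le hθ hσ hR hK u
  have h3 := norm_grad_truncNonlin_le hθ hσ hR hK h h₁
  rw [← h.grad_eq, ← h₁.grad_eq] at h3
  refine (abs_le_of_sq_le_sq' ?_ (mul_nonneg K.2 (sobolevNorm_nonneg u))).2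
  rw [mul_pow, sobolevNorm_sq, sobolevNorm_sq, mul_add, ← mul_pow, ← mul_pow]
  exact add_le_add (pow_le_pow_left₀ (norm_nonneg _) h2 2) (pow_le_pow_left₀ (norm_nonneg _) h3 2)

end MetricGraph

/-! ### Integral equations with a Lipschitz nonlinearity -/

/-- A map with a contracting iterate has exactly one fixed point, which lies in every nonempty
closed invariant set. -/
theorem ContractingWith.exists_fixedPoint_of_iterate {E : Type*} [MetricSpace E]
    [CompleteSpace E] [Nonempty E] {Φ : E → E} {K : NNReal} {k : ℕ}
    (h : ContractingWith K Φ^[k]) :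
    ∃ x, Φ x = x ∧ (∀ y, Φ y = y → y = x) ∧
      ∀ C : Set E, IsClosed C → C.Nonempty → Set.MapsTo Φ C C → x ∈ C := by
  refine ⟨h.fixedPoint, h.isFixedPt_fixedPoint_iterate, fun y hy => ?_, fun C hC hne hm => ?_⟩
  · exact h.fixedPoint_unique (Function.IsFixedPt.iterate hy k)
  · obtain ⟨c, hc⟩ := hne
    exact hC.mem_of_tendsto (h.tendsto_iterate_fixedPoint c)
      (Eventually.of_forall fun j => (hm.iterate k).iterate j hc)

/-! ### Picard iteration -/

section Volterra

variable {H : Type*} [NormedAddCommGroup H] [NormedSpace ℝ H] {G : ℝ → H → H} {T : ℝ}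

/-- The integral operator `(Φ v)(t) = v₀ + ∫₀ᵗ G(s, v(s)) ds` on `C([0,T], H)`. -/
noncomputable def volterraMap (hT : 0 ≤ T) (hG : Continuous fun p : ℝ × H => G p.1 p.2) (v₀ : H)
    (v : C(Set.Icc 0 T, H)) : C(Set.Icc 0 T, H) where
  toFun t := v₀ + ∫ s in (0 : ℝ)..t, G s (v (Set.projIcc 0 T hT s))
  continuous_toFun := by
    have h : Continuous fun s => G s (v (Set.projIcc 0 T hT s)) :=
      hG.comp (continuous_id.prodMk (v.continuous.comp continuous_projIcc))
    exact continuous_const.add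
      ((intervalIntegral.continuous_primitive (fun a b => h.intervalIntegrable a b) 0).comp
        continuous_subtype_val)

theorem volterraMap_apply (hT : 0 ≤ T) (hG : Continuous fun p : ℝ × H => G p.1 p.2) (v₀ : H)
    (v : C(Set.Icc 0 T, H)) (t : Set.Icc 0 T) :
    volterraMap hT hG v₀ v t = v₀ + ∫ s in (0 : ℝ)..t, G s (v (Set.projIcc 0 T hT s)) := rfl

/-- Each application integrates `K (K s)^k / k!` into the next term of the exponential series. As
these terms tend to zero, a high iterate contracts without any smallness of `T`. -/
theorem norm_iterate_volterraMap_sub_le (hT : 0 ≤ T)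
    (hG : Continuous fun p : ℝ × H => G p.1 p.2) {K : NNReal} (hK : ∀ t, LipschitzWith K (G t))
    (v₀ : H) (v w : C(Set.Icc 0 T, H)) (k : ℕ) (t : Set.Icc 0 T) :
    ‖(volterraMap hT hG v₀)^[k] v t - (volterraMap hT hG v₀)^[k] w t‖ ≤
      (K * t) ^ k / k.factorial * dist v w := by
  induction k generalizing t with
  | zero => simpa [dist_eq_norm] using (v - w).norm_coe_le_norm t
  | succ k ih =>
    have hc : ∀ a : C(Set.Icc 0 T, H), Continuous fun s => G s (a (Set.projIcc 0 T hT s)) :=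
      fun a => hG.comp (continuous_id.prodMk (a.continuous.comp continuous_projIcc))
    rw [Function.iterate_succ_apply', Function.iterate_succ_apply', volterraMap_apply,
      volterraMap_apply, add_sub_add_left_eq_sub, ← intervalIntegral.integral_sub
        ((hc _).intervalIntegrable _ _) ((hc _).intervalIntegrable _ _)]
    have e : ∫ s in (0 : ℝ)..t, K * ((K * s) ^ k / k.factorial * dist v w) =
        (K * t) ^ (k + 1) / (k + 1).factorial * dist v w := by
      have e1 : ∀ s : ℝ, K * ((K * s) ^ k / k.factorial * dist v w) =
          (K ^ (k + 1) / k.factorial * dist v w) * s ^ k := fun s => by ring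
      simp only [e1]
      rw [intervalIntegral.integral_const_mul, integral_pow, Nat.factorial_succ]
      push_cast
      rw [mul_pow]
      field_simp
      simp
    rw [← e]
    refine intervalIntegral.norm_integral_le_of_norm_le t.2.1 ?_
      (Continuous.intervalIntegrable (by fun_prop) _ _)
    refine (ae_of_all _ fun s hs => ?_)
    have hs' : s ∈ Set.Icc 0 T := ⟨hs.1.le, hs.2.trans t.2.2⟩
    have h1 := (hK s).dist_le_mul ((volterraMap hT hG v₀)^[k] v ⟨s, hs'⟩)
      ((volterraMap hT hG v₀)^[k] w ⟨s, hs'⟩)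
    rw [dist_eq_norm, dist_eq_norm] at h1
    rw [Set.projIcc_of_mem hT hs']
    exact h1.trans (mul_le_mul_of_nonneg_left (ih ⟨s, hs'⟩) K.2)

theorem exists_contractingWith_iterate_volterraMap (hT : 0 ≤ T)
    (hG : Continuous fun p : ℝ × H => G p.1 p.2) {K : NNReal} (hK : ∀ t, LipschitzWith K (G t))
    (v₀ : H) : ∃ k, ContractingWith (1 / 2) (volterraMap hT hG v₀)^[k] := by
  have h := FloorSemiring.tendsto_pow_div_factorial_atTop ((K : ℝ) * T)
  obtain ⟨k, hk⟩ := (h.eventually (gt_mem_nhds (show (0 : ℝ) < 1 / 2 by norm_num))).exists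
  refine ⟨k, by rw [← NNReal.coe_lt_coe]; norm_num, LipschitzWith.of_dist_le_mul fun v w => ?_⟩
  rw [ContinuousMap.dist_le (by positivity)]
  intro t
  rw [dist_eq_norm]
  refine (norm_iterate_volterraMap_sub_le hT hG hK v₀ v w k t).trans
    (mul_le_mul_of_nonneg_right ?_ dist_nonneg)
  refine le_trans ?_ (hk.le.trans (by simp))
  have := t.2.1
  have := t.2.2
  gcongr

variable [CompleteSpace H]

/-- Existence, uniqueness and localisation of the solution of `v(t) = v₀ + ∫₀ᵗ G(s, v(s)) ds`. -/
theorem exists_volterra_solution (hT : 0 ≤ T) (hG : Continuous fun p : ℝ × H => G p.1 p.2)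
    {K : NNReal} (hK : ∀ t, LipschitzWith K (G t)) (v₀ : H) :
    ∃ v : ℝ → H, Continuous v ∧ (∀ t ∈ Set.Icc 0 T, v t = v₀ + ∫ s in (0 : ℝ)..t, G s (v s)) ∧
      (∀ w : ℝ → H, ContinuousOn w (Set.Icc 0 T) →
        (∀ t ∈ Set.Icc 0 T, w t = v₀ + ∫ s in (0 : ℝ)..t, G s (w s)) →
        Set.EqOn w v (Set.Icc 0 T)) ∧
      ∀ C : ℝ → Set H, (∀ t, IsClosed (C t)) → (∀ t ∈ Set.Icc 0 T, v₀ ∈ C t) →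
        (∀ w : ℝ → H, Continuous w → (∀ t ∈ Set.Icc 0 T, w t ∈ C t) →
          ∀ t ∈ Set.Icc 0 T, v₀ + ∫ s in (0 : ℝ)..t, G s (w s) ∈ C t) →
        ∀ t ∈ Set.Icc 0 T, v t ∈ C t := by
  obtain ⟨k, hk⟩ := exists_contractingWith_iterate_volterraMap hT hG hK v₀
  obtain ⟨v, hv, hu, hC⟩ := hk.exists_fixedPoint_of_iterate
  refine ⟨fun s => v (Set.projIcc 0 T hT s), v.continuous.comp continuous_projIcc,
    fun t ht => ?_, fun w hw hwe t ht => ?_, fun C hCc hC0 hCm t ht => ?_⟩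
  · dsimp only
    rw [Set.projIcc_of_mem hT ht]
    conv_lhs => rw [← hv]
    rfl
  · let w' : C(Set.Icc 0 T, H) := ⟨_, hw.domRestrict⟩
    have hw' : volterraMap hT hG v₀ w' = w' := by
      ext r
      rw [volterraMap_apply]
      refine Eq.trans ?_ (hwe r r.2).symm
      congr 1
      refine intervalIntegral.integral_congr fun s hs => ?_
      rw [Set.uIcc_of_le r.2.1] at hs
      rw [Set.projIcc_of_mem hT ⟨hs.1, hs.2.trans r.2.2⟩]
      rfl
    dsimp only
    rw [Set.projIcc_of_mem hT ht, ← hu w' hw']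
    rfl
  -- The constraints cut out a closed invariant set of curves, nonempty since it contains the
  -- constant `v₀`.
  · have := hC {a | ∀ r : Set.Icc 0 T, a r ∈ C r} ?_ ⟨ContinuousMap.const _ v₀, fun r => hC0 r r.2⟩ ?_
    · simpa only [Set.projIcc_of_mem hT ht] using this ⟨t, ht⟩
    · simp only [Set.ofPred_forall]
      exact isClosed_iInter fun r => (hCc r).preimage (by fun_prop)
    · intro a ha r
      rw [volterraMap_apply]
      refine hCm _ (a.continuous.comp continuous_projIcc) (fun s hs => ?_) r r.2
      rw [Function.comp_apply, Set.projIcc_of_mem hT hs]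
      exact ha ⟨s, hs⟩

end Volterra

/-! ### Persistence of the range of a symmetric operator -/

section Regularity

variable {H : Type*} [NormedAddCommGroup H] [InnerProductSpace ℂ H] [CompleteSpace H]
  {G : ℝ → H → H} {L : H →L[ℂ] H} {T : ℝ}

/-- Membership in the image of a ball under `L` is expressed by scalar pairings, and these pass
through the integral. No measurability in time of the preimages is needed. -/
theorem norm_inner_integral_le (hL : ∀ f g, inner ℂ (L f) g = inner ℂ f (L g))
    (hG : Continuous fun p : ℝ × H => G p.1 p.2) {K : ℝ}
    (hLG : ∀ s g, ∃ g', L g' = G s (L g) ∧ ‖g'‖ ≤ K * ‖g‖) (hd : DenseRange L) {w : ℝ → H}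
    (hw : Continuous w) {ρ : ℝ → ℝ} (hρ : Continuous ρ) (hρ0 : ∀ t, 0 ≤ ρ t) (hK0 : 0 ≤ K)
    (h : ∀ t ∈ Set.Icc 0 T, ∀ k, ‖inner ℂ (w t) k‖ ≤ ρ t * ‖L k‖)
    {s t : ℝ} (hs : 0 ≤ s) (hst : s ≤ t) (ht : t ≤ T) (k : H) :
    ‖inner ℂ (∫ r in s..t, G r (w r)) k‖ ≤ (∫ r in s..t, K * ρ r) * ‖L k‖ := by
  have hc : Continuous fun r => G r (w r) := hG.comp (continuous_id.prodMk hw)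
  rw [norm_inner_symm, ← innerSL_apply_apply ℂ,
    ← (innerSL ℂ k).intervalIntegral_comp_comm (hc.intervalIntegrable _ _),
    ← intervalIntegral.integral_mul_const]
  refine intervalIntegral.norm_integral_le_of_norm_le hst (ae_of_all _ fun r hr => ?_)
    (Continuous.intervalIntegrable (by fun_prop) _ _)
  obtain ⟨g, hg, hgn⟩ := exists_preimage_of_norm_inner_le hL hd (hρ0 r)
    (h r ⟨hs.trans hr.1.le, hr.2.trans ht⟩)
  obtain ⟨g', hg', hgn'⟩ := hLG r g
  rw [innerSL_apply_apply, ← hg, ← hg', norm_inner_symm, hL]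
  refine (norm_inner_le_norm _ _).trans (mul_le_mul_of_nonneg_right ?_ (norm_nonneg _))
  exact hgn'.trans (mul_le_mul_of_nonneg_left hgn hK0)

/-- The solution of an integral equation stays in the range of `L`, and its preimage is continuous,
if the nonlinearity is bounded for the norm of the preimages. -/
theorem exists_volterra_solution_lift (hi : Function.Injective L)
    (hL : ∀ f g, inner ℂ (L f) g = inner ℂ f (L g)) (hd : DenseRange L) (hT : 0 ≤ T)
    (hG : Continuous fun p : ℝ × H => G p.1 p.2) {K₀ : NNReal}
    (hK₀ : ∀ t, LipschitzWith K₀ (G t)) {K : ℝ} (hK : 0 ≤ K)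
    (hLG : ∀ s g, ∃ g', L g' = G s (L g) ∧ ‖g'‖ ≤ K * ‖g‖) (g₀ : H) {v : ℝ → H}
    (hv : ContinuousOn v (Set.Icc 0 T))
    (hve : ∀ t ∈ Set.Icc 0 T, v t = L g₀ + ∫ s in (0 : ℝ)..t, G s (v s)) :
    ∃ g : ℝ → H, ContinuousOn g (Set.Icc 0 T) ∧ ∀ t ∈ Set.Icc 0 T, v t = L (g t) := by
  obtain ⟨w, hw, hwe, hu, hC⟩ := exists_volterra_solution hT hG hK₀ (L g₀)
  have hvw := hu v hv hve
  -- The solution of `ρ(t) = ‖g₀‖ + ∫₀ᵗ K ρ`, so that Picard iteration maps the constraint into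
  -- itself.
  let ρ : ℝ → ℝ := fun t => ‖g₀‖ * Real.exp (K * t)
  have hρ : Continuous ρ := by fun_prop
  have hρ0 : ∀ t, 0 ≤ ρ t := fun t => by positivity
  have hint : ∀ t, ‖g₀‖ + ∫ s in (0 : ℝ)..t, K * ρ s = ρ t := by
    intro t
    have hd : ∀ s ∈ Set.uIcc 0 t, HasDerivAt ρ (K * ρ s) s := fun s _ => by
      have h : HasDerivAt ρ (‖g₀‖ * (Real.exp (K * s) * (K * 1))) s :=
        (((hasDerivAt_id s).const_mul K).exp).const_mul ‖g₀‖
      have e : K * ρ s = ‖g₀‖ * (Real.exp (K * s) * (K * 1)) := by simp only [ρ]; ring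
      rwa [e]
    rw [intervalIntegral.integral_eq_sub_of_hasDerivAt hd
      (Continuous.intervalIntegrable (by fun_prop) _ _)]
    simp [ρ]
  have hb : ∀ t ∈ Set.Icc 0 T, ∀ k, ‖inner ℂ (w t) k‖ ≤ ρ t * ‖L k‖ := by
    have hL0 : ∀ k, ‖inner ℂ (L g₀) k‖ ≤ ‖g₀‖ * ‖L k‖ := fun k => by
      rw [hL]
      exact norm_inner_le_norm _ _
    -- This set is the image under `L` of the ball of radius `ρ t`, written so that its closedness
    -- in `H` is evident.
    refine hC (fun t => {f | ∀ k, ‖inner ℂ f k‖ ≤ ρ t * ‖L k‖}) (fun t => ?_) (fun t ht k => ?_)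
      (fun a ha hab t ht k => ?_)
    · simp only [Set.ofPred_forall]
      exact isClosed_iInter fun k => isClosed_le (by fun_prop) continuous_const
    · refine (hL0 k).trans (mul_le_mul_of_nonneg_right ?_ (norm_nonneg _))
      refine le_mul_of_one_le_right (norm_nonneg _) (Real.one_le_exp (mul_nonneg hK ht.1))
    · rw [inner_add_left, ← hint, add_mul]
      exact (norm_add_le _ _).trans (add_le_add (hL0 k)
        (norm_inner_integral_le hL hG hLG hd ha hρ hρ0 hK hab le_rfl ht.1 ht.2 k))
  have hex : ∀ t, ∃ g, t ∈ Set.Icc 0 T → L g = w t := fun t => by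
    by_cases ht : t ∈ Set.Icc 0 T
    · obtain ⟨g, hg, -⟩ := exists_preimage_of_norm_inner_le hL hd (hρ0 t) (hb t ht)
      exact ⟨g, fun _ => hg⟩
    · exact ⟨0, fun h => absurd h ht⟩
  choose g hg using hex
  have hmon : ∀ t ∈ Set.Icc 0 T, ρ t ≤ ρ T := fun t ht =>
    mul_le_mul_of_nonneg_left (Real.exp_le_exp.mpr (mul_le_mul_of_nonneg_left ht.2 hK))
      (norm_nonneg _)
  -- The pairing bound applied to the increment `w t - w s` yields a short preimage of it, which by
  -- injectivity of `L` is `g t - g s`.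
  have hlip : ∀ s ∈ Set.Icc 0 T, ∀ t ∈ Set.Icc 0 T, s ≤ t →
      ‖g t - g s‖ ≤ K * ρ T * (t - s) := by
    intro s hs t ht hst
    have e : w t - w s = ∫ r in s..t, G r (w r) := by
      have hc : Continuous fun r => G r (w r) := hG.comp (continuous_id.prodMk hw)
      rw [hwe t ht, hwe s hs, add_sub_add_left_eq_sub,
        intervalIntegral.integral_interval_sub_left (hc.intervalIntegrable _ _)
          (hc.intervalIntegrable _ _)]
    obtain ⟨d, hd1, hd2⟩ := exists_preimage_of_norm_inner_le hL hd (f := w t - w s)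
      (r := K * ρ T * (t - s))
      (mul_nonneg (mul_nonneg hK (hρ0 T)) (sub_nonneg.mpr hst)) fun k => by
        rw [e]
        refine (norm_inner_integral_le hL hG hLG hd hw hρ hρ0 hK hb hs.1 hst ht.2 k).trans
          (mul_le_mul_of_nonneg_right ?_ (norm_nonneg _))
        calc ∫ r in s..t, K * ρ r ≤ ∫ r in s..t, K * ρ T :=
              intervalIntegral.integral_mono_on hst
                (Continuous.intervalIntegrable (by fun_prop) _ _)
                (Continuous.intervalIntegrable (by fun_prop) _ _) fun r hr =>
                mul_le_mul_of_nonneg_left (hmon r ⟨hs.1.trans hr.1, hr.2.trans ht.2⟩) hK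
          _ = K * ρ T * (t - s) := by
              rw [intervalIntegral.integral_const, smul_eq_mul, mul_comm]
    have : d = g t - g s := hi (by rw [hd1, map_sub, hg t ht, hg s hs])
    rwa [← this]
  refine ⟨g, ?_, fun t ht => by rw [hg t ht, hvw ht]⟩
  refine (LipschitzOnWith.of_dist_le_mul (K := ⟨K * ρ T, mul_nonneg hK (hρ0 T)⟩)
    fun s hs t ht => ?_).continuousOn
  rw [dist_eq_norm, Real.dist_eq]
  rcases le_total s t with h | h
  · rw [norm_sub_rev, abs_sub_comm, abs_of_nonneg (sub_nonneg.mpr h)]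
    exact hlip s hs t ht h
  · rw [abs_of_nonneg (sub_nonneg.mpr h)]
    exact hlip t ht s hs h

end Regularity

/-! ### The mild equation as an integral equation -/

section Interaction

variable {H : Type*} [NormedAddCommGroup H] [InnerProductSpace ℂ H] {A : H →ₗ.[ℂ] H}
  {S : ℝ → H →L[ℂ] H} {F : H → H} {n : ℝ → ℝ} {K : NNReal}

theorem IsGroupGeneratedBy.continuous_uncurry (hS : IsGroupGeneratedBy A S) :
    Continuous fun p : ℝ × H => S p.1 p.2 :=
  continuous_prod_of_continuous_lipschitzWith' _ 1
    (fun t => LipschitzWith.of_dist_le_mul fun f g => by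
      rw [dist_eq_norm, ← map_sub, hS.isometry, dist_eq_norm, NNReal.coe_one, one_mul])
    hS.continuous

/-- The nonlinearity `i S(-n(s)) F(S(n(s)) f)` in the interaction picture. -/
noncomputable def interactionField (S : ℝ → H →L[ℂ] H) (F : H → H) (n : ℝ → ℝ) (s : ℝ) (f : H) :
    H :=
  Complex.I • S (-n s) (F (S (n s) f))

theorem continuous_interactionField (hS : IsGroupGeneratedBy A S) (hF : Continuous F)
    (hn : Continuous n) : Continuous fun p : ℝ × H => interactionField S F n p.1 p.2 := by
  have h1 : Continuous fun p : ℝ × H => S (n p.1) p.2 :=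
    hS.continuous_uncurry.comp ((hn.comp continuous_fst).prodMk continuous_snd)
  have h2 : Continuous fun p : ℝ × H => S (-n p.1) (F (S (n p.1) p.2)) :=
    hS.continuous_uncurry.comp ((hn.comp continuous_fst).neg.prodMk (hF.comp h1))
  exact h2.const_smul Complex.I

theorem lipschitzWith_interactionField (hS : IsGroupGeneratedBy A S) (hF : LipschitzWith K F)
    (t : ℝ) : LipschitzWith K (interactionField S F n t) := by
  refine LipschitzWith.of_dist_le_mul fun f g => ?_
  rw [interactionField, interactionField, dist_eq_norm, ← smul_sub, norm_smul, Complex.norm_I,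
    one_mul, ← map_sub, hS.isometry, dist_eq_norm]
  have h := hF.dist_le_mul (S (n t) f) (S (n t) g)
  rwa [dist_eq_norm, dist_eq_norm, ← map_sub, hS.isometry] at h

theorem interactionField_apply_neg (hS : IsGroupGeneratedBy A S) (s : ℝ) (f : H) :
    interactionField S F n s (S (-n s) f) = Complex.I • S (-n s) (F f) := by
  rw [interactionField, hS.apply_neg_apply]

/-- Factor `S(n(t) - n(s)) = S(n(t)) S(-n(s))` and take `S(n(t))` out of the integral. The function
`n'` is a continuous extension of `n` to the line, which makes the field continuous at all times. -/
theorem mild_eq_interaction [CompleteSpace H] (hS : IsGroupGeneratedBy A S) (hF : Continuous F)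
    {T : ℝ} {n' : ℝ → ℝ} (hn' : Continuous n') (hnn : Set.EqOn n n' (Set.Icc 0 T)) (u₀ : H)
    {u : ℝ → H} (hu : ContinuousOn u (Set.Icc 0 T)) {t : ℝ} (ht : t ∈ Set.Icc 0 T) :
    S (n t - n 0) u₀ + Complex.I • ∫ s in (0 : ℝ)..t, S (n t - n s) (F (u s)) =
      S (n' t) (S (-n' 0) u₀ +
        ∫ s in (0 : ℝ)..t, interactionField S F n' s (S (-n' s) (u s))) := by
  have h0 : (0 : ℝ) ∈ Set.Icc 0 T := ⟨le_rfl, ht.1.trans ht.2⟩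
  have hsub : Set.uIcc 0 t ⊆ Set.Icc 0 T := by
    rw [Set.uIcc_of_le ht.1]
    exact Set.Icc_subset_Icc_right ht.2
  have hint : IntervalIntegrable (fun s => S (-n' s) (F (u s))) volume 0 t := by
    refine ContinuousOn.intervalIntegrable ?_
    exact hS.continuous_uncurry.comp_continuousOn
      (hn'.neg.continuousOn.prodMk (hF.comp_continuousOn (hu.mono hsub)))
  simp only [interactionField_apply_neg hS]
  rw [map_add, ← hS.add_apply, ← sub_eq_add_neg, intervalIntegral.integral_smul, map_smul,
    ← (S (n' t)).intervalIntegral_comp_comm hint, hnn ht, hnn h0]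
  congr 2
  refine intervalIntegral.integral_congr fun s hs => ?_
  rw [← hS.add_apply, ← sub_eq_add_neg, hnn (hsub hs)]

end Interaction

namespace MetricGraph

variable {V I X : Type*} [Fintype I] [Fintype X] {Γ : MetricGraph V I X}
  {Δ : Γ.L2 →ₗ.[ℂ] Γ.L2} {S : ℝ → Γ.L2 →L[ℂ] Γ.L2} {θ : ℝ → ℝ} {σ R T : ℝ} {n n' : ℝ → ℝ}
  {u₀ : Γ.L2} {u v : ℝ → Γ.L2} {K : NNReal}

theorem IsMildSolution.interaction_eq (h : Γ.IsMildSolution S θ σ R T n u₀ u)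
    (hS : IsGroupGeneratedBy Δ S) (hF : Continuous (Γ.truncNonlin θ σ R)) (hn' : Continuous n')
    (hnn : Set.EqOn n n' (Set.Icc 0 T)) :
    ContinuousOn (fun t => S (-n' t) (u t)) (Set.Icc 0 T) ∧
      ∀ t ∈ Set.Icc 0 T, S (-n' t) (u t) = S (-n' 0) u₀ +
        ∫ s in (0 : ℝ)..t, interactionField S (Γ.truncNonlin θ σ R) n' s (S (-n' s) (u s)) := by
  refine ⟨hS.continuous_uncurry.comp_continuousOn (hn'.neg.continuousOn.prodMk h.continuousOn),
    fun t ht => ?_⟩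
  have e := (h.eq t ht).trans (mild_eq_interaction hS hF hn' hnn u₀ h.continuousOn ht)
  exact (congrArg (S (-n' t)) e).trans (hS.neg_apply_apply _ _)

theorem isMildSolution_of_interaction_eq (hS : IsGroupGeneratedBy Δ S)
    (hF : Continuous (Γ.truncNonlin θ σ R)) (hn' : Continuous n')
    (hnn : Set.EqOn n n' (Set.Icc 0 T)) (hv : Continuous v)
    (h : ∀ t ∈ Set.Icc 0 T, v t = S (-n' 0) u₀ +
      ∫ s in (0 : ℝ)..t, interactionField S (Γ.truncNonlin θ σ R) n' s (v s)) :
    Γ.IsMildSolution S θ σ R T n u₀ fun t => S (n' t) (v t) := by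
  have hc : Continuous fun t => S (n' t) (v t) := hS.continuous_uncurry.comp (hn'.prodMk hv)
  refine ⟨hc.continuousOn, fun t ht => ?_⟩
  refine Eq.trans ?_ (mild_eq_interaction hS hF hn' hnn u₀ hc.continuousOn ht).symm
  simp only [hS.neg_apply_apply]
  exact congrArg (S (n' t)) (h t ht)

theorem exists_isMildSolution (hS : IsGroupGeneratedBy Δ S)
    (hF : LipschitzWith K (Γ.truncNonlin θ σ R)) (hT : 0 ≤ T) (hn : ContinuousOn n (Set.Icc 0 T))
    (u₀ : Γ.L2) :
    ∃ u : ℝ → Γ.L2, Γ.IsMildSolution S θ σ R T n u₀ u ∧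
      ∀ v : ℝ → Γ.L2, Γ.IsMildSolution S θ σ R T n u₀ v → Set.EqOn v u (Set.Icc 0 T) := by
  -- Outside `[0, T]` the function `n` is continued by its end values.
  have hn' : Continuous (Set.IccExtend hT ((Set.Icc 0 T).domRestrict n)) := hn.domRestrict.Icc_extend'
  have hnn : Set.EqOn n (Set.IccExtend hT ((Set.Icc 0 T).domRestrict n)) (Set.Icc 0 T) :=
    fun t ht => by rw [Set.IccExtend_of_mem hT _ ht]; rfl
  obtain ⟨v, hv, hve, hvu, -⟩ := exists_volterra_solution hT
    (continuous_interactionField hS hF.continuous hn')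
    (lipschitzWith_interactionField hS hF) (S (-_) u₀)
  refine ⟨_, isMildSolution_of_interaction_eq hS hF.continuous hn' hnn hv hve,
    fun w hw t ht => ?_⟩
  obtain ⟨h1, h2⟩ := hw.interaction_eq hS hF.continuous hn' hnn
  have h3 := hvu _ h1 h2 ht
  dsimp only at h3 ⊢
  rw [← h3, hS.apply_neg_apply]

variable [DecidableEq V] {A B : Γ.VertexMatrices} {M : ℝ}

/-- The nonlinearity in the interaction picture, for preimages under the square root of the
form. -/
theorem exists_interactionField_lift {L : Γ.L2 →L[ℂ] Γ.L2} (hS : IsGroupGeneratedBy Δ S)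
    (hLS : ∀ t, Commute L (S t)) {C₁ C₂ : ℝ}
    (h₁ : ∀ g, L g ∈ Γ.energyDomain B ∧ Γ.sobolevNorm (L g) ≤ C₁ * ‖g‖) (hC₂ : 0 ≤ C₂)
    (h₂ : ∀ f ∈ Γ.energyDomain B, ∃ g, L g = f ∧ ‖g‖ ≤ C₂ * Γ.sobolevNorm f)
    (hF : ∀ w ∈ Γ.energyDomain B, Γ.truncNonlin θ σ R w ∈ Γ.energyDomain B ∧
      Γ.sobolevNorm (Γ.truncNonlin θ σ R w) ≤ K * Γ.sobolevNorm w) (s : ℝ) (g : Γ.L2) :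
    ∃ g', L g' = interactionField S (Γ.truncNonlin θ σ R) n s (L g) ∧
      ‖g'‖ ≤ C₂ * (K * C₁) * ‖g‖ := by
  have hc : ∀ t f, L (S t f) = S t (L f) := fun t f =>
    congrArg (fun Q : Γ.L2 →L[ℂ] Γ.L2 => Q f) (hLS t)
  obtain ⟨h3, h4⟩ := h₁ (S (n s) g)
  obtain ⟨h5, h6⟩ := hF _ h3
  obtain ⟨f, hf, hfn⟩ := h₂ _ h5
  refine ⟨Complex.I • S (-n s) f, ?_, ?_⟩
  · rw [map_smul, hc, hf, hc, interactionField]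
  · rw [norm_smul, Complex.norm_I, one_mul, hS.isometry]
    rw [hS.isometry] at h4
    calc ‖f‖ ≤ C₂ * (K * (C₁ * ‖g‖)) := hfn.trans (mul_le_mul_of_nonneg_left
          (h6.trans (mul_le_mul_of_nonneg_left h4 K.2)) hC₂)
      _ = _ := by ring

variable [Fintype V]

theorem IsFormConstant.exists_energyNorm_le (hM : Γ.IsFormConstant A B M) :
    ∃ C : ℝ, ∀ u ∈ Γ.energyDomain B, Γ.energyNorm A B M u ≤ C * Γ.sobolevNorm u := by
  obtain ⟨-, c, C, -, h⟩ := hM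
  refine ⟨√|C|, fun u hu => ?_⟩
  rw [energyNorm, sobolevNorm, ← Real.sqrt_mul (abs_nonneg C)]
  refine Real.sqrt_le_sqrt ((h u hu).2.trans ?_)
  exact mul_le_mul_of_nonneg_right (le_abs_self C) (by positivity)

/-- The lifted interaction solution gives `u(t) = L(S(n(t)) g(t))` with `g` continuous in `L²`. As
`L` is bounded from `L²` to the form norm, continuity in `D(𝓔)` follows from continuity of `S(n(t))
g(t)` in `L²`. -/
theorem IsMildSolution.continuousInEnergyDomain (h : Γ.IsMildSolution S θ σ R T n u₀ u)
    (hsa : IsSelfAdjoint (Γ.laplacian A B)) (hS : IsGroupGeneratedBy (Γ.laplacian A B) S)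
    (hFL : LipschitzWith K (Γ.truncNonlin θ σ R)) (hT : 0 ≤ T)
    (hn : ContinuousOn n (Set.Icc 0 T)) (hu₀ : u₀ ∈ Γ.energyDomain B)
    (hF : ∀ w ∈ Γ.energyDomain B, Γ.truncNonlin θ σ R w ∈ Γ.energyDomain B ∧
      Γ.sobolevNorm (Γ.truncNonlin θ σ R w) ≤ K * Γ.sobolevNorm w)
    (hM : Γ.IsFormConstant A B M) : Γ.ContinuousInEnergyDomain A B M T u := by
  obtain ⟨L, hLi, hLs, hLd, hLc, ⟨C₁, hC₁, h₁⟩, C₂, hC₂, h₂⟩ := exists_formSqrt hsa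
  have hLS := hLc S hS
  have hc : ∀ t f, L (S t f) = S t (L f) := fun t f =>
    congrArg (fun Q : Γ.L2 →L[ℂ] Γ.L2 => Q f) (hLS t)
  obtain ⟨n', hn', hnn⟩ : ∃ n', Continuous n' ∧ Set.EqOn n n' (Set.Icc 0 T) :=
    ⟨Set.IccExtend hT ((Set.Icc 0 T).domRestrict n), hn.domRestrict.Icc_extend',
      fun t ht => by rw [Set.IccExtend_of_mem hT _ ht]; rfl⟩
  obtain ⟨hv, hve⟩ := h.interaction_eq hS hFL.continuous hn' hnn
  obtain ⟨g₀, hg₀, -⟩ := h₂ u₀ hu₀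
  rw [← hg₀, ← hc] at hve
  obtain ⟨g, hg, hvg⟩ := exists_volterra_solution_lift hLi hLs hLd hT
    (continuous_interactionField hS hFL.continuous hn')
    (lipschitzWith_interactionField hS hFL) (K := C₂ * (K * C₁)) (by positivity)
    (exists_interactionField_lift hS hLS h₁ hC₂ h₂ hF) _ hv hve
  have hug : ∀ t ∈ Set.Icc 0 T, u t = L (S (n' t) (g t)) := fun t ht => by
    rw [hc, ← hvg t ht, hS.apply_neg_apply]
  have hgc : ContinuousOn (fun t => S (n' t) (g t)) (Set.Icc 0 T) :=
    hS.continuous_uncurry.comp_continuousOn (hn'.continuousOn.prodMk hg)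
  refine ⟨fun t ht => hug t ht ▸ (h₁ _).1, fun t ht => ?_⟩
  obtain ⟨C, hC⟩ := hM.exists_energyNorm_le
  have hlim : Tendsto (fun s => |C| * (C₁ * ‖S (n' s) (g s) - S (n' t) (g t)‖))
      (𝓝[Set.Icc 0 T] t) (𝓝 0) := by
    have := (((hgc t ht).sub_const (S (n' t) (g t))).norm.const_mul C₁).const_mul |C|
    simpa using this
  refine squeeze_zero' (Eventually.of_forall fun s => Real.sqrt_nonneg _) ?_ hlim
  filter_upwards [self_mem_nhdsWithin] with s hs
  have hm := h₁ (S (n' s) (g s) - S (n' t) (g t))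
  rw [map_sub, ← hug s hs, ← hug t ht] at hm
  refine (hC _ hm.1).trans ?_
  refine (mul_le_mul_of_nonneg_right (le_abs_self C) (sobolevNorm_nonneg _)).trans ?_
  exact mul_le_mul_of_nonneg_left hm.2 (abs_nonneg C)

end MetricGraph

/-! ### The main theorem -/

theorem theorem2p11 {V I X : Type*} [Fintype V] [DecidableEq V] [Fintype I] [Fintype X]
    (Γ : MetricGraph V I X) (A B : Γ.VertexMatrices)
    (hsa : IsSelfAdjoint (Γ.laplacian A B))
    (θ : ℝ → ℝ) (hθ : IsCutoff θ) (σ R : ℝ) (hσ : 1 / 2 ≤ σ) (hR : 0 < R)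
    (T : ℝ) (hT : 0 < T) (n : ℝ → ℝ) (hn : ContinuousOn n (Set.Icc 0 T)) :
    -- the group `e^{itΔ_Γ}` and the norm of `D(𝓔)` are well defined
    (∃! S : ℝ → Γ.L2 →L[ℂ] Γ.L2, IsGroupGeneratedBy (Γ.laplacian A B) S) ∧
    (∃ M : ℝ, Γ.IsFormConstant A B M) ∧
    ∀ S : ℝ → Γ.L2 →L[ℂ] Γ.L2, IsGroupGeneratedBy (Γ.laplacian A B) S → ∀ u₀ : Γ.L2,
      (∃ u : ℝ → Γ.L2, Γ.IsMildSolution S θ σ R T n u₀ u ∧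
        ∀ v : ℝ → Γ.L2, Γ.IsMildSolution S θ σ R T n u₀ v → Set.EqOn v u (Set.Icc 0 T)) ∧
      (u₀ ∈ Γ.energyDomain B →
        (∀ w ∈ Γ.energyDomain B, Γ.truncNonlin θ σ R w ∈ Γ.energyDomain B) →
        ∀ u : ℝ → Γ.L2, Γ.IsMildSolution S θ σ R T n u₀ u →
          ∀ M : ℝ, Γ.IsFormConstant A B M → Γ.ContinuousInEnergyDomain A B M T u) := by
  obtain ⟨M, hM⟩ := MetricGraph.exists_isFormConstant
    (fun v => MetricGraph.isLagrangianCondition hsa v)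
  obtain ⟨S, hS⟩ := exists_isGroupGeneratedBy hsa (hM.isCoerciveAt hsa)
  obtain ⟨K, hK⟩ := exists_lipschitzWith_truncF hθ hσ hR
  have hFL := MetricGraph.lipschitzWith_truncNonlin (Γ := Γ) hθ hσ hR hK
  refine ⟨⟨S, hS, fun S' hS' => hS'.eq_of_isSelfAdjoint hsa hS⟩, ⟨M, hM⟩, fun S' hS' u₀ =>
    ⟨MetricGraph.exists_isMildSolution hS' hFL hT.le hn u₀, fun hu₀ hF u hu M' hM' => ?_⟩⟩
  exact hu.continuousInEnergyDomain hsa hS' hFL hT.le hn hu₀ (fun w hw =>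
    ⟨hF w hw, MetricGraph.sobolevNorm_truncNonlin_le hθ hσ hR hK hw (hF w hw)⟩) hM'
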